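/- **Setting.** Let $\Lambda\subset\mathbb R^d$ be a lattice: a connected bipartite graph whose white vertices form a full-rank lattice $L\subset\mathbb R^d$ (a linear image of $\mathbb Z^d$), whose black vertices form a translate $L+v_0$ with $v_0\notin L$, and in which every white vertex $w$ is joined to $w+e_1,\dots,w+e_D$ for fixed distinct vectors $e_1,\dots,e_D\in L+v_0$ with $\sum_j e_j=0$. Let $\mathcal N=\mathrm{conv}\{e_1,\dots,e_D\}$ be its Newton polytope, $F(a)=\log\sum_{j=1}^D e^{\,e_j\cdot a}$ ($a\in\mathbb R^d$) its free energy, and $\sigma(s)=\sup_{a\in\mathbb R^d}\,(s\cdot a-F(a))$ ($s\in\mathcal N$) its surface tension. Let $R\subset\mathbb R^d$ be compact and connected, equal to the closure of its interior $R^\circ$, with $|\partial R|=0$ (for instance with piecewise smooth boundary). An asymptotic flow on $R$ is a measurable vector field supported in $R$, valued in $\mathcal N$ and divergence-free on $R^\circ$ in the sense of distributions. Its boundary value is a finite signed measure $b$ if $\int_R\omega\cdot\nabla\varphi\,dx=\int\varphi\,db$ for all $\varphi\in C_c^\infty(\mathbb R^d)$ (that is, $b=\langle\omega,\xi\rangle\,dS_{\partial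 R}$, with $\xi$ the outward unit normal, when everything is smooth). A limit shape for $(R,b)$ is a minimizer $\omega$ of $\int_R\sigma(\omega(x))\,dx$ among the asymptotic flows on $R$ with boundary value $b$; its gauge flow is $\alpha=\nabla\sigma(\omega)$. All equations below hold in $R^\circ$ in the sense of distributions, for locally integrable fields. **Theorem.** (1) Let $\omega$ be a limit shape for $(R,b)$ without facets, in the sense that every point of $R^\circ$ has a neighborhood on which $\omega$ takes values (almost everywhere) in a compact subset of the interior of $\mathcal N$. Then its gauge flow $\alpha$ satisfies $\omega=\nabla F(\alpha)$ almost everywhere in $R^\circ$ and solves the dual Euler–Lagrange equations $$\operatorname{div}(\nabla F(\alpha))=0,\qquad \partial_{x_i}\alpha_j=\partial_{x_j}\alpha_i\quad\text{for all } i,j .$$ Moreover $\alpha=\nabla H_0$ for a weak solution $H_0$ of the gauge equation $\operatorname{div}(\nabla F(\nabla H_0))=0$ in $R^\circ$. If such an $H_0$ has boundary values $H_0|_{\partial R}=H_b$ (meaning that $H_0(x)\to H_b(y)$ as $x\to y$ in $R^\circ$ for every $y\in\partial R$, up to null sets of $x$), then every weak solution $H$ of $\operatorname{div}(\nabla F(\nabla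 H))=0$ in $R^\circ$ with $H|_{\partial R}=H_b$ satisfies $H=H_0$ and $\nabla H=\alpha$ almost everywhere in $R^\circ$. (2) Conversely, let $A$ be a vector field on $R^\circ$ with $\operatorname{div}(\nabla F(A))=0$ and $\partial_{x_i}A_j=\partial_{x_j}A_i$ for all $i,j$ (for example $A=\nabla H$ with $H$ a weak solution of the gauge equation). Suppose that $A$ is an $L^1(R^\circ)$-limit of gradients of functions in $C_c^\infty(\mathbb R^d)$ (for Lipschitz $R$ this holds for $A=\nabla H$ with any $H\in W^{1,1}(R^\circ)$), and that the flow equal to $\nabla F(A)$ on $R^\circ$ and to $0$ elsewhere has boundary value $b$. Then this flow is a limit shape for $(R,b)$, and every limit shape $\omega$ for $(R,b)$ satisfies $\omega=\nabla F(A)$ and has gauge flow $\alpha=A$ almost everywhere in $R^\circ$. In particular the gauge flow is the only such solution of the dual Euler–Lagrange equations. -/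

import Mathlib

open MeasureTheory Filter Topology Set

noncomputable section

/-- Euclidean space `ℝ^d`. -/
abbrev Vec (d : ℕ) := EuclideanSpace ℝ (Fin d)

/-! ### Lattices, free energy, surface tension -/

/-- The bipartite graph whose white vertices are the points of `L`, whose black vertices are the
points of `L + v`, and in which each white vertex `w` is joined to the points `w + e`, `e ∈ S`. -/
def bipartiteGraph {d : ℕ} (L : Submodule ℤ (Vec d)) (v : Vec d) (S : Finset (Vec d)) :
    SimpleGraph {x : Vec d // x ∈ L ∨ x - v ∈ L} :=
  SimpleGraph.fromRel (fun x y => x.1 ∈ L ∧ y.1 - x.1 ∈ S)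

/-- A `d`-dimensional lattice of the multinomial dimer model: a connected, harmonically embedded,
regular bipartite graph in `ℝ^d` on which a full-rank group of translations (a linear image of
`ℤ^d`) acts transitively on white vertices and transitively on black vertices. -/
structure DimerLattice (d : ℕ) where
  /-- a basis of the group of translations, which is also the set of white vertices -/
  basis : Module.Basis (Fin d) ℝ (Vec d)
  /-- the black vertices are the white ones translated by `offset` -/
  offset : Vec d
  /-- the edge vectors `e_1, …, e_D` at a white vertex -/
  edges : Finset (Vec d)
  offset_notMem : offset ∉ Submodule.span ℤ (Set.range basis)
  edges_mem : ∀ e ∈ edges, e - offset ∈ Submodule.span ℤ (Set.range basis)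
  sum_edges : ∑ e ∈ edges, e = 0
  connected : (bipartiteGraph (Submodule.span ℤ (Set.range basis)) offset edges).Connected

namespace DimerLattice

variable {d : ℕ} (Λ : DimerLattice d)

/-- The Newton polytope: the convex hull of the edge vectors. -/
def newtonPolytope : Set (Vec d) := convexHull ℝ (Λ.edges : Set (Vec d))

/-- The free energy `F(α) = log ∑_j exp (e_j · α)`. -/
def freeEnergy (a : Vec d) : ℝ := Real.log (∑ e ∈ Λ.edges, Real.exp (inner ℝ e a))

/-- The surface tension, the Legendre dual of the free energy; its domain is the Newton polytope
(on which the supremum is over a set of reals that is bounded above by `0`). -/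
def surfaceTension (s : Vec d) : ℝ := ⨆ a : Vec d, (inner ℝ s a - Λ.freeEnergy a)

end DimerLattice

/-! ### Weak derivatives on an open set -/

/-- Smooth functions with compact support contained in `Ω`. -/
def IsTestFunction {d : ℕ} (Ω : Set (Vec d)) (φ : Vec d → ℝ) : Prop :=
  ContDiff ℝ (⊤ : ℕ∞) φ ∧ HasCompactSupport φ ∧ tsupport φ ⊆ Ω

/-- `div V = 0` on `Ω` in the sense of distributions. -/
def IsWeaklyDivFree {d : ℕ} (Ω : Set (Vec d)) (V : Vec d → Vec d) : Prop :=
  LocallyIntegrableOn V Ω volume ∧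
    ∀ φ, IsTestFunction Ω φ → ∫ x in Ω, inner ℝ (V x) (gradient φ x) = 0

/-- `∂_i V_j = ∂_j V_i` on `Ω` in the sense of distributions, for all `i`, `j`. -/
def IsWeaklyCurlFree {d : ℕ} (Ω : Set (Vec d)) (V : Vec d → Vec d) : Prop :=
  LocallyIntegrableOn V Ω volume ∧
    ∀ φ, IsTestFunction Ω φ → ∀ i j : Fin d,
      ∫ x in Ω, (V x j * gradient φ x i - V x i * gradient φ x j) = 0

/-- `A` is the weak gradient of `H` on `Ω`. -/
def HasWeakGradient {d : ℕ} (Ω : Set (Vec d)) (H : Vec d → ℝ) (A : Vec d → Vec d) : Prop :=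
  LocallyIntegrableOn H Ω volume ∧ LocallyIntegrableOn A Ω volume ∧
    ∀ φ, IsTestFunction Ω φ → ∀ i : Fin d,
      ∫ x in Ω, H x * gradient φ x i = - ∫ x in Ω, A x i * φ x

/-- `H` is a weak solution of `div (∇F(∇H)) = 0` on `Ω`, with weak gradient `A = ∇H`. -/
def IsWeakGaugeSolution {d : ℕ} (Λ : DimerLattice d) (Ω : Set (Vec d))
    (H : Vec d → ℝ) (A : Vec d → Vec d) : Prop :=
  HasWeakGradient Ω H A ∧ IsWeaklyDivFree Ω (fun x => gradient Λ.freeEnergy (A x))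

/-! ### Asymptotic flows and limit shapes -/

/-- Asymptotic flows on `R`: measurable vector fields supported in `R`, divergence-free in the
interior of `R` as distributions, and valued in the Newton polytope. -/
def IsAsymptoticFlow {d : ℕ} (Λ : DimerLattice d) (R : Set (Vec d)) (ω : Vec d → Vec d) : Prop :=
  AEStronglyMeasurable ω volume ∧ (∀ᵐ x, x ∉ R → ω x = 0) ∧
    IsWeaklyDivFree (interior R) ω ∧ ∀ᵐ x, x ∈ R → ω x ∈ Λ.newtonPolytope

/-- The integral of a function against a signed measure. -/
def signedIntegral {d : ℕ} (b : SignedMeasure (Vec d)) (φ : Vec d → ℝ) : ℝ :=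
  ∫ x, φ x ∂b.toJordanDecomposition.posPart - ∫ x, φ x ∂b.toJordanDecomposition.negPart

/-- The boundary value (outward flux through `∂R`) of the flow `ω` is the signed measure `b`. For
a smooth divergence-free `ω` and piecewise smooth `∂R`, the divergence theorem gives
`∫_R ω · ∇φ = ∫_{∂R} φ (ω · ξ) dS`, with `ξ` the outward unit normal, so that `b` has density
`ω · ξ` with respect to surface measure; the identity below extends this to measurable flows
by continuity for weak convergence. -/
def HasBoundaryFlux {d : ℕ} (R : Set (Vec d)) (ω : Vec d → Vec d)
    (b : SignedMeasure (Vec d)) : Prop :=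
  ∀ φ : Vec d → ℝ, ContDiff ℝ (⊤ : ℕ∞) φ → HasCompactSupport φ →
    ∫ x in R, inner ℝ (ω x) (gradient φ x) = signedIntegral b φ

/-- `ω` is a limit shape for `(R, b)`: it minimizes `∫_R σ(ω)` among all asymptotic flows on `R`
with boundary value `b`. -/
def IsLimitShape {d : ℕ} (Λ : DimerLattice d) (R : Set (Vec d)) (b : SignedMeasure (Vec d))
    (ω : Vec d → Vec d) : Prop :=
  IsAsymptoticFlow Λ R ω ∧ HasBoundaryFlux R ω b ∧
    ∀ ω', IsAsymptoticFlow Λ R ω' → HasBoundaryFlux R ω' b →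
      ∫ x in R, Λ.surfaceTension (ω x) ≤ ∫ x in R, Λ.surfaceTension (ω' x)

/-- The flow `ω` has no facets, locally uniformly in the interior of `R`: every interior point of `R` has a neighborhood on which `ω` is
valued, almost everywhere, in a compact subset of the interior of the Newton polytope. -/
def IsFacetFree {d : ℕ} (Λ : DimerLattice d) (R : Set (Vec d)) (ω : Vec d → Vec d) : Prop :=
  ∀ x ∈ interior R, ∃ U ∈ 𝓝 x, ∃ C : Set (Vec d), IsCompact C ∧
    C ⊆ interior Λ.newtonPolytope ∧ ∀ᵐ y, y ∈ U → ω y ∈ C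

/-- The gauge flow `α = ∇σ(ω)` dual to the flow `ω`. -/
def gaugeFlow {d : ℕ} (Λ : DimerLattice d) (ω : Vec d → Vec d) (x : Vec d) : Vec d :=
  gradient Λ.surfaceTension (ω x)

/-- The flow on `R` dual to the vector field `A` on the interior of `R`: it is `∇F(A)` there,
and zero elsewhere. -/
def dualFlow {d : ℕ} (Λ : DimerLattice d) (R : Set (Vec d)) (A : Vec d → Vec d) : Vec d → Vec d :=
  (interior R).indicator (fun x => gradient Λ.freeEnergy (A x))

/-! ### Boundary conditions for gauge functions -/

/-- `H = Hb` on `∂R`: at every `y ∈ ∂R` the function `H` on the interior of `R` (defined up to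
null sets) has the limit `Hb y`. -/
def HasBoundaryValues {d : ℕ} (R : Set (Vec d)) (H : Vec d → ℝ) (Hb : Vec d → ℝ) : Prop :=
  ∀ y ∈ frontier R, Tendsto H (𝓝[interior R] y ⊓ ae volume) (𝓝 (Hb y))

/-- The gradient field `A` is `L¹` up to the boundary of `R`: it is the limit in `L¹` of the
interior of `R` of gradients of smooth functions on `ℝ^d`. If `∂R` is Lipschitz, this holds for the
gradient of every function in `W^{1,1}(R)`. -/
def IsGradientUpToBoundary {d : ℕ} (R : Set (Vec d)) (A : Vec d → Vec d) : Prop :=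
  ∃ φ : ℕ → Vec d → ℝ, (∀ n, ContDiff ℝ (⊤ : ℕ∞) (φ n) ∧ HasCompactSupport (φ n)) ∧
    Tendsto (fun n => ∫⁻ x in interior R, ‖gradient (φ n) x - A x‖ₑ) atTop (𝓝 0)

end

/-! The proof is convex duality. Connectedness and the zero sum of the edge vectors make `F`
strictly convex, so `∇F` is injective with values in `N`. It is also open and reaches every interior
point of `N`, and `∇σ` is its continuous inverse on `interior N` (`freeEnergy_add_inner_lt`,
`exists_gradient_freeEnergy_eq_near`, `gradient_surfaceTension_gradient`).

Part (1). A limit shape without facets can be perturbed by any bounded divergence-free field `V`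
with compact support in the interior of `R`. The first variation shows that `α = ∇σ(ω)` is
orthogonal to every such `V` (`IsLimitShape.integral_inner_gaugeFlow_eq_zero`). In `L²(K)`, with `K`
compact, the fields orthogonal to all gradients are those whose extension by zero is
divergence-free, so `α` is a limit of gradients on `K` (`toLp_mem_closure`). Approximations with
summable errors, renormalized on each component by means of a Poincaré inequality, add up to a
potential `H₀` (`exists_hasWeakGradient_of_tsum`). The gauge equation for `H₀` is `div ω = 0`
rewritten through `ω = ∇F(α)`.

Two solutions with the same boundary values are compared by testing the divergence-free field
`∇F(∇H) - ∇F(∇H')` with a smooth truncation of `H - H' - δ`, whose support is compact in the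
interior. Strict monotonicity of `∇F` makes the gradient of the truncation vanish, hence the
truncation itself (`HasWeakGradient.ae_le_of_isWeaklyDivFree`).

Part (2) is a calibration argument. The tangent plane inequality bounds `σ(ω) - σ(∇F(A))` below by
`⟪ω - ∇F(A), A⟫`. The integral of the latter is zero, because `A` is an `L¹` limit of gradients and
both flows have the same boundary value. Equality in the tangent plane inequality forces `ω = ∇F(A)`
(`isLimitShape_dualFlow`). -/

namespace DimerLattice

variable {d : ℕ} (Λ : DimerLattice d)

/-! ### The edge vectors -/

/-- The linear functional `⟪·, a⟫` does not change along an edge of the graph, so connectedness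
makes it constant on vertices, with the value it takes at `0`. -/
lemma inner_vertex_eq_zero {a : Vec d} (h : ∀ e ∈ Λ.edges, inner ℝ e a = 0) {x : Vec d}
    (hx : x ∈ Submodule.span ℤ (Set.range Λ.basis)) : inner ℝ x a = 0 := by
  have key : ∀ y z : {x : Vec d // x ∈ Submodule.span ℤ (Set.range Λ.basis) ∨
      x - Λ.offset ∈ Submodule.span ℤ (Set.range Λ.basis)},
      (bipartiteGraph (Submodule.span ℤ (Set.range Λ.basis)) Λ.offset Λ.edges).Reachable y z →
        inner ℝ y.1 a = inner ℝ z.1 a := by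
    rintro y z ⟨w⟩
    induction w with
    | nil => rfl
    | cons hadj _ ih =>
      rw [← ih]
      rw [bipartiteGraph, SimpleGraph.fromRel_adj] at hadj
      rcases hadj.2 with h1 | h1
      · have := h _ h1.2
        rw [inner_sub_left] at this
        linarith
      · have := h _ h1.2
        rw [inner_sub_left] at this
        linarith
  have := key ⟨x, Or.inl hx⟩ ⟨0, Or.inl (zero_mem _)⟩ (Λ.connected.preconnected _ _)
  simpa using this

lemma eq_zero_of_inner_edges_eq_zero {a : Vec d} (h : ∀ e ∈ Λ.edges, inner ℝ e a = 0) : a = 0 := by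
  have hb : (innerSL ℝ a : Vec d →L[ℝ] ℝ).toLinearMap = 0 := Λ.basis.ext fun i => by
    have := Λ.inner_vertex_eq_zero h (Submodule.subset_span ⟨i, rfl⟩)
    simpa [real_inner_comm] using this
  exact inner_self_eq_zero.1 (LinearMap.congr_fun hb a)

/-- Summing over the edges gives `card * c = 0`, since the edge vectors add up to zero. Directions
in which all `⟪e, a⟫` agree are those in which `F` is affine; excluding them is what strict
convexity needs. -/
lemma eq_zero_of_inner_edges_eq_const {a : Vec d} {c : ℝ}
    (h : ∀ e ∈ Λ.edges, inner ℝ e a = c) : a = 0 := by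
  refine Λ.eq_zero_of_inner_edges_eq_zero fun e he => ?_
  have hsum : ∑ e ∈ Λ.edges, inner ℝ e a = 0 := by
    rw [← sum_inner, Λ.sum_edges, inner_zero_left]
  rw [Finset.sum_congr rfl h, Finset.sum_const, nsmul_eq_mul] at hsum
  have : (Λ.edges.card : ℝ) ≠ 0 := by
    exact_mod_cast (Finset.card_pos.2 ⟨e, he⟩).ne'
  rw [h e he]
  exact (mul_eq_zero.1 hsum).resolve_left this

lemma offset_ne_zero : Λ.offset ≠ 0 := fun h => Λ.offset_notMem (h ▸ zero_mem _)

/-- Without edges the offset would be vacuously orthogonal to all of them, hence zero and a white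
vertex. -/
lemma edges_nonempty : Λ.edges.Nonempty := by
  rw [Finset.nonempty_iff_ne_empty]
  intro h
  exact Λ.offset_ne_zero (Λ.eq_zero_of_inner_edges_eq_zero (by simp [h]))

lemma dim_pos {d : ℕ} (Λ : DimerLattice d) : 0 < d := by
  rcases Nat.eq_zero_or_pos d with rfl | h
  · exact absurd (Subsingleton.elim _ _) Λ.offset_ne_zero
  · exact h

/-! ### The free energy -/

/-- The partition function `∑_j exp (e_j · a)`. -/
noncomputable def partition (a : Vec d) : ℝ := ∑ e ∈ Λ.edges, Real.exp (inner ℝ e a)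

/-- The Gibbs weight of an edge. -/
noncomputable def weight (a e : Vec d) : ℝ := Real.exp (inner ℝ e a) / Λ.partition a

lemma partition_pos (a : Vec d) : 0 < Λ.partition a :=
  Finset.sum_pos (fun _ _ => Real.exp_pos _) Λ.edges_nonempty

lemma weight_pos (a e : Vec d) : 0 < Λ.weight a e := div_pos (Real.exp_pos _) (Λ.partition_pos a)

lemma sum_weight (a : Vec d) : ∑ e ∈ Λ.edges, Λ.weight a e = 1 := by
  simp only [weight]
  rw [← Finset.sum_div]
  exact div_self (Λ.partition_pos a).ne'

lemma hasGradientAt_freeEnergy (a : Vec d) :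
    HasGradientAt Λ.freeEnergy (∑ e ∈ Λ.edges, Λ.weight a e • e) a := by
  rw [hasGradientAt_iff_hasFDerivAt]
  have h1 : HasFDerivAt Λ.partition
      (∑ e ∈ Λ.edges, Real.exp (inner ℝ e a) • (innerSL ℝ e : Vec d →L[ℝ] ℝ)) a := by
    have : ∀ e ∈ Λ.edges, HasFDerivAt (fun a : Vec d => Real.exp (inner ℝ e a))
        (Real.exp (inner ℝ e a) • (innerSL ℝ e : Vec d →L[ℝ] ℝ)) a := fun e _ =>
      (innerSL ℝ e : Vec d →L[ℝ] ℝ).hasFDerivAt.exp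
    exact HasFDerivAt.fun_sum this
  have h2 := h1.log (Λ.partition_pos a).ne'
  refine HasFDerivAt.congr_fderiv (f := Λ.freeEnergy) h2 ?_
  ext v
  simp [weight, Finset.mul_sum, div_eq_inv_mul, mul_assoc]

lemma gradient_freeEnergy (a : Vec d) :
    gradient Λ.freeEnergy a = ∑ e ∈ Λ.edges, Λ.weight a e • e :=
  (Λ.hasGradientAt_freeEnergy a).gradient

lemma continuous_freeEnergy : Continuous Λ.freeEnergy :=
  continuous_iff_continuousAt.2 fun a => (Λ.hasGradientAt_freeEnergy a).continuousAt

lemma gradient_freeEnergy_mem (a : Vec d) : gradient Λ.freeEnergy a ∈ Λ.newtonPolytope := by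
  rw [gradient_freeEnergy]
  exact (convex_convexHull ℝ _).sum_mem (fun e _ => (Λ.weight_pos a e).le) (Λ.sum_weight a)
    fun e he => subset_convexHull ℝ _ he

lemma isCompact_newtonPolytope : IsCompact Λ.newtonPolytope :=
  Set.Finite.isCompact_convexHull (𝕜 := ℝ) Λ.edges.finite_toSet

lemma exists_norm_le_of_mem_newtonPolytope : ∃ M : ℝ, 0 ≤ M ∧ ∀ s ∈ Λ.newtonPolytope, ‖s‖ ≤ M := by
  obtain ⟨M, hM⟩ := Λ.isCompact_newtonPolytope.isBounded.exists_norm_le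
  exact ⟨max M 0, le_max_right _ _, fun s hs => (hM s hs).trans (le_max_left _ _)⟩

/-- Strict convexity of the free energy. -/
lemma freeEnergy_add_inner_lt {a a' : Vec d} (h : a ≠ a') :
    Λ.freeEnergy a + inner ℝ (gradient Λ.freeEnergy a) (a' - a) < Λ.freeEnergy a' := by
  have hne : ∃ j ∈ Λ.edges, ∃ k ∈ Λ.edges, inner ℝ j (a' - a) ≠ inner ℝ k (a' - a) := by
    by_contra! hcon
    obtain ⟨e₀, he₀⟩ := Λ.edges_nonempty
    have := Λ.eq_zero_of_inner_edges_eq_const (fun e he => hcon e he e₀ he₀)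
    exact h (sub_eq_zero.1 this).symm
  -- Strict Jensen inequality for `exp` under the Gibbs weights at `a`. The mean of `exp ⟪e, a' -
  -- a⟫` is the ratio of the partition functions at `a'` and `a`, so logarithms give the claim.
  have h1 := strictConvexOn_exp.map_sum_lt (t := Λ.edges) (w := Λ.weight a)
    (p := fun e => inner ℝ e (a' - a)) (fun e _ => Λ.weight_pos a e) (Λ.sum_weight a)
    (fun _ _ => mem_univ _) hne
  have h2 : ∑ e ∈ Λ.edges, Λ.weight a e • inner ℝ e (a' - a) =
      inner ℝ (gradient Λ.freeEnergy a) (a' - a) := by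
    rw [gradient_freeEnergy, sum_inner]
    simp [inner_smul_left]
  have h3 : ∑ e ∈ Λ.edges, Λ.weight a e • Real.exp (inner ℝ e (a' - a)) =
      Λ.partition a' / Λ.partition a := by
    rw [partition, Finset.sum_div]
    refine Finset.sum_congr rfl fun e _ => ?_
    rw [weight, smul_eq_mul, div_mul_eq_mul_div, ← Real.exp_add, ← inner_add_right]
    simp
  rw [h2, h3] at h1
  have h4 := Real.log_lt_log (Real.exp_pos _) h1
  rw [Real.log_exp, Real.log_div (Λ.partition_pos a').ne' (Λ.partition_pos a).ne'] at h4
  simp only [freeEnergy]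
  simp only [partition] at h4
  linarith

lemma freeEnergy_add_inner_le (a a' : Vec d) :
    Λ.freeEnergy a + inner ℝ (gradient Λ.freeEnergy a) (a' - a) ≤ Λ.freeEnergy a' := by
  rcases eq_or_ne a a' with rfl | h
  · simp
  · exact (Λ.freeEnergy_add_inner_lt h).le

/-- The first-order condition at a local minimum of `F - ⟪s, ·⟫`. Preimages under `∇F` are always
found as such minimizers. -/
lemma gradient_freeEnergy_eq_of_forall_le {s a : Vec d}
    (h : ∀ᶠ x in 𝓝 a, Λ.freeEnergy a - inner ℝ s a ≤ Λ.freeEnergy x - inner ℝ s x) :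
    gradient Λ.freeEnergy a = s := by
  have h1 : HasFDerivAt (fun x => Λ.freeEnergy x - inner ℝ s x)
      (InnerProductSpace.toDual ℝ (Vec d) (gradient Λ.freeEnergy a)
        - (innerSL ℝ s : Vec d →L[ℝ] ℝ)) a := by
    have := hasGradientAt_iff_hasFDerivAt.1 (Λ.hasGradientAt_freeEnergy a)
    rw [← Λ.gradient_freeEnergy a] at this
    exact this.sub (innerSL ℝ s : Vec d →L[ℝ] ℝ).hasFDerivAt
  have h2 : IsLocalMin (fun x => Λ.freeEnergy x - inner ℝ s x) a := h
  have h3 := h2.hasFDerivAt_eq_zero h1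
  refine ext_inner_right ℝ fun v => ?_
  have := congrArg (fun l => l v) h3
  simpa [sub_eq_zero] using this

/-- The gradient of the free energy is open, quantitatively. -/
lemma exists_gradient_freeEnergy_eq_near (a : Vec d) {r : ℝ} (hr : 0 < r) :
    ∃ m > 0, ∀ s, ‖s - gradient Λ.freeEnergy a‖ < m →
      ∃ a', ‖a' - a‖ < r ∧ gradient Λ.freeEnergy a' = s := by
  set s₀ := gradient Λ.freeEnergy a with hs₀
  have hcont : Continuous fun x => Λ.freeEnergy x - inner ℝ s₀ x := by
    have := Λ.continuous_freeEnergy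
    fun_prop
  have : Nonempty (Fin d) := ⟨⟨0, Λ.dim_pos⟩⟩
  obtain ⟨y, hy, hmin⟩ := (isCompact_sphere a r).exists_isMinOn
    (NormedSpace.sphere_nonempty.2 hr.le) hcont.continuousOn
  have hya : a ≠ y := by
    rintro rfl
    simp [hr.ne] at hy
  set δ := Λ.freeEnergy y - inner ℝ s₀ y - (Λ.freeEnergy a - inner ℝ s₀ a) with hδ
  have hδpos : 0 < δ := by
    have := Λ.freeEnergy_add_inner_lt hya
    rw [← hs₀, inner_sub_right] at this
    linarith
  -- `δ` is the gap between the value at `a` and the minimum on the sphere. Replacing `s₀` by `s`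
  -- with `‖s - s₀‖ < δ / r` changes this comparison by less than `δ`, so a minimizer over the
  -- closed ball cannot lie on the sphere.
  refine ⟨δ / r, by positivity, fun s hs => ?_⟩
  have hcont' : Continuous fun x => Λ.freeEnergy x - inner ℝ s x := by
    have := Λ.continuous_freeEnergy
    fun_prop
  obtain ⟨z, hz, hzmin⟩ := (isCompact_closedBall a r).exists_isMinOn
    ⟨a, Metric.mem_closedBall_self hr.le⟩ hcont'.continuousOn
  have hza : ‖z - a‖ < r := by
    rw [Metric.mem_closedBall, dist_eq_norm] at hz
    refine lt_of_le_of_ne hz fun hzr => ?_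
    have h1 : Λ.freeEnergy z - inner ℝ s z ≤ Λ.freeEnergy a - inner ℝ s a :=
      hzmin (Metric.mem_closedBall_self hr.le)
    have h2 : Λ.freeEnergy y - inner ℝ s₀ y ≤ Λ.freeEnergy z - inner ℝ s₀ z :=
      hmin (by rw [Metric.mem_sphere, dist_eq_norm, hzr] : z ∈ Metric.sphere a r)
    have h3 : inner ℝ (s - s₀) (z - a) ≤ ‖s - s₀‖ * ‖z - a‖ := real_inner_le_norm _ _
    have h4 : ‖s - s₀‖ * ‖z - a‖ < δ := by
      rw [hzr]
      exact (lt_div_iff₀ hr).1 hs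
    rw [inner_sub_left, inner_sub_right, inner_sub_right] at h3
    linarith
  refine ⟨z, hza, Λ.gradient_freeEnergy_eq_of_forall_le ?_⟩
  have : Metric.ball a r ∈ 𝓝 z := Metric.isOpen_ball.mem_nhds (by
    rwa [Metric.mem_ball, dist_eq_norm])
  filter_upwards [this] with x hx using hzmin (Metric.ball_subset_closedBall hx)

/-- At an edge vector, one term of the sum of exponentials is at most the whole sum; the condition
on `s` is a half-space, so it passes to the convex hull. -/
lemma inner_le_freeEnergy {s : Vec d} (hs : s ∈ Λ.newtonPolytope) (a : Vec d) :
    inner ℝ s a ≤ Λ.freeEnergy a := by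
  have hsub : (Λ.edges : Set (Vec d)) ⊆ {x | inner ℝ x a ≤ Λ.freeEnergy a} := by
    intro e he
    rw [Set.mem_ofPred_eq, ← Real.log_exp (inner ℝ e a)]
    exact Real.log_le_log (Real.exp_pos _)
      (Finset.single_le_sum (f := fun e => Real.exp (inner ℝ e a))
        (fun _ _ => (Real.exp_pos _).le) he)
  have hconv : Convex ℝ {x : Vec d | inner ℝ x a ≤ Λ.freeEnergy a} :=
    convex_halfSpace_le (f := fun x : Vec d => (inner ℝ x a : ℝ))
      ⟨fun x y => inner_add_left _ _ _, fun c x => by simp [inner_smul_left]⟩ _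
  exact convexHull_min hsub hconv hs

lemma exists_gradient_freeEnergy_eq {s : Vec d} (hs : s ∈ interior Λ.newtonPolytope) :
    ∃ a, gradient Λ.freeEnergy a = s := by
  obtain ⟨r, hr, hball⟩ := Metric.mem_nhds_iff.1 (mem_interior_iff_mem_nhds.1 hs)
  -- Coercivity comes from the room around `s`: the bound `⟪s', a⟫ ≤ F a` is applied to `s' = s + (r
  -- / 2) a / ‖a‖`, which is still in the polytope.
  have hcoer : ∀ a : Vec d, r / 2 * ‖a‖ ≤ Λ.freeEnergy a - inner ℝ s a := by
    intro a
    rcases eq_or_ne a 0 with rfl | ha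
    · have := Λ.inner_le_freeEnergy (interior_subset hs) 0
      simpa using this
    · have hna : 0 < ‖a‖ := norm_pos_iff.2 ha
      have hmem : s + (r / 2 / ‖a‖) • a ∈ Λ.newtonPolytope := by
        apply hball
        rw [Metric.mem_ball, dist_eq_norm, add_sub_cancel_left, norm_smul, Real.norm_eq_abs,
          abs_of_pos (by positivity), div_mul_cancel₀ _ hna.ne']
        linarith
      have := Λ.inner_le_freeEnergy hmem a
      rw [inner_add_left, inner_smul_left, real_inner_self_eq_norm_sq] at this
      have h2 : r / 2 / ‖a‖ * ‖a‖ ^ 2 = r / 2 * ‖a‖ := by field_simp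
      simp only [conj_trivial] at this
      rw [h2] at this
      linarith
  have hcont : Continuous fun x => Λ.freeEnergy x - inner ℝ s x := by
    have := Λ.continuous_freeEnergy
    fun_prop
  have htend : Tendsto (fun x => Λ.freeEnergy x - inner ℝ s x) (cocompact (Vec d)) atTop :=
    tendsto_atTop_mono hcoer
      (Tendsto.const_mul_atTop (by positivity) (tendsto_norm_cocompact_atTop (E := Vec d)))
  obtain ⟨a, ha⟩ := hcont.exists_forall_le htend
  exact ⟨a, Λ.gradient_freeEnergy_eq_of_forall_le (Eventually.of_forall ha)⟩

/-! ### The surface tension -/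

lemma inner_sub_freeEnergy_le_zero {s : Vec d} (hs : s ∈ Λ.newtonPolytope) (a : Vec d) :
    inner ℝ s a - Λ.freeEnergy a ≤ 0 := sub_nonpos.2 (Λ.inner_le_freeEnergy hs a)

lemma inner_sub_freeEnergy_le {s : Vec d} (hs : s ∈ Λ.newtonPolytope) (a : Vec d) :
    inner ℝ s a - Λ.freeEnergy a ≤ Λ.surfaceTension s :=
  le_ciSup (f := fun a => inner ℝ s a - Λ.freeEnergy a)
    ⟨0, by rintro _ ⟨a, rfl⟩; exact Λ.inner_sub_freeEnergy_le_zero hs a⟩ a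

/-- `F` lies above its tangent plane at `a`, so the supremum defining `σ` is attained at `a`. -/
lemma surfaceTension_gradient (a : Vec d) :
    Λ.surfaceTension (gradient Λ.freeEnergy a) =
      inner ℝ (gradient Λ.freeEnergy a) a - Λ.freeEnergy a := by
  refine le_antisymm (ciSup_le fun x => ?_)
    (Λ.inner_sub_freeEnergy_le (Λ.gradient_freeEnergy_mem a) a)
  have := Λ.freeEnergy_add_inner_le a x
  rw [inner_sub_right] at this
  linarith

lemma norm_surfaceTension_le {s : Vec d} (hs : s ∈ Λ.newtonPolytope) :
    ‖Λ.surfaceTension s‖ ≤ Λ.freeEnergy 0 := by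
  have h1 : Λ.surfaceTension s ≤ 0 := ciSup_le fun a => Λ.inner_sub_freeEnergy_le_zero hs a
  have h2 := Λ.inner_sub_freeEnergy_le hs 0
  rw [inner_zero_right] at h2
  rw [Real.norm_eq_abs, abs_of_nonpos h1]
  linarith

/-- The tangent plane inequality for the surface tension. -/
lemma surfaceTension_add_inner_le {s : Vec d} (hs : s ∈ Λ.newtonPolytope) (a : Vec d) :
    Λ.surfaceTension (gradient Λ.freeEnergy a) + inner ℝ (s - gradient Λ.freeEnergy a) a ≤
      Λ.surfaceTension s := by
  have := Λ.inner_sub_freeEnergy_le hs a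
  rw [surfaceTension_gradient, inner_sub_left]
  linarith

/-- Equality means that `a` attains the supremum for `σ(s)`, that is, minimizes `F - ⟪s, ·⟫`. This
covers `s` on the boundary of the polytope, so limit shapes with facets can be compared too. -/
lemma gradient_freeEnergy_eq_of_surfaceTension_eq {s : Vec d} (hs : s ∈ Λ.newtonPolytope)
    {a : Vec d} (h : Λ.surfaceTension s = Λ.surfaceTension (gradient Λ.freeEnergy a) +
      inner ℝ (s - gradient Λ.freeEnergy a) a) : gradient Λ.freeEnergy a = s := by
  refine Λ.gradient_freeEnergy_eq_of_forall_le (Eventually.of_forall fun x => ?_)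
  have := Λ.inner_sub_freeEnergy_le hs x
  rw [h, surfaceTension_gradient, inner_sub_left] at this
  linarith

/-- By openness of `∇F`, a nearby `s` is `∇F(a')` with `a'` close to `a`. The tangent plane
inequalities at both points put the Taylor remainder between `0` and `⟪s - s₀, a' - a⟫`. -/
lemma hasGradientAt_surfaceTension (a : Vec d) :
    HasGradientAt Λ.surfaceTension a (gradient Λ.freeEnergy a) := by
  rw [hasGradientAt_iff_isLittleO, Asymptotics.isLittleO_iff]
  intro c hc
  obtain ⟨m, hm, h⟩ := Λ.exists_gradient_freeEnergy_eq_near a hc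
  filter_upwards [Metric.ball_mem_nhds (gradient Λ.freeEnergy a) hm] with s hs
  rw [Metric.mem_ball, dist_eq_norm] at hs
  obtain ⟨a', ha', rfl⟩ := h s hs
  set s₀ := gradient Λ.freeEnergy a
  set s := gradient Λ.freeEnergy a'
  have h1 : Λ.surfaceTension s₀ + inner ℝ (s - s₀) a ≤ Λ.surfaceTension s :=
    Λ.surfaceTension_add_inner_le (Λ.gradient_freeEnergy_mem a') a
  have h2 : Λ.surfaceTension s + inner ℝ (s₀ - s) a' ≤ Λ.surfaceTension s₀ :=
    Λ.surfaceTension_add_inner_le (Λ.gradient_freeEnergy_mem a) a'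
  have h3 : inner ℝ (s - s₀) (a' - a) ≤ ‖s - s₀‖ * ‖a' - a‖ := real_inner_le_norm _ _
  have h4 : ‖s - s₀‖ * ‖a' - a‖ ≤ ‖s - s₀‖ * c :=
    mul_le_mul_of_nonneg_left ha'.le (norm_nonneg _)
  rw [← neg_sub, inner_neg_left] at h2
  rw [inner_sub_right] at h3
  rw [real_inner_comm (s - s₀) a, Real.norm_eq_abs, abs_of_nonneg (by linarith), mul_comm c]
  linarith

lemma gradient_surfaceTension_gradient (a : Vec d) :
    gradient Λ.surfaceTension (gradient Λ.freeEnergy a) = a :=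
  (Λ.hasGradientAt_surfaceTension a).gradient

lemma gradient_freeEnergy_gradient_surfaceTension {s : Vec d}
    (hs : s ∈ interior Λ.newtonPolytope) :
    gradient Λ.freeEnergy (gradient Λ.surfaceTension s) = s := by
  obtain ⟨a, rfl⟩ := Λ.exists_gradient_freeEnergy_eq hs
  rw [gradient_surfaceTension_gradient]

lemma continuousOn_gradient_surfaceTension :
    ContinuousOn (gradient Λ.surfaceTension) (interior Λ.newtonPolytope) := by
  intro s hs
  refine ContinuousAt.continuousWithinAt ?_
  obtain ⟨a, rfl⟩ := Λ.exists_gradient_freeEnergy_eq hs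
  rw [Metric.continuousAt_iff]
  intro r hr
  obtain ⟨m, hm, h⟩ := Λ.exists_gradient_freeEnergy_eq_near a hr
  refine ⟨m, hm, fun {s} hs => ?_⟩
  rw [dist_eq_norm] at hs
  obtain ⟨a', ha', rfl⟩ := h s hs
  rwa [gradient_surfaceTension_gradient, gradient_surfaceTension_gradient, dist_eq_norm]

/-- On the Newton polytope, the surface tension is a supremum over a countable set. -/
lemma surfaceTension_eq_iSup_denseSeq {s : Vec d} (hs : s ∈ Λ.newtonPolytope) :
    Λ.surfaceTension s = ⨆ n : ℕ, (inner ℝ s (TopologicalSpace.denseSeq (Vec d) n)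
      - Λ.freeEnergy (TopologicalSpace.denseSeq (Vec d) n)) := by
  have hbdd : BddAbove (range fun n : ℕ => (inner ℝ s (TopologicalSpace.denseSeq (Vec d) n)
      - Λ.freeEnergy (TopologicalSpace.denseSeq (Vec d) n) : ℝ)) :=
    ⟨0, by rintro _ ⟨n, rfl⟩; exact Λ.inner_sub_freeEnergy_le_zero hs _⟩
  refine le_antisymm (ciSup_le fun a => ?_) (ciSup_le fun n => Λ.inner_sub_freeEnergy_le hs _)
  have hcl : IsClosed {x : Vec d | inner ℝ s x - Λ.freeEnergy x ≤
      ⨆ n : ℕ, (inner ℝ s (TopologicalSpace.denseSeq (Vec d) n)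
        - Λ.freeEnergy (TopologicalSpace.denseSeq (Vec d) n))} := by
    have := Λ.continuous_freeEnergy
    exact isClosed_le (by fun_prop) continuous_const
  have hsub : closure (range (TopologicalSpace.denseSeq (Vec d))) ⊆ _ :=
    closure_minimal (by rintro _ ⟨n, rfl⟩; exact le_ciSup hbdd n) hcl
  exact hsub (TopologicalSpace.denseRange_denseSeq (Vec d) a)

/-- The countable supremum is measurable everywhere and agrees with `σ` on the polytope, where `ω`
takes almost all its values. -/
lemma aestronglyMeasurable_surfaceTension_comp {μ : Measure (Vec d)} {ω : Vec d → Vec d}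
    (hω : AEStronglyMeasurable ω μ) (hmem : ∀ᵐ x ∂μ, ω x ∈ Λ.newtonPolytope) :
    AEStronglyMeasurable (fun x => Λ.surfaceTension (ω x)) μ := by
  have hmeas : Measurable fun s : Vec d => ⨆ n : ℕ,
      (inner ℝ s (TopologicalSpace.denseSeq (Vec d) n)
        - Λ.freeEnergy (TopologicalSpace.denseSeq (Vec d) n)) :=
    Measurable.iSup fun n => by fun_prop
  refine (hmeas.comp_aemeasurable hω.aemeasurable).aestronglyMeasurable.congr ?_
  filter_upwards [hmem] with x hx using (Λ.surfaceTension_eq_iSup_denseSeq hx).symm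

end DimerLattice

/-! ### Gradients of smooth functions -/

section Gradient

variable {d : ℕ}

lemma gradient_apply_eq_fderiv (φ : Vec d → ℝ) (x : Vec d) (i : Fin d) :
    gradient φ x i = fderiv ℝ φ x (EuclideanSpace.single i 1) := by
  rw [← inner_gradient_left, EuclideanSpace.inner_single_right]
  simp

lemma inner_eq_sum_mul (v w : Vec d) : inner ℝ v w = ∑ i, v i * w i := by
  simp [PiLp.inner_apply, mul_comm]

lemma ContDiff.continuous_gradient {φ : Vec d → ℝ} (hφ : ContDiff ℝ (⊤ : ℕ∞) φ) :
    Continuous (gradient φ) :=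
  (InnerProductSpace.toDual ℝ (Vec d)).symm.continuous.comp
    (hφ.continuous_fderiv (by simp))

lemma ContDiff.gradient_apply {φ : Vec d → ℝ} (hφ : ContDiff ℝ (⊤ : ℕ∞) φ) (i : Fin d) :
    ContDiff ℝ (⊤ : ℕ∞) (fun x => gradient φ x i) := by
  simp only [gradient_apply_eq_fderiv]
  exact (hφ.fderiv_right (m := (⊤ : ℕ∞)) (by simp)).clm_apply contDiff_const

lemma tsupport_gradient_subset (φ : Vec d → ℝ) : tsupport (gradient φ) ⊆ tsupport φ :=
  (tsupport_comp_subset (g := (InnerProductSpace.toDual ℝ (Vec d)).symm) (map_zero _) _).trans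
    (tsupport_fderiv_subset ℝ)

lemma HasCompactSupport.gradient {φ : Vec d → ℝ} (hφ : HasCompactSupport φ) :
    HasCompactSupport (gradient φ) :=
  hφ.mono' ((subset_tsupport _).trans (tsupport_gradient_subset φ))

lemma gradient_eq_zero_of_notMem_tsupport {φ : Vec d → ℝ} {x : Vec d} (hx : x ∉ tsupport φ) :
    gradient φ x = 0 :=
  image_eq_zero_of_notMem_tsupport fun h => hx (tsupport_gradient_subset φ h)

lemma IsTestFunction.gradient_apply {Ω : Set (Vec d)} {φ : Vec d → ℝ} (hφ : IsTestFunction Ω φ)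
    (i : Fin d) : IsTestFunction Ω (fun x => gradient φ x i) := by
  have hsub : tsupport (fun x => gradient φ x i) ⊆ tsupport φ :=
    (tsupport_comp_subset (g := fun v : Vec d => v i) rfl _).trans (tsupport_gradient_subset φ)
  exact ⟨hφ.1.gradient_apply i, hφ.2.1.mono' ((subset_tsupport _).trans hsub),
    hsub.trans hφ.2.2⟩

lemma gradient_sub {φ ψ : Vec d → ℝ} {x : Vec d} (hφ : DifferentiableAt ℝ φ x)
    (hψ : DifferentiableAt ℝ ψ x) :
    gradient (fun y => φ y - ψ y) x = gradient φ x - gradient ψ x := by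
  ext i
  simp [gradient_apply_eq_fderiv, fderiv_fun_sub hφ hψ]

lemma gradient_comp {φ : Vec d → ℝ} {G : ℝ → ℝ} {x : Vec d} (hG : DifferentiableAt ℝ G (φ x))
    (hφ : DifferentiableAt ℝ φ x) :
    gradient (fun y => G (φ y)) x = deriv G (φ x) • gradient φ x := by
  ext i
  simp only [gradient_apply_eq_fderiv, PiLp.smul_apply, smul_eq_mul]
  have h : fderiv ℝ (fun y => G (φ y)) x = deriv G (φ x) • fderiv ℝ φ x :=
    (hG.hasDerivAt.comp_hasFDerivAt x hφ.hasFDerivAt).fderiv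
  simp [h]

/-- A smooth function equal to one near `K`, with compact support in `Ω`. -/
lemma exists_cutoff {Ω K : Set (Vec d)} (hΩ : IsOpen Ω) (hK : IsCompact K) (hKΩ : K ⊆ Ω) :
    ∃ χ : Vec d → ℝ, IsTestFunction Ω χ ∧ (∀ᶠ x in 𝓝ˢ K, χ x = 1) ∧ ∀ x, χ x ∈ Icc (0 : ℝ) 1 := by
  obtain ⟨K₁, hK₁, hKK₁, hK₁Ω⟩ := exists_compact_between hK hΩ hKΩ
  obtain ⟨f, hf1, hf0, hf⟩ := exists_contMDiffMap_one_nhds_of_subset_interior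
    (modelWithCornersSelf ℝ (Vec d)) (n := (⊤ : ℕ∞)) hK.isClosed hKK₁
  have hsub : Function.support f ⊆ K₁ := fun x hx => by_contra fun h => hx (hf0 x h)
  exact ⟨f, ⟨f.contMDiff.contDiff, HasCompactSupport.of_support_subset_isCompact hK₁ hsub,
    (closure_minimal hsub hK₁.isClosed).trans hK₁Ω⟩, hf1, hf⟩

end Gradient

/-! ### Mollification -/

section Mollify

variable {d : ℕ} {E : Type*} [NormedAddCommGroup E] [NormedSpace ℝ E]

/-- A bump function supported in the ball of radius `1 / (n + 1)`. -/
noncomputable def mollifier (d n : ℕ) : ContDiffBump (0 : Vec d) where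
  rIn := 1 / (n + 1) / 2
  rOut := 1 / (n + 1)
  rIn_pos := by positivity
  rIn_lt_rOut := half_lt_self (by positivity)

/-- The mollification of a function at scale `1 / (n + 1)`. -/
noncomputable def mollify (n : ℕ) (f : Vec d → E) : Vec d → E :=
  MeasureTheory.convolution ((mollifier d n).normed volume) f (ContinuousLinearMap.lsmul ℝ ℝ) volume

lemma mollify_apply (n : ℕ) (f : Vec d → E) (x : Vec d) :
    mollify n f x = ∫ y, (mollifier d n).normed volume y • f (x - y) := rfl

lemma contDiff_mollify (n : ℕ) {f : Vec d → E} (hf : LocallyIntegrable f) [CompleteSpace E] :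
    ContDiff ℝ (⊤ : ℕ∞) (mollify n f) :=
  (mollifier d n).hasCompactSupport_normed.contDiff_convolution_left _
    (mollifier d n).contDiff_normed hf

lemma mollifier_rOut_tendsto : Tendsto (fun n => (mollifier d n).rOut) atTop (𝓝 0) :=
  tendsto_one_div_add_atTop_nhds_zero_nat

lemma mollify_eq_zero [CompleteSpace E] {n : ℕ} {f : Vec d → E} {x : Vec d}
    (h : ∀ y ∈ Metric.ball x (1 / (n + 1 : ℝ)), f y = 0) : mollify n f x = 0 := by
  have hx : f x = 0 := h x (Metric.mem_ball_self (by positivity))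
  have := (mollifier d n).normed_convolution_eq_right (μ := volume) (g := f) (x₀ := x)
    (fun y hy => (h y hy).trans hx.symm)
  exact this.trans hx

lemma support_mollify_subset [CompleteSpace E] {n : ℕ} {f : Vec d → E} {K : Set (Vec d)}
    (h : ∀ x, x ∉ K → f x = 0) :
    Function.support (mollify n f) ⊆ Metric.cthickening (1 / (n + 1 : ℝ)) K := by
  intro x hx
  by_contra hcon
  refine hx (mollify_eq_zero fun y hy => h y fun hyK => hcon ?_)
  exact Metric.mem_cthickening_of_dist_le x y _ _ hyK (by rw [dist_comm]; exact hy.le)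

lemma tsupport_mollify_subset [CompleteSpace E] {n : ℕ} {f : Vec d → E} {K : Set (Vec d)}
    (h : ∀ x, x ∉ K → f x = 0) :
    tsupport (mollify n f) ⊆ Metric.cthickening (1 / (n + 1 : ℝ)) K :=
  closure_minimal (support_mollify_subset h) Metric.isClosed_cthickening

lemma hasCompactSupport_mollify [CompleteSpace E] {n : ℕ} {f : Vec d → E} {K : Set (Vec d)}
    (hK : IsCompact K) (h : ∀ x, x ∉ K → f x = 0) : HasCompactSupport (mollify n f) :=
  HasCompactSupport.of_support_subset_isCompact (hK.cthickening) (support_mollify_subset h)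

lemma mollify_sub (n : ℕ) {f g : Vec d → E} (hf : LocallyIntegrable f)
    (hg : LocallyIntegrable g) (x : Vec d) :
    mollify n (fun y => f y - g y) x = mollify n f x - mollify n g x := by
  have h (f : Vec d → E) (hf : LocallyIntegrable f) :
      Integrable (fun y => (mollifier d n).normed volume y • f (x - y)) volume :=
    (mollifier d n).hasCompactSupport_normed.convolutionExists_left
      (μ := volume)
      (ContinuousLinearMap.lsmul ℝ ℝ) (mollifier d n).continuous_normed hf x
  simp only [mollify_apply, smul_sub]
  exact integral_sub (h f hf) (h g hg)

/-- Tonelli, translation invariance and the unit mass of the kernel: mollification contracts `L¹`.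
-/
lemma lintegral_enorm_mollify_le (n : ℕ) {f : Vec d → E} (hf : AEStronglyMeasurable f) :
    ∫⁻ x, ‖mollify n f x‖ₑ ≤ ∫⁻ x, ‖f x‖ₑ := by
  have hmeas : AEStronglyMeasurable
      (fun p : Vec d × Vec d => (mollifier d n).normed volume p.2 • f (p.1 - p.2))
      (volume.prod volume) :=
    AEStronglyMeasurable.convolution_integrand (ContinuousLinearMap.lsmul ℝ ℝ)
      (mollifier d n).continuous_normed.aestronglyMeasurable hf
  calc ∫⁻ x, ‖mollify n f x‖ₑ
      ≤ ∫⁻ x, ∫⁻ y, ‖(mollifier d n).normed volume y • f (x - y)‖ₑ :=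
        lintegral_mono fun x => enorm_integral_le_lintegral_enorm _
    _ = ∫⁻ y, ∫⁻ x, ‖(mollifier d n).normed volume y • f (x - y)‖ₑ :=
        lintegral_lintegral_swap hmeas.enorm
    _ = ∫⁻ y, ‖(mollifier d n).normed volume y‖ₑ * ∫⁻ x, ‖f x‖ₑ := by
        refine lintegral_congr fun y => ?_
        simp only [enorm_smul]
        rw [lintegral_const_mul' _ _ enorm_ne_top, lintegral_sub_right_eq_self (fun x => ‖f x‖ₑ)]
    _ = ∫⁻ x, ‖f x‖ₑ := by
        rw [lintegral_mul_const'' _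
          (mollifier d n).continuous_normed.aestronglyMeasurable.enorm]
        have h1 : ∫⁻ y, ‖(mollifier d n).normed volume y‖ₑ = 1 := by
          have := ofReal_integral_norm_eq_lintegral_enorm
            ((mollifier d n).integrable_normed (μ := volume))
          rw [← this]
          simp only [Real.norm_eq_abs, abs_of_nonneg ((mollifier d n).nonneg_normed _)]
          rw [(mollifier d n).integral_normed, ENNReal.ofReal_one]
        rw [h1, one_mul]

lemma tendsto_lintegral_mollify_sub_of_continuous [CompleteSpace E] {g : Vec d → E}
    (hg : Continuous g) (hgc : HasCompactSupport g) :
    Tendsto (fun n => ∫⁻ x, ‖mollify n g x - g x‖ₑ) atTop (𝓝 0) := by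
  obtain ⟨C, hC⟩ := hgc.exists_bound_of_continuous hg
  have hC0 : 0 ≤ C := (norm_nonneg _).trans (hC 0)
  -- Radius `1` serves all `n` at once, because `1 / (n + 1) ≤ 1`; this gives a dominating function
  -- independent of `n`.
  set K := Metric.cthickening 1 (tsupport g) with hK
  have hKc : IsCompact K := hgc.isCompact.cthickening
  have hli : LocallyIntegrable g := hg.locallyIntegrable
  have hz : ∀ x, x ∉ tsupport g → g x = 0 := fun x hx => image_eq_zero_of_notMem_tsupport hx
  have hlim : ∫⁻ x : Vec d, (0 : ENNReal) = 0 := lintegral_zero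
  rw [← hlim]
  refine tendsto_lintegral_of_dominated_convergence
    (K.indicator fun _ => ENNReal.ofReal (C + C)) (fun n => ?_) (fun n => ?_) ?_ ?_
  · exact ((contDiff_mollify n hli).continuous.sub hg).enorm.measurable
  · refine Eventually.of_forall fun x => ?_
    by_cases hx : x ∈ K
    · simp only [indicator_of_mem hx, ← ofReal_norm]
      refine ENNReal.ofReal_le_ofReal ?_
      rw [← dist_eq_norm]
      refine (mollifier d n).dist_normed_convolution_le hg.aestronglyMeasurable fun y _ => ?_
      exact (dist_le_norm_add_norm _ _).trans (add_le_add (hC _) (hC _))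
    · have h1 : mollify n g x = 0 := by
        by_contra h
        refine hx (Metric.cthickening_mono ?_ _ (support_mollify_subset hz h))
        rw [div_le_one (by positivity)]
        linarith [(Nat.cast_nonneg n : (0 : ℝ) ≤ n)]
      have h2 : g x = 0 := hz x fun h => hx (Metric.self_subset_cthickening _ h)
      simp [h1, h2]
  · rw [lintegral_indicator hKc.measurableSet, lintegral_const, Measure.restrict_apply_univ]
    exact ENNReal.mul_ne_top ENNReal.ofReal_ne_top hKc.measure_lt_top.ne
  · refine Eventually.of_forall fun x => ?_
    have := (ContDiffBump.convolution_tendsto_right_of_continuous (μ := volume)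
      (mollifier_rOut_tendsto (d := d)) hg x)
    have h2 := (this.sub_const (g x)).enorm
    rw [sub_self, enorm_zero] at h2
    exact h2

/-- Density of continuous compactly supported functions, together with the `L¹` contraction, reduces
this to the continuous case. -/
theorem tendsto_lintegral_mollify_sub [CompleteSpace E] {f : Vec d → E} (hf : Integrable f) :
    Tendsto (fun n => ∫⁻ x, ‖mollify n f x - f x‖ₑ) atTop (𝓝 0) := by
  rw [ENNReal.tendsto_nhds_zero]
  intro ε hε
  have hε3 : ε / 3 ≠ 0 := (ENNReal.div_pos hε.ne' (by simp)).ne'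
  obtain ⟨g, hgc, hfg, hg, hgi⟩ := hf.exists_hasCompactSupport_lintegral_sub_le hε3
  filter_upwards [(ENNReal.tendsto_nhds_zero.1 (tendsto_lintegral_mollify_sub_of_continuous hg hgc))
    (ε / 3) hε3.bot_lt] with n hn
  have hm (h : Vec d → E) (hh : Integrable h) : AEMeasurable (fun x => ‖mollify n h x‖ₑ) :=
    (contDiff_mollify n hh.locallyIntegrable).continuous.enorm.measurable.aemeasurable
  have hfgi : Integrable fun x => f x - g x := hf.sub hgi
  calc ∫⁻ x, ‖mollify n f x - f x‖ₑ
      ≤ ∫⁻ x, ‖mollify n (fun y => f y - g y) x‖ₑ + (‖mollify n g x - g x‖ₑ + ‖f x - g x‖ₑ) := by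
        refine lintegral_mono fun x => ?_
        rw [mollify_sub n hf.locallyIntegrable hgi.locallyIntegrable]
        have : mollify n f x - f x =
          (mollify n f x - mollify n g x) + ((mollify n g x - g x) - (f x - g x)) := by abel
        rw [this]
        exact (enorm_add_le _ _).trans (add_le_add_right (enorm_sub_le) _)
    _ = (∫⁻ x, ‖mollify n (fun y => f y - g y) x‖ₑ) +
          ((∫⁻ x, ‖mollify n g x - g x‖ₑ) + ∫⁻ x, ‖f x - g x‖ₑ) := by
        rw [lintegral_add_left' (hm _ hfgi), lintegral_add_right' _ hfgi.1.enorm]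
    _ ≤ ε / 3 + (ε / 3 + ε / 3) := by
        gcongr
        exact (lintegral_enorm_mollify_le n hfgi.1).trans hfg
    _ = ε := by rw [← add_assoc, ENNReal.add_thirds]

lemma integrable_mollify [CompleteSpace E] (n : ℕ) {f : Vec d → E} (hf : Integrable f) :
    Integrable (mollify n f) :=
  ⟨(contDiff_mollify n hf.locallyIntegrable).continuous.aestronglyMeasurable,
    (lintegral_enorm_mollify_le n hf.1).trans_lt hf.2⟩

/-- Mollification commutes with weak differentiation. -/
lemma gradient_mollify {v : Vec d → ℝ} {w : Vec d → Vec d} (hv : LocallyIntegrable v)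
    (hw : LocallyIntegrable w)
    (h : ∀ φ : Vec d → ℝ, ContDiff ℝ (⊤ : ℕ∞) φ → HasCompactSupport φ → ∀ i,
      ∫ x, v x * gradient φ x i = - ∫ x, w x i * φ x) (n : ℕ) (x : Vec d) :
    gradient (mollify n v) x = mollify n w x := by
  set ρ := (mollifier d n).normed (volume : Measure (Vec d)) with hρ
  have hρc : HasCompactSupport ρ := (mollifier d n).hasCompactSupport_normed
  have hρs : ContDiff ℝ (⊤ : ℕ∞) ρ := (mollifier d n).contDiff_normed
  have hd := hρc.hasFDerivAt_convolution_left (ContinuousLinearMap.lsmul ℝ ℝ)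
    (hρs.of_le (by simp)) hv x
  ext i
  rw [gradient_apply_eq_fderiv]
  have hd' : fderiv ℝ (mollify n v) x = _ := hd.fderiv
  have hex : ConvolutionExistsAt (fderiv ℝ ρ) v x
      ((ContinuousLinearMap.lsmul ℝ ℝ).precompL (Vec d)) volume :=
    (hρc.fderiv ℝ).convolutionExists_left _ (hρs.continuous_fderiv (by simp)) hv x
  have hex2 : Integrable fun y => ρ y • w (x - y) :=
    hρc.convolutionExists_left (ContinuousLinearMap.lsmul ℝ ℝ) hρs.continuous hw x
  rw [hd', convolution_def, ContinuousLinearMap.integral_apply hex]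
  have e1 : mollify n w x i = ∫ y, ρ y * w (x - y) i := by
    rw [mollify_apply]
    have := (EuclideanSpace.proj (𝕜 := ℝ) i : Vec d →L[ℝ] ℝ).integral_comp_comm hex2
    simpa using this.symm
  rw [e1]
  -- The weak derivative identity is tested with the reflected and translated kernel; the sign from
  -- the reflection cancels the one from integration by parts.
  set φ : Vec d → ℝ := fun y => ρ (x - y) with hφ
  have hφs : ContDiff ℝ (⊤ : ℕ∞) φ := hρs.comp (contDiff_const.sub contDiff_id)
  have hφc : HasCompactSupport φ :=
    hρc.comp_homeomorph (Homeomorph.subLeft x)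
  have hgrad : ∀ y, gradient φ y i = - fderiv ℝ ρ (x - y) (EuclideanSpace.single i 1) := by
    intro y
    rw [gradient_apply_eq_fderiv]
    have h1 : HasFDerivAt (fun y : Vec d => x - y) (-ContinuousLinearMap.id ℝ (Vec d)) y :=
      (hasFDerivAt_id y).const_sub x
    have h2 := ((hρs.differentiable (by simp) (x - y)).hasFDerivAt.comp y h1).fderiv
    rw [show φ = ρ ∘ fun y => x - y from rfl, h2]
    simp
  have key := h φ hφs hφc i
  have l1 : ∫ y, v y * gradient φ y i =
      - ∫ y, fderiv ℝ ρ y (EuclideanSpace.single i 1) * v (x - y) := by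
    rw [← integral_sub_left_eq_self _ volume x, ← integral_neg]
    refine integral_congr_ae (Eventually.of_forall fun y => ?_)
    simp only [hgrad, sub_sub_cancel]
    ring
  have l2 : ∫ y, w y i * φ y = ∫ y, ρ y * w (x - y) i := by
    rw [← integral_sub_left_eq_self _ volume x]
    refine integral_congr_ae (Eventually.of_forall fun y => ?_)
    simp only [hφ, sub_sub_cancel]
    ring
  rw [l1, l2, neg_inj] at key
  rw [← key]
  refine integral_congr_ae (Eventually.of_forall fun y => ?_)
  simp [ContinuousLinearMap.precompL_apply]

/-- Mollification preserves divergence-free fields. -/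
lemma integral_inner_mollify_gradient_eq_zero {V : Vec d → Vec d} (hV : Integrable V)
    (h : ∀ φ : Vec d → ℝ, ContDiff ℝ (⊤ : ℕ∞) φ → HasCompactSupport φ →
      ∫ x, inner ℝ (V x) (gradient φ x) = 0) (n : ℕ) {φ : Vec d → ℝ}
    (hφ : ContDiff ℝ (⊤ : ℕ∞) φ) (hφc : HasCompactSupport φ) :
    ∫ x, inner ℝ (mollify n V x) (gradient φ x) = 0 := by
  set ρ := (mollifier d n).normed (volume : Measure (Vec d)) with hρ
  have hρc : HasCompactSupport ρ := (mollifier d n).hasCompactSupport_normed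
  have hρs : ContDiff ℝ (⊤ : ℕ∞) ρ := (mollifier d n).contDiff_normed
  obtain ⟨C, hC⟩ := hφc.gradient.exists_bound_of_continuous hφ.continuous_gradient
  have hint : Integrable (fun p : Vec d × Vec d => ρ p.2 • V (p.1 - p.2))
      (volume.prod volume) :=
    Integrable.convolution_integrand (ContinuousLinearMap.lsmul ℝ ℝ)
      (hρs.continuous.integrable_of_hasCompactSupport hρc) hV
  have hint2 : Integrable (fun p : Vec d × Vec d =>
      (inner ℝ (ρ p.2 • V (p.1 - p.2)) (gradient φ p.1) : ℝ)) (volume.prod volume) := by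
    refine (hint.norm.mul_const C).mono'
      (hint.1.inner (hφ.continuous_gradient.comp continuous_fst).aestronglyMeasurable)
      (Eventually.of_forall fun p => ?_)
    exact (norm_inner_le_norm _ _).trans (mul_le_mul_of_nonneg_left (hC _) (norm_nonneg _))
  have h1 : ∀ x, inner ℝ (mollify n V x) (gradient φ x) =
      ∫ y, (inner ℝ (ρ y • V (x - y)) (gradient φ x) : ℝ) := by
    intro x
    have hex2 : Integrable fun y => ρ y • V (x - y) :=
      hρc.convolutionExists_left (ContinuousLinearMap.lsmul ℝ ℝ) hρs.continuous
        hV.locallyIntegrable x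
    rw [mollify_apply, real_inner_comm]
    have := (innerSL ℝ (gradient φ x) : Vec d →L[ℝ] ℝ).integral_comp_comm hex2
    simp only [innerSL_apply_apply] at this
    rw [← this]
    simp only [real_inner_comm]
  simp only [h1]
  rw [integral_integral_swap hint2]
  refine integral_eq_zero_of_ae (Eventually.of_forall fun y => ?_)
  simp only [inner_smul_left, integral_const_mul, conj_trivial, Pi.zero_apply]
  -- For fixed `y` the translation is moved onto `φ`, and a translated test function is again a test
  -- function.
  have h2 : ∫ x, inner ℝ (V (x - y)) (gradient φ x) = 0 := by
    rw [← integral_add_right_eq_self _ y]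
    have h3 := h (fun x => φ (x + y)) (hφ.comp (contDiff_id.add contDiff_const))
      (hφc.comp_homeomorph (Homeomorph.addRight y))
    rw [← h3]
    refine integral_congr_ae (Eventually.of_forall fun x => ?_)
    have h4 : gradient (fun x => φ (x + y)) x = gradient φ (x + y) := by
      simp only [gradient, fderiv_comp_add_right]
    simp only [add_sub_cancel_right, h4]
  rw [h2, mul_zero]

end Mollify

/-! ### Weak gradients, cutoffs and limits of pairings -/

section WeakDerivatives

variable {d : ℕ} {E : Type*} [NormedAddCommGroup E] [NormedSpace ℝ E]

lemma LocallyIntegrableOn.integrable_smul_of_tsupport_subset {Ω : Set (Vec d)} {f : Vec d → E}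
    (hf : LocallyIntegrableOn f Ω volume) {g : Vec d → ℝ} (hg : Continuous g)
    (hgc : HasCompactSupport g) (hsub : tsupport g ⊆ Ω) : Integrable (fun x => g x • f x) := by
  have h1 : IntegrableOn f (tsupport g) volume := hf.integrableOn_compact_subset hsub hgc.isCompact
  have h2 : IntegrableOn (fun x => g x • f x) (tsupport g) volume :=
    h1.continuousOn_smul hg.continuousOn hgc.isCompact
  refine (integrableOn_iff_integrable_of_support_subset fun x hx => ?_).1 h2
  refine subset_tsupport g fun h => hx ?_
  simp [h]

lemma integrable_gradient {φ : Vec d → ℝ} (hφ : ContDiff ℝ (⊤ : ℕ∞) φ)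
    (hφc : HasCompactSupport φ) : Integrable (gradient φ) :=
  hφ.continuous_gradient.integrable_of_hasCompactSupport hφc.gradient

lemma MeasureTheory.Integrable.euclidean_apply {μ : Measure (Vec d)} {w : Vec d → Vec d}
    (hw : Integrable w μ) (i : Fin d) : Integrable (fun x => w x i) μ :=
  (EuclideanSpace.proj (𝕜 := ℝ) i : Vec d →L[ℝ] ℝ).integrable_comp hw

lemma MeasureTheory.LocallyIntegrableOn.euclidean_apply {Ω : Set (Vec d)} {w : Vec d → Vec d}
    (hw : LocallyIntegrableOn w Ω volume) (i : Fin d) :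
    LocallyIntegrableOn (fun x => w x i) Ω volume := fun x hx =>
  let ⟨U, hU, h⟩ := hw x hx
  ⟨U, hU, Integrable.euclidean_apply h i⟩

/-- Hölder with exponents `∞` and `1`. The values lie in a general inner product space so that
scalar functions and vector fields are both covered. -/
lemma tendsto_integral_inner_of_L1 {F : Type*} [NormedAddCommGroup F] [InnerProductSpace ℝ F]
    {μ : Measure (Vec d)} {V : Vec d → F} {M : ℝ}
    (hV : AEStronglyMeasurable V μ) (hM : ∀ᵐ x ∂μ, ‖V x‖ ≤ M) {f : ℕ → Vec d → F}
    {g : Vec d → F} (hf : ∀ᶠ n in atTop, Integrable (f n) μ) (hg : AEStronglyMeasurable g μ)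
    (h : Tendsto (fun n => ∫⁻ x, ‖f n x - g x‖ₑ ∂μ) atTop (𝓝 0)) :
    Tendsto (fun n => ∫ x, (inner ℝ (V x) (f n x) : ℝ) ∂μ) atTop
      (𝓝 (∫ x, inner ℝ (V x) (g x) ∂μ)) := by
  refine tendsto_integral_of_L1 _ (hV.inner hg) ?_ ?_
  · filter_upwards [hf] with n hn
    refine (hn.norm.const_mul M).mono' (hV.inner hn.1) ?_
    filter_upwards [hM] with x hx
    exact (norm_inner_le_norm _ _).trans (mul_le_mul_of_nonneg_right hx (norm_nonneg _))
  · have h2 : Tendsto (fun n => ENNReal.ofReal M * ∫⁻ x, ‖f n x - g x‖ₑ ∂μ) atTop (𝓝 0) := by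
      have := ENNReal.Tendsto.const_mul h (Or.inr (ENNReal.ofReal_ne_top (r := M)))
      rwa [mul_zero] at this
    refine tendsto_of_tendsto_of_tendsto_of_le_of_le tendsto_const_nhds h2
      (fun _ => zero_le) fun n => ?_
    simp only
    rw [← lintegral_const_mul' _ _ ENNReal.ofReal_ne_top]
    refine lintegral_mono_ae ?_
    filter_upwards [hM] with x hx
    rw [← inner_sub_right, ← ofReal_norm, ← ofReal_norm (f n x - g x), ← ENNReal.ofReal_mul
      ((norm_nonneg _).trans hx)]
    exact ENNReal.ofReal_le_ofReal
      ((norm_inner_le_norm _ _).trans (mul_le_mul_of_nonneg_right hx (norm_nonneg _)))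

lemma gradient_mul_apply {φ χ : Vec d → ℝ} {x : Vec d} (hφ : DifferentiableAt ℝ φ x)
    (hχ : DifferentiableAt ℝ χ x) (i : Fin d) :
    gradient (fun y => χ y * φ y) x i = χ x * gradient φ x i + φ x * gradient χ x i := by
  simp [gradient_apply_eq_fderiv, fderiv_fun_mul hχ hφ]

lemma IsTestFunction.mul_left {Ω : Set (Vec d)} {χ φ : Vec d → ℝ} (hχ : IsTestFunction Ω χ)
    (hφ : ContDiff ℝ (⊤ : ℕ∞) φ) : IsTestFunction Ω (fun x => χ x * φ x) :=
  ⟨hχ.1.mul hφ, hχ.2.1.mul_right, (tsupport_mul_subset_left).trans hχ.2.2⟩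

/-- Multiplication of a weakly differentiable function by a cutoff. -/
lemma HasWeakGradient.integral_cutoff_mul_gradient {Ω : Set (Vec d)} {u : Vec d → ℝ}
    {D : Vec d → Vec d} (h : HasWeakGradient Ω u D) {χ : Vec d → ℝ} (hχ : IsTestFunction Ω χ) :
    Integrable (fun x => χ x * u x) ∧ Integrable (fun x => χ x • D x + u x • gradient χ x) ∧
    ∀ φ : Vec d → ℝ, ContDiff ℝ (⊤ : ℕ∞) φ → HasCompactSupport φ → ∀ i,
      ∫ x, χ x * u x * gradient φ x i =
        - ∫ x, (χ x • D x + u x • gradient χ x) i * φ x := by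
  obtain ⟨hu, hD, hw⟩ := h
  have hgχ : ∀ i, IsTestFunction Ω fun x => gradient χ x i := fun i => hχ.gradient_apply i
  have huχ : ∀ i, Integrable fun x => gradient χ x i * u x := fun i =>
    LocallyIntegrableOn.integrable_smul_of_tsupport_subset hu (hgχ i).1.continuous
      (hgχ i).2.1 (hgχ i).2.2
  have hχu : Integrable fun x => χ x * u x :=
    LocallyIntegrableOn.integrable_smul_of_tsupport_subset hu hχ.1.continuous hχ.2.1 hχ.2.2
  have hχD : Integrable fun x => χ x • D x :=
    LocallyIntegrableOn.integrable_smul_of_tsupport_subset hD hχ.1.continuous hχ.2.1 hχ.2.2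
  have hχ' : Integrable fun x => u x • gradient χ x := by
    rw [← memLp_one_iff_integrable]
    refine MemLp.of_eval_piLp fun i => ?_
    rw [memLp_one_iff_integrable]
    simpa [mul_comm] using huχ i
  refine ⟨hχu, hχD.add hχ', fun φ hφ hφc i => ?_⟩
  -- The test function is `χ * φ`; the product rule produces the extra term `u • ∇χ`. All integrands
  -- vanish off `Ω`, which turns the identity into one on the whole space.
  have key := hw _ (hχ.mul_left hφ) i
  have hz : ∀ x, x ∉ Ω → χ x = 0 := fun x hx =>
    image_eq_zero_of_notMem_tsupport fun h => hx (hχ.2.2 h)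
  have hz' : ∀ x, x ∉ Ω → gradient χ x = 0 := fun x hx =>
    gradient_eq_zero_of_notMem_tsupport fun h => hx (hχ.2.2 h)
  have hg : ∀ x, gradient (fun y => χ y * φ y) x i =
      χ x * gradient φ x i + φ x * gradient χ x i := fun x =>
    gradient_mul_apply (hφ.differentiable (by simp) x) (hχ.1.differentiable (by simp) x) i
  rw [setIntegral_eq_integral_of_forall_compl_eq_zero (fun x hx => by
      rw [hg, hz x hx, hz' x hx]; simp),
    setIntegral_eq_integral_of_forall_compl_eq_zero (fun x hx => by rw [hz x hx]; simp)] at key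
  obtain ⟨C, hC⟩ := hφc.exists_bound_of_continuous hφ.continuous
  obtain ⟨C', hC'⟩ := hφc.gradient.exists_bound_of_continuous hφ.continuous_gradient
  have i1 : Integrable fun x => χ x * u x * gradient φ x i :=
    hχu.mul_bdd (c := C') (hφ.gradient_apply i).continuous.aestronglyMeasurable
      (Eventually.of_forall fun x => (PiLp.norm_apply_le _ i).trans (hC' x))
  have i2 : Integrable fun x => gradient χ x i * u x * φ x :=
    (huχ i).mul_bdd (c := C) hφ.continuous.aestronglyMeasurable (Eventually.of_forall hC)
  have i3 : Integrable fun x => χ x * D x i * φ x :=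
    (hχD.euclidean_apply i).mul_bdd (c := C) hφ.continuous.aestronglyMeasurable
      (Eventually.of_forall hC)
  have e1 : ∫ x, u x * gradient (fun y => χ y * φ y) x i =
      (∫ x, χ x * u x * gradient φ x i) + ∫ x, gradient χ x i * u x * φ x := by
    rw [← integral_add i1 i2]
    refine integral_congr_ae (Eventually.of_forall fun x => ?_)
    simp only [hg]
    ring
  have e2 : ∫ x, (χ x • D x + u x • gradient χ x) i * φ x =
      (∫ x, χ x * D x i * φ x) + ∫ x, gradient χ x i * u x * φ x := by
    rw [← integral_add i3 i2]
    refine integral_congr_ae (Eventually.of_forall fun x => ?_)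
    simp only [PiLp.add_apply, PiLp.smul_apply, smul_eq_mul]
    ring
  have e3 : ∫ x, D x i * (χ x * φ x) = ∫ x, χ x * D x i * φ x :=
    integral_congr_ae (Eventually.of_forall fun x => by ring)
  rw [e1, e3] at key
  rw [e2]
  linarith

lemma HasWeakGradient.sub {Ω : Set (Vec d)} {u v : Vec d → ℝ} {D D' : Vec d → Vec d}
    (h : HasWeakGradient Ω u D) (h' : HasWeakGradient Ω v D') :
    HasWeakGradient Ω (fun x => u x - v x) (fun x => D x - D' x) := by
  refine ⟨h.1.sub h'.1, h.2.1.sub h'.2.1, fun φ hφ i => ?_⟩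
  have hi : ∀ {f : Vec d → ℝ}, LocallyIntegrableOn f Ω volume → ∀ {g : Vec d → ℝ},
      IsTestFunction Ω g → IntegrableOn (fun x => f x * g x) Ω := fun hf g hg => by
    have := LocallyIntegrableOn.integrable_smul_of_tsupport_subset hf hg.1.continuous
      hg.2.1 hg.2.2
    simpa [mul_comm] using this.integrableOn (s := Ω)
  simp only [sub_mul, PiLp.sub_apply]
  rw [integral_sub (hi h.1 (hφ.gradient_apply i)) (hi h'.1 (hφ.gradient_apply i)),
    integral_sub (hi (h.2.1.euclidean_apply i) hφ) (hi (h'.2.1.euclidean_apply i) hφ),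
    h.2.2 φ hφ i, h'.2.2 φ hφ i]
  ring

/-- A function that vanishes almost everywhere has vanishing weak gradient. -/
lemma HasWeakGradient.ae_eq_zero {Ω : Set (Vec d)} (hΩ : IsOpen Ω) {u : Vec d → ℝ}
    {D : Vec d → Vec d} (h : HasWeakGradient Ω u D) (hu : ∀ᵐ x, x ∈ Ω → u x = 0) :
    ∀ᵐ x, x ∈ Ω → D x = 0 := by
  have hi : ∀ i, ∀ᵐ x, x ∈ Ω → D x i = 0 := fun i => by
    refine hΩ.ae_eq_zero_of_integral_contDiff_smul_eq_zero (h.2.1.euclidean_apply i)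
      fun g hg hgc hgΩ => ?_
    have key := h.2.2 g ⟨hg, hgc, hgΩ⟩ i
    have h0 : ∫ x in Ω, u x * gradient g x i = 0 := by
      refine integral_eq_zero_of_ae ?_
      filter_upwards [(ae_restrict_iff' hΩ.measurableSet).2 hu] with x hx
      simp [hx]
    rw [h0, zero_eq_neg, setIntegral_eq_integral_of_forall_compl_eq_zero (fun x hx => by
      rw [image_eq_zero_of_notMem_tsupport fun h => hx (hgΩ h), mul_zero])] at key
    simpa [mul_comm] using key
  filter_upwards [ae_all_iff.2 hi] with x hx hxΩ
  ext i
  exact hx i hxΩ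

end WeakDerivatives

/-! ### A smooth truncation -/

section Truncation

/-- `G = expNegInvGlue` is a smooth substitute for the positive part: it vanishes exactly for `t ≤
0`, and `G'` is nonnegative, bounded, and zero exactly for `t ≤ 0`. -/
lemma hasDerivAt_expNegInvGlue (t : ℝ) :
    HasDerivAt expNegInvGlue (t⁻¹ ^ 2 * expNegInvGlue t) t := by
  simpa using expNegInvGlue.hasDerivAt_polynomial_eval_inv_mul 1 t

lemma deriv_expNegInvGlue_nonneg (t : ℝ) : 0 ≤ deriv expNegInvGlue t := by
  rw [(hasDerivAt_expNegInvGlue t).deriv]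
  exact mul_nonneg (sq_nonneg _) (expNegInvGlue.nonneg t)

/-- With `x = 1 / t > 0` the derivative is `x² exp (-x)`, and `exp x ≥ x² / 2`. -/
lemma deriv_expNegInvGlue_le (t : ℝ) : deriv expNegInvGlue t ≤ 2 := by
  rw [(hasDerivAt_expNegInvGlue t).deriv]
  rcases le_or_gt t 0 with ht | ht
  · simp [expNegInvGlue.zero_of_nonpos ht]
  · have h1 := Real.quadratic_le_exp_of_nonneg (inv_pos.2 ht).le
    have h2 : expNegInvGlue t = (Real.exp t⁻¹)⁻¹ := by
      simp [expNegInvGlue, ht.not_ge, Real.exp_neg]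
    rw [h2, mul_inv_le_iff₀ (Real.exp_pos _)]
    nlinarith [(inv_pos.2 ht).le]

lemma deriv_expNegInvGlue_eq_zero_iff {t : ℝ} : deriv expNegInvGlue t = 0 ↔ t ≤ 0 := by
  rw [(hasDerivAt_expNegInvGlue t).deriv, mul_eq_zero, expNegInvGlue.zero_iff_nonpos]
  constructor
  · rintro (h | h)
    · simp at h
      exact h.le
    · exact h
  · exact Or.inr

lemma continuous_deriv_expNegInvGlue : Continuous (deriv expNegInvGlue) :=
  (expNegInvGlue.contDiff (n := 1)).continuous_deriv le_rfl

end Truncation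

/-! ### The comparison principle -/

section Comparison

variable {d : ℕ}

/-- If `u` is at most `δ` outside a compact subset of `Ω`, and its weak gradient `D` is
orthogonal, in the integrated sense, to a bounded divergence-free field `V` with `⟨V, D⟩ ≥ 0`, with
equality only where `D = 0`, then `u` is at most `δ` everywhere. -/
theorem HasWeakGradient.ae_le_of_isWeaklyDivFree (hd : 0 < d) {Ω K : Set (Vec d)} (hΩ : IsOpen Ω)
    (hK : IsCompact K) (hKΩ : K ⊆ Ω) {u : Vec d → ℝ} {D V : Vec d → Vec d}
    (hu : HasWeakGradient Ω u D) (hV : IsWeaklyDivFree Ω V) {M : ℝ}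
    (hM : ∀ᵐ x ∂volume.restrict Ω, ‖V x‖ ≤ M)
    (hVD : ∀ᵐ x ∂volume.restrict Ω, 0 ≤ (inner ℝ (V x) (D x) : ℝ) ∧
      ((inner ℝ (V x) (D x) : ℝ) = 0 → D x = 0)) {δ : ℝ} (hδ : 0 ≤ δ)
    (hle : ∀ᵐ x ∂volume.restrict Ω, x ∉ K → u x ≤ δ) :
    ∀ᵐ x ∂volume.restrict Ω, u x ≤ δ := by
  obtain ⟨χ, hχ, hχ1, hχI⟩ := exists_cutoff hΩ hK hKΩ
  obtain ⟨hv, hw, hvw⟩ := hu.integral_cutoff_mul_gradient hχ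
  set v : Vec d → ℝ := fun x => χ x * u x with hv_def
  set w : Vec d → Vec d := fun x => χ x • D x + u x • gradient χ x with hw_def
  have hcont1 : ContDiff ℝ (⊤ : ℕ∞) fun t : ℝ => expNegInvGlue (t - δ) :=
    expNegInvGlue.contDiff.comp (contDiff_id.sub contDiff_const)
  have hderiv : ∀ t, deriv (fun t : ℝ => expNegInvGlue (t - δ)) t = deriv expNegInvGlue (t - δ) :=
    fun t => deriv_comp_sub_const (f := expNegInvGlue) δ t
  have hcutK : ∀ x ∈ K, χ x = 1 ∧ gradient χ x = 0 := fun x hx => by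
    have hx1 : ∀ᶠ y in 𝓝 x, χ y = 1 := hχ1.filter_mono (nhds_le_nhdsSet hx)
    refine ⟨hx1.self_of_nhds, ?_⟩
    have : χ =ᶠ[𝓝 x] fun _ => 1 := hx1
    rw [this.gradient_eq, gradient_fun_const]
  have hz : ∀ x, x ∉ tsupport χ → v x = 0 := fun x hx => by
    simp [hv_def, image_eq_zero_of_notMem_tsupport hx]
  have hzw : ∀ x, x ∉ tsupport χ → w x = 0 := fun x hx => by
    simp [hw_def, image_eq_zero_of_notMem_tsupport hx, gradient_eq_zero_of_notMem_tsupport hx]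
  -- The cutoff does no harm above level `δ`: off `K` one has `u ≤ δ`, hence `χ u ≤ δ` because `0 ≤
  -- χ ≤ 1` and `0 ≤ δ`, while `χ = 1` near `K`.
  have hvK : ∀ᵐ x ∂volume.restrict Ω, δ < v x → x ∈ K ∧ v x = u x ∧ w x = D x := by
    filter_upwards [hle] with x hx hvx
    have hxK : x ∈ K := by
      by_contra hxK
      have h1 := hx hxK
      have h2 := hχI x
      have : χ x * u x ≤ δ := by
        rcases le_or_gt (u x) 0 with h | h
        · exact (mul_nonpos_of_nonneg_of_nonpos h2.1 h).trans hδ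
        · exact (mul_le_of_le_one_left h.le h2.2).trans h1
      exact absurd hvx (not_lt.2 this)
    obtain ⟨h1, h2⟩ := hcutK x hxK
    simp [hv_def, hw_def, h1, h2, hxK]
  -- the truncations of the mollifications are test functions
  set ψ : ℕ → Vec d → ℝ := fun n x => expNegInvGlue (mollify n v x - δ) with hψ
  have hvs : ∀ n, ContDiff ℝ (⊤ : ℕ∞) (mollify n v) := fun n =>
    contDiff_mollify n hv.locallyIntegrable
  have hψs : ∀ n, ContDiff ℝ (⊤ : ℕ∞) (ψ n) := fun n => hcont1.comp (hvs n)
  have hψsupp : ∀ n, tsupport (ψ n) ⊆ tsupport (mollify n v) := fun n =>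
    tsupport_comp_subset (g := fun t : ℝ => expNegInvGlue (t - δ))
      (expNegInvGlue.zero_of_nonpos (by linarith)) _
  have hψc : ∀ n, HasCompactSupport (ψ n) := fun n =>
    (hasCompactSupport_mollify hχ.2.1.isCompact hz).mono' ((subset_tsupport _).trans (hψsupp n))
  have hψ0 : ∀ n x, 0 ≤ ψ n x := fun n x => expNegInvGlue.nonneg _
  have hψgrad : ∀ n x, gradient (ψ n) x =
      deriv expNegInvGlue (mollify n v x - δ) • mollify n w x := fun n x => by
    rw [← hderiv, ← gradient_mollify hv.locallyIntegrable hw.locallyIntegrable hvw]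
    exact gradient_comp (G := fun t : ℝ => expNegInvGlue (t - δ))
      (hcont1.differentiable (by simp) _) ((hvs n).differentiable (by simp) x)
  have hψtest : ∀ᶠ n in atTop, IsTestFunction Ω (ψ n) := by
    obtain ⟨r, hr, hrΩ⟩ := hχ.2.1.isCompact.exists_cthickening_subset_open hΩ hχ.2.2
    have h0 : ∀ᶠ n : ℕ in atTop, 1 / ((n : ℝ) + 1) < r :=
      tendsto_one_div_add_atTop_nhds_zero_nat.eventually (gt_mem_nhds hr)
    filter_upwards [h0] with n hn
    exact ⟨hψs n, hψc n, (hψsupp n).trans ((tsupport_mollify_subset hz).trans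
      ((Metric.cthickening_mono hn.le _).trans hrΩ))⟩
  -- their gradients converge
  set g : Vec d → Vec d := fun x => deriv expNegInvGlue (v x - δ) • w x with hg
  have hvae : ∀ᵐ x, Tendsto (fun n => mollify n v x) atTop (𝓝 (v x)) :=
    -- The outer radius of the mollifier is exactly twice the inner one.
    ContDiffBump.ae_convolution_tendsto_right_of_locallyIntegrable (K := 2)
      mollifier_rOut_tendsto (Eventually.of_forall fun n => by
        simp only [mollifier]
        linarith) hv.locallyIntegrable
  have hgm : AEStronglyMeasurable g :=
    (continuous_deriv_expNegInvGlue.comp_aestronglyMeasurable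
      (hv.1.sub aestronglyMeasurable_const)).smul hw.1
  have hd2 : ∀ t, ‖deriv expNegInvGlue t‖ ≤ 2 := fun t => by
    rw [Real.norm_eq_abs, abs_of_nonneg (deriv_expNegInvGlue_nonneg t)]
    exact deriv_expNegInvGlue_le t
  have hlim : Tendsto (fun n => ∫⁻ x, ‖gradient (ψ n) x - g x‖ₑ) atTop (𝓝 0) := by
    -- With `vₙ`, `wₙ` the mollifications, the error is `G'(vₙ - δ) (wₙ - w) + (G'(vₙ - δ) - G'(v -
    -- δ)) w`. The first part is controlled by `G' ≤ 2`, the second by dominated convergence with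
    -- bound `4 ‖w‖`.
    have l1 : Tendsto (fun n => ENNReal.ofReal 2 * ∫⁻ x, ‖mollify n w x - w x‖ₑ) atTop (𝓝 0) := by
      have := ENNReal.Tendsto.const_mul (tendsto_lintegral_mollify_sub hw)
        (Or.inr (ENNReal.ofReal_ne_top (r := 2)))
      rwa [mul_zero] at this
    have l2 : Tendsto (fun n => ∫⁻ x, ‖(deriv expNegInvGlue (mollify n v x - δ) -
        deriv expNegInvGlue (v x - δ)) • w x‖ₑ) atTop (𝓝 0) := by
      have hm : ∀ n, AEStronglyMeasurable (fun x => (deriv expNegInvGlue (mollify n v x - δ) -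
          deriv expNegInvGlue (v x - δ)) • w x) := fun n =>
        ((continuous_deriv_expNegInvGlue.comp_aestronglyMeasurable
          ((hvs n).continuous.aestronglyMeasurable.sub aestronglyMeasurable_const)).sub
          (continuous_deriv_expNegInvGlue.comp_aestronglyMeasurable
          (hv.1.sub aestronglyMeasurable_const))).smul hw.1
      have h0 : ∫⁻ x : Vec d, (0 : ENNReal) = 0 := lintegral_zero
      rw [← h0]
      refine tendsto_lintegral_of_dominated_convergence' (fun x => ENNReal.ofReal 4 * ‖w x‖ₑ)
        (fun n => (hm n).enorm) (fun n => Eventually.of_forall fun x => ?_) ?_ ?_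
      · simp only [enorm_smul]
        gcongr
        rw [← ofReal_norm]
        refine ENNReal.ofReal_le_ofReal ((norm_sub_le _ _).trans ?_)
        linarith [hd2 (mollify n v x - δ), hd2 (v x - δ)]
      · rw [lintegral_const_mul' _ _ ENNReal.ofReal_ne_top]
        exact ENNReal.mul_ne_top ENNReal.ofReal_ne_top hw.2.ne
      · filter_upwards [hvae] with x hx
        have h1 : Tendsto (fun n => deriv expNegInvGlue (mollify n v x - δ)) atTop
            (𝓝 (deriv expNegInvGlue (v x - δ))) :=
          (continuous_deriv_expNegInvGlue.tendsto _).comp (hx.sub_const δ)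
        have h2 := ((h1.sub_const (deriv expNegInvGlue (v x - δ))).smul_const (w x)).enorm
        rwa [sub_self, zero_smul, enorm_zero] at h2
    have l3 := l1.add l2
    rw [add_zero] at l3
    refine tendsto_of_tendsto_of_tendsto_of_le_of_le tendsto_const_nhds l3
      (fun _ => zero_le) fun n => ?_
    simp only
    have hmw : AEMeasurable fun x => ENNReal.ofReal 2 * ‖mollify n w x - w x‖ₑ :=
      ((integrable_mollify n hw).sub hw).1.enorm.const_mul _
    rw [← lintegral_const_mul' _ _ ENNReal.ofReal_ne_top, ← lintegral_add_left' hmw]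
    refine lintegral_mono fun x => ?_
    rw [hψgrad]
    have : deriv expNegInvGlue (mollify n v x - δ) • mollify n w x - g x =
        deriv expNegInvGlue (mollify n v x - δ) • (mollify n w x - w x) +
        (deriv expNegInvGlue (mollify n v x - δ) - deriv expNegInvGlue (v x - δ)) • w x := by
      simp only [hg, smul_sub, sub_smul]
      abel
    rw [this]
    refine (enorm_add_le _ _).trans (add_le_add_left ?_ _)
    rw [enorm_smul]
    gcongr
    rw [← ofReal_norm]
    exact ENNReal.ofReal_le_ofReal (hd2 _)
  -- orthogonality in the limit
  have hVm : AEStronglyMeasurable V (volume.restrict Ω) := hV.1.aestronglyMeasurable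
  have hψi : ∀ n, Integrable (gradient (ψ n)) := fun n => integrable_gradient (hψs n) (hψc n)
  have hint : ∫ x in Ω, (inner ℝ (V x) (g x) : ℝ) = 0 := by
    have h1 := tendsto_integral_inner_of_L1 (μ := volume.restrict Ω) hVm hM
      (f := fun n => gradient (ψ n)) (g := g)
      (Eventually.of_forall fun n => (hψi n).restrict) hgm.restrict
      (tendsto_of_tendsto_of_tendsto_of_le_of_le tendsto_const_nhds hlim (fun _ => zero_le)
        fun n => setLIntegral_le_lintegral _ _)
    refine tendsto_nhds_unique h1 (tendsto_const_nhds.congr' ?_)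
    filter_upwards [hψtest] with n hn
    exact (hV.2 _ hn).symm
  have hgi : Integrable g :=
    (hw.norm.const_mul 2).mono' hgm (Eventually.of_forall fun x => by
      simp only [hg, norm_smul]
      exact mul_le_mul_of_nonneg_right (hd2 _) (norm_nonneg _))
  have hnonneg : ∀ᵐ x ∂volume.restrict Ω, 0 ≤ (inner ℝ (V x) (g x) : ℝ) ∧
      ((inner ℝ (V x) (g x) : ℝ) = 0 → g x = 0) := by
    filter_upwards [hvK, hVD] with x hx hx2
    rcases le_or_gt (v x) δ with h | h
    · have : g x = 0 := by
        simp only [hg]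
        rw [deriv_expNegInvGlue_eq_zero_iff.2 (by linarith), zero_smul]
      simp [this]
    · obtain ⟨-, -, h3⟩ := hx h
      simp only [hg, h3, inner_smul_right]
      refine ⟨mul_nonneg (deriv_expNegInvGlue_nonneg _) hx2.1, fun h0 => ?_⟩
      rcases mul_eq_zero.1 h0 with h4 | h4
      · rw [h4, zero_smul]
      · rw [hx2.2 h4, smul_zero]
  have hVgi : Integrable (fun x => (inner ℝ (V x) (g x) : ℝ)) (volume.restrict Ω) := by
    refine (hgi.norm.restrict.const_mul M).mono' (hVm.inner hgm.restrict) ?_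
    filter_upwards [hM] with x hx
    exact (norm_inner_le_norm _ _).trans (mul_le_mul_of_nonneg_right hx (norm_nonneg _))
  have hg0Ω : ∀ᵐ x ∂volume.restrict Ω, g x = 0 := by
    have := (integral_eq_zero_iff_of_nonneg_ae (hnonneg.mono fun x hx => hx.1) hVgi).1 hint
    filter_upwards [this, hnonneg] with x hx hx2 using hx2.2 hx
  have hg0 : ∀ᵐ x, g x = 0 := by
    filter_upwards [(ae_restrict_iff' hΩ.measurableSet).1 hg0Ω] with x hx
    by_cases hxΩ : x ∈ Ω
    · exact hx hxΩ
    · simp only [hg, hzw x fun h => hxΩ (hχ.2.2 h), smul_zero]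
  -- hence the integrals of the truncations tend to zero
  obtain ⟨r, hr⟩ := (hχ.2.1.isCompact.cthickening (r := 1)).isBounded.exists_norm_le
  set i : Fin d := ⟨0, hd⟩
  have hbound : ∀ n, ‖∫ x, ψ n x‖ₑ ≤ ENNReal.ofReal r * ∫⁻ x, ‖gradient (ψ n) x - g x‖ₑ := by
    intro n
    have hcoord : ∀ x : Vec d, fderiv ℝ (fun y : Vec d => y i) x (EuclideanSpace.single i 1) = 1 :=
      fun x => by
        have : HasFDerivAt (fun y : Vec d => y i) (EuclideanSpace.proj (𝕜 := ℝ) i : Vec d →L[ℝ] ℝ) x :=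
          (EuclideanSpace.proj (𝕜 := ℝ) i : Vec d →L[ℝ] ℝ).hasFDerivAt
        rw [this.fderiv]
        simp
    -- The derivative of the coordinate `x i` is `1`, so integration by parts bounds the integral of
    -- `ψ n` by its gradient on a fixed bounded set. No boundary regularity is involved.
    have hparts : ∫ x, ψ n x = - ∫ x, gradient (ψ n) x i * x i := by
      have hψcont := (hψs n).continuous
      have hgcont := ((hψs n).gradient_apply i).continuous
      have hgc : HasCompactSupport fun x => gradient (ψ n) x i :=
        (hψc n).gradient.comp_left (g := fun v : Vec d => v i) rfl
      have := integral_mul_fderiv_eq_neg_fderiv_mul_of_integrable (μ := volume)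
        (f := ψ n) (g := fun x : Vec d => x i) (v := EuclideanSpace.single i 1)
        (by
          simp only [← gradient_apply_eq_fderiv]
          exact (hgcont.mul (by fun_prop)).integrable_of_hasCompactSupport hgc.mul_right)
        (by
          simp only [hcoord, mul_one]
          exact hψcont.integrable_of_hasCompactSupport (hψc n))
        ((hψcont.mul (by fun_prop)).integrable_of_hasCompactSupport (hψc n).mul_right)
        (fun x _ => (hψs n).differentiable (by simp) x) (fun x _ => by fun_prop)
      simpa only [hcoord, mul_one, ← gradient_apply_eq_fderiv] using this
    rw [hparts, enorm_neg]
    refine (enorm_integral_le_lintegral_enorm _).trans ?_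
    rw [← lintegral_const_mul' _ _ ENNReal.ofReal_ne_top]
    refine lintegral_mono_ae ?_
    filter_upwards [hg0] with x hx
    rw [hx, sub_zero, enorm_mul]
    by_cases hxs : x ∈ Metric.cthickening 1 (tsupport χ)
    · rw [mul_comm]
      gcongr
      · rw [← ofReal_norm]
        exact ENNReal.ofReal_le_ofReal ((PiLp.norm_apply_le _ i).trans (hr x hxs))
      · rw [← ofReal_norm, ← ofReal_norm]
        exact ENNReal.ofReal_le_ofReal (PiLp.norm_apply_le _ i)
    · have : gradient (ψ n) x = 0 := by
        refine gradient_eq_zero_of_notMem_tsupport fun h => hxs ?_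
        refine Metric.cthickening_mono ?_ _ (tsupport_mollify_subset hz (hψsupp n h))
        rw [div_le_one (by positivity)]
        linarith [(Nat.cast_nonneg n : (0 : ℝ) ≤ n)]
      simp [this]
  have hψlim : Tendsto (fun n => ∫⁻ x, ‖ψ n x‖ₑ) atTop (𝓝 0) := by
    have l1 : Tendsto (fun n => ENNReal.ofReal r * ∫⁻ x, ‖gradient (ψ n) x - g x‖ₑ) atTop
        (𝓝 0) := by
      have := ENNReal.Tendsto.const_mul hlim (Or.inr (ENNReal.ofReal_ne_top (r := r)))
      rwa [mul_zero] at this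
    refine tendsto_of_tendsto_of_tendsto_of_le_of_le tendsto_const_nhds l1
      (fun _ => zero_le) fun n => ?_
    refine le_trans (le_of_eq ?_) (hbound n)
    have hψint : Integrable (ψ n) := (hψs n).continuous.integrable_of_hasCompactSupport (hψc n)
    rw [← ofReal_integral_norm_eq_lintegral_enorm hψint, ← ofReal_norm,
      Real.norm_of_nonneg (integral_nonneg (hψ0 n))]
    congr 1
    exact integral_congr_ae (Eventually.of_forall fun x => Real.norm_of_nonneg (hψ0 n x))
  -- Fatou's lemma passes from the mollifications to `v`; since `G` vanishes only on `t ≤ 0`, this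
  -- says `v ≤ δ` almost everywhere.
  have hfatou : ∫⁻ x, ‖expNegInvGlue (v x - δ)‖ₑ = 0 := by
    have h1 : ∫⁻ x, ‖expNegInvGlue (v x - δ)‖ₑ = ∫⁻ x, liminf (fun n => ‖ψ n x‖ₑ) atTop := by
      refine lintegral_congr_ae ?_
      filter_upwards [hvae] with x hx
      have : Tendsto (fun n => ‖ψ n x‖ₑ) atTop (𝓝 ‖expNegInvGlue (v x - δ)‖ₑ) :=
        ((expNegInvGlue.contDiff (n := 0)).continuous.tendsto _ |>.comp (hx.sub_const δ)).enorm
      exact this.liminf_eq.symm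
    have h2 : ∫⁻ x, liminf (fun n => ‖ψ n x‖ₑ) atTop ≤ liminf (fun n => ∫⁻ x, ‖ψ n x‖ₑ) atTop :=
      lintegral_liminf_le fun n => (hψs n).continuous.enorm.measurable
    rw [← h1, hψlim.liminf_eq] at h2
    exact le_antisymm h2 zero_le
  have hvle : ∀ᵐ x, v x ≤ δ := by
    have hm : AEMeasurable (fun x => ‖expNegInvGlue (v x - δ)‖ₑ) :=
      ((expNegInvGlue.contDiff (n := 0)).continuous.comp_aestronglyMeasurable
        (hv.1.sub aestronglyMeasurable_const)).enorm
    filter_upwards [(lintegral_eq_zero_iff' hm).1 hfatou] with x hx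
    have : expNegInvGlue (v x - δ) = 0 := by simpa using hx
    linarith [expNegInvGlue.zero_iff_nonpos.1 this]
  filter_upwards [hle, ae_restrict_of_ae hvle] with x hx hx2
  by_cases hxK : x ∈ K
  · have : v x = u x := by simp [hv_def, (hcutK x hxK).1]
    rwa [← this]
  · exact hx hxK

end Comparison

section LimitShapes

variable {d : ℕ} {Λ : DimerLattice d} {R : Set (Vec d)}

/-! ### Asymptotic flows -/

lemma IsAsymptoticFlow.ae_mem_newtonPolytope (hR : MeasurableSet R) {ω : Vec d → Vec d}
    (h : IsAsymptoticFlow Λ R ω) : ∀ᵐ x ∂volume.restrict R, ω x ∈ Λ.newtonPolytope :=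
  (ae_restrict_iff' hR).2 h.2.2.2

lemma IsAsymptoticFlow.exists_norm_le {ω : Vec d → Vec d} (h : IsAsymptoticFlow Λ R ω) :
    ∃ M : ℝ, ∀ᵐ x, ‖ω x‖ ≤ M := by
  obtain ⟨M, hM0, hM⟩ := Λ.exists_norm_le_of_mem_newtonPolytope
  refine ⟨M, ?_⟩
  filter_upwards [h.2.1, h.2.2.2] with x h1 h2
  by_cases hx : x ∈ R
  · exact hM _ (h2 hx)
  · rw [h1 hx, norm_zero]
    exact hM0

lemma IsAsymptoticFlow.integrable (hR : IsCompact R) {ω : Vec d → Vec d}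
    (h : IsAsymptoticFlow Λ R ω) : Integrable ω := by
  obtain ⟨M, hM⟩ := h.exists_norm_le
  have h1 : IntegrableOn ω R volume :=
    IntegrableOn.of_bound hR.measure_lt_top h.1.restrict M (ae_restrict_of_ae hM)
  exact h1.integrable_of_ae_notMem_eq_zero h.2.1

lemma integrableOn_surfaceTension (hR : IsCompact R) {ω : Vec d → Vec d}
    (h : IsAsymptoticFlow Λ R ω) :
    Integrable (fun x => Λ.surfaceTension (ω x)) (volume.restrict R) := by
  have hmem := h.ae_mem_newtonPolytope hR.measurableSet
  refine IntegrableOn.of_bound hR.measure_lt_top ?_ (Λ.freeEnergy 0) ?_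
  · exact Λ.aestronglyMeasurable_surfaceTension_comp h.1.restrict hmem
  · filter_upwards [hmem] with x hx using Λ.norm_surfaceTension_le hx

lemma integrable_inner_gradient {μ : Measure (Vec d)} {V : Vec d → Vec d} (hV : Integrable V μ)
    {φ : Vec d → ℝ} (hφ : ContDiff ℝ (⊤ : ℕ∞) φ) (hφc : HasCompactSupport φ) :
    Integrable (fun x => (inner ℝ (V x) (gradient φ x) : ℝ)) μ := by
  obtain ⟨C, hC⟩ := hφc.gradient.exists_bound_of_continuous hφ.continuous_gradient
  refine (hV.norm.mul_const C).mono' (hV.1.inner hφ.continuous_gradient.aestronglyMeasurable)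
    (Eventually.of_forall fun x => ?_)
  exact (norm_inner_le_norm _ _).trans (mul_le_mul_of_nonneg_left (hC x) (norm_nonneg _))

/-! ### Facet-free flows and their gauge flows -/

lemma IsFacetFree.ae_mem_interior {ω : Vec d → Vec d} (h : IsFacetFree Λ R ω) :
    ∀ᵐ x, x ∈ interior R → ω x ∈ interior Λ.newtonPolytope := by
  have hnull : volume {x | x ∈ interior R ∧ ω x ∉ interior Λ.newtonPolytope} = 0 := by
    refine measure_null_of_locally_null _ fun x hx => ?_
    obtain ⟨U, hU, C, -, hCN, hUC⟩ := h x hx.1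
    -- The first piece lies in the exceptional null set of `U`; the second is empty because `C` is
    -- inside the open polytope.
    refine ⟨U ∩ {x | ¬ (x ∈ U → ω x ∈ C)} ∪ U ∩ {x | ω x ∈ C} ∩
      {x | x ∈ interior R ∧ ω x ∉ interior Λ.newtonPolytope}, ?_, ?_⟩
    · filter_upwards [mem_nhdsWithin_of_mem_nhds hU, self_mem_nhdsWithin] with y hy hy2
      by_cases hyC : ω y ∈ C
      · exact Or.inr ⟨⟨hy, hyC⟩, hy2⟩
      · exact Or.inl ⟨hy, fun h => hyC (h hy)⟩
    · refine measure_union_null (measure_mono_null inter_subset_right hUC) ?_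
      convert measure_empty (μ := volume) using 2
      ext y
      simp only [mem_inter_iff, mem_ofPred_eq, mem_empty_iff_false, iff_false, not_and]
      exact fun hy _ hy2 => hy2 (hCN hy.2)
  rw [ae_iff]
  convert hnull using 2
  ext x
  simp

/-- A finite cover of `K` makes the condition uniform, so that on `K` the flow keeps a positive
distance from the boundary of the polytope. -/
lemma IsFacetFree.exists_compact {ω : Vec d → Vec d} (h : IsFacetFree Λ R ω) {K : Set (Vec d)}
    (hK : IsCompact K) (hKR : K ⊆ interior R) :
    ∃ C, IsCompact C ∧ C ⊆ interior Λ.newtonPolytope ∧ ∀ᵐ y, y ∈ K → ω y ∈ C := by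
  refine hK.induction_on (p := fun K => ∃ C, IsCompact C ∧ C ⊆ interior Λ.newtonPolytope ∧
    ∀ᵐ y, y ∈ K → ω y ∈ C) ⟨∅, isCompact_empty, empty_subset _, by simp⟩ ?_ ?_ ?_
  · rintro s t hst ⟨C, hC, hCN, hCt⟩
    exact ⟨C, hC, hCN, hCt.mono fun y hy hys => hy (hst hys)⟩
  · rintro s t ⟨C, hC, hCN, hCs⟩ ⟨C', hC', hCN', hCt⟩
    refine ⟨C ∪ C', hC.union hC', union_subset hCN hCN', ?_⟩
    filter_upwards [hCs, hCt] with y hs ht hy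
    exact hy.imp hs ht
  · intro x hx
    obtain ⟨U, hU, C, hC⟩ := h x (hKR hx)
    exact ⟨U, mem_nhdsWithin_of_mem_nhds hU, C, hC⟩

lemma aestronglyMeasurable_gradient_surfaceTension_comp {μ : Measure (Vec d)}
    {ω : Vec d → Vec d} (hω : AEStronglyMeasurable ω μ)
    (hmem : ∀ᵐ x ∂μ, ω x ∈ interior Λ.newtonPolytope) :
    AEStronglyMeasurable (fun x => gradient Λ.surfaceTension (ω x)) μ := by
  classical
  have hm : Measurable ((interior Λ.newtonPolytope).piecewise (gradient Λ.surfaceTension) 0) :=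
    Λ.continuousOn_gradient_surfaceTension.measurable_piecewise continuousOn_const
      isOpen_interior.measurableSet
  refine (hm.comp_aemeasurable hω.aemeasurable).aestronglyMeasurable.congr ?_
  filter_upwards [hmem] with x hx
  simp [hx]

lemma IsFacetFree.ae_gradient_gaugeFlow {ω : Vec d → Vec d} (h : IsFacetFree Λ R ω) :
    ∀ᵐ x, x ∈ interior R → gradient Λ.freeEnergy (gaugeFlow Λ ω x) = ω x := by
  filter_upwards [h.ae_mem_interior] with x hx hxR
  exact Λ.gradient_freeEnergy_gradient_surfaceTension (hx hxR)

lemma IsFacetFree.aestronglyMeasurable_gaugeFlow {ω : Vec d → Vec d} (h : IsFacetFree Λ R ω)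
    (hω : AEStronglyMeasurable ω) :
    AEStronglyMeasurable (gaugeFlow Λ ω) (volume.restrict (interior R)) :=
  aestronglyMeasurable_gradient_surfaceTension_comp hω.restrict
    ((ae_restrict_iff' isOpen_interior.measurableSet).2 h.ae_mem_interior)

lemma IsFacetFree.exists_norm_gaugeFlow_le {ω : Vec d → Vec d} (h : IsFacetFree Λ R ω)
    {K : Set (Vec d)} (hK : IsCompact K) (hKR : K ⊆ interior R) :
    ∃ B : ℝ, ∀ᵐ x, x ∈ K → ‖gaugeFlow Λ ω x‖ ≤ B := by
  obtain ⟨C, hC, hCN, hKC⟩ := h.exists_compact hK hKR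
  obtain ⟨B, hB⟩ := hC.exists_bound_of_continuousOn
    (Λ.continuousOn_gradient_surfaceTension.mono hCN)
  exact ⟨B, hKC.mono fun x hx hxK => hB _ (hx hxK)⟩

lemma IsFacetFree.locallyIntegrableOn_gaugeFlow {ω : Vec d → Vec d} (h : IsFacetFree Λ R ω)
    (hω : AEStronglyMeasurable ω) : LocallyIntegrableOn (gaugeFlow Λ ω) (interior R) volume := by
  rw [locallyIntegrableOn_iff isOpen_interior.isLocallyClosed]
  intro K hKR hK
  obtain ⟨B, hB⟩ := h.exists_norm_gaugeFlow_le hK hKR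
  exact IntegrableOn.of_bound hK.measure_lt_top
    ((h.aestronglyMeasurable_gaugeFlow hω).mono_measure (Measure.restrict_mono hKR le_rfl)) B
    ((ae_restrict_iff' hK.measurableSet).2 hB)

/-! ### Stationarity of limit shapes -/

/-- For small `t > 0` the flow `ω + tV` is a competitor. The tangent plane at the perturbed point
gives `σ(ω + tV) - σ(ω) ≤ t ⟪∇σ(ω + tV), V⟫`, so minimality makes the integral of `⟪∇σ(ω + tV), V⟫`
nonnegative, and `t → 0` by dominated convergence. -/
lemma IsLimitShape.integral_inner_gaugeFlow_nonneg (hR : IsCompact R) {b : SignedMeasure (Vec d)}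
    {ω : Vec d → Vec d} (hω : IsLimitShape Λ R b ω) (hfree : IsFacetFree Λ R ω)
    {V : Vec d → Vec d} (hVm : AEStronglyMeasurable V) {M : ℝ} (hM : ∀ x, ‖V x‖ ≤ M)
    {K : Set (Vec d)} (hK : IsCompact K) (hKR : K ⊆ interior R) (hVK : ∀ x, x ∉ K → V x = 0)
    (hdiv : ∀ φ : Vec d → ℝ, ContDiff ℝ (⊤ : ℕ∞) φ → HasCompactSupport φ →
      ∫ x, inner ℝ (V x) (gradient φ x) = 0) :
    0 ≤ ∫ x, (inner ℝ (gaugeFlow Λ ω x) (V x) : ℝ) := by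
  obtain ⟨hflow, hflux, hmin⟩ := hω
  obtain ⟨C, hC, hCN, hKC⟩ := hfree.exists_compact hK hKR
  obtain ⟨r, hr, hrN⟩ := hC.exists_cthickening_subset_open isOpen_interior hCN
  have hM0 : 0 ≤ M := (norm_nonneg _).trans (hM 0)
  have hKR' : K ⊆ R := hKR.trans interior_subset
  have hVi : Integrable V := by
    have : IntegrableOn V K volume :=
      IntegrableOn.of_bound hK.measure_lt_top hVm.restrict M (Eventually.of_forall hM)
    exact this.integrable_of_forall_notMem_eq_zero hVK
  have hωi := hflow.integrable hR
  obtain ⟨B, hB⟩ := hC.cthickening.exists_bound_of_continuousOn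
    (Λ.continuousOn_gradient_surfaceTension.mono hrN)
  have hbd : ∀ s ∈ Metric.cthickening r C, ∀ x,
      ‖(inner ℝ (gradient Λ.surfaceTension s) (V x) : ℝ)‖ ≤ B * M := fun s hs x =>
    (norm_inner_le_norm _ _).trans (mul_le_mul (hB _ hs) (hM x) (norm_nonneg _)
      ((norm_nonneg _).trans (hB _ hs)))
  -- the perturbed flow stays in the interior of the Newton polytope
  have hmemK : ∀ t : ℝ, 0 ≤ t → t * M ≤ r → ∀ᵐ x, x ∈ K →
      ω x + t • V x ∈ Metric.cthickening r C := by
    intro t ht htr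
    filter_upwards [hKC] with x hx hxK
    refine Metric.mem_cthickening_of_dist_le _ _ _ _ (hx hxK) ?_
    rw [dist_eq_norm, add_sub_cancel_left, norm_smul, Real.norm_of_nonneg ht]
    exact (mul_le_mul_of_nonneg_left (hM x) ht).trans htr
  have hpert : ∀ t : ℝ, 0 < t → t * M ≤ r →
      0 ≤ ∫ x in K, (inner ℝ (gradient Λ.surfaceTension (ω x + t • V x)) (V x) : ℝ) := by
    intro t ht htr
    have hmem := hmemK t ht.le htr
    -- The set `S` is left free: `interior R` serves for the divergence, `R` for the boundary flux.
    have hint : ∀ S : Set (Vec d), K ⊆ S → ∀ φ : Vec d → ℝ, ContDiff ℝ (⊤ : ℕ∞) φ →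
        HasCompactSupport φ → ∫ x in S, (inner ℝ (ω x + t • V x) (gradient φ x) : ℝ) =
          ∫ x in S, (inner ℝ (ω x) (gradient φ x) : ℝ) := by
      intro S hKS φ hφ hφc
      simp only [inner_add_left, inner_smul_left, conj_trivial]
      rw [integral_add (integrable_inner_gradient hωi.restrict hφ hφc)
        ((integrable_inner_gradient hVi.restrict hφ hφc).const_mul t), integral_const_mul,
        setIntegral_eq_integral_of_forall_compl_eq_zero (f := fun x => inner ℝ (V x) (gradient φ x))
          (fun x hx => by rw [hVK x fun h => hx (hKS h), inner_zero_left]), hdiv φ hφ hφc,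
        mul_zero, add_zero]
    have hflow' : IsAsymptoticFlow Λ R fun x => ω x + t • V x := by
      refine ⟨hflow.1.add (hVm.const_smul t), ?_, ⟨?_, ?_⟩, ?_⟩
      · filter_upwards [hflow.2.1] with x hx hxR
        rw [hx hxR, hVK x fun h => hxR (hKR' h), smul_zero, add_zero]
      · exact (hωi.add (hVi.smul t)).locallyIntegrable.locallyIntegrableOn _
      · intro φ hφ
        rw [hint _ hKR φ hφ.1 hφ.2.1]
        exact hflow.2.2.1.2 φ hφ
      · filter_upwards [hmem, hflow.2.2.2] with x hx hx2 hxR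
        by_cases hxK : x ∈ K
        · exact interior_subset (hrN (hx hxK))
        · rw [hVK x hxK, smul_zero, add_zero]
          exact hx2 hxR
    have hflux' : HasBoundaryFlux R (fun x => ω x + t • V x) b := fun φ hφ hφc => by
      rw [hint _ hKR' φ hφ hφc]
      exact hflux φ hφ hφc
    have hle := hmin _ hflow' hflux'
    have hi1 := integrableOn_surfaceTension hR hflow
    have hi2 := integrableOn_surfaceTension hR hflow'
    have hdiff : 0 ≤ ∫ x in K, (Λ.surfaceTension (ω x + t • V x) - Λ.surfaceTension (ω x)) := by
      rw [← setIntegral_eq_of_subset_of_forall_sdiff_eq_zero hR.measurableSet hKR'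
        (fun x hx => by rw [hVK x hx.2, smul_zero, add_zero, sub_self]), integral_sub hi2 hi1]
      linarith
    have hKint : ∀ᵐ x ∂volume.restrict K, ω x + t • V x ∈ Metric.cthickening r C :=
      (ae_restrict_iff' hK.measurableSet).2 hmem
    have hgm : AEStronglyMeasurable (fun x => gradient Λ.surfaceTension (ω x + t • V x))
        (volume.restrict K) :=
      aestronglyMeasurable_gradient_surfaceTension_comp hflow'.1.restrict
        (hKint.mono fun x hx => hrN hx)
    have hgi : Integrable (fun x =>
        (inner ℝ (gradient Λ.surfaceTension (ω x + t • V x)) (V x) : ℝ)) (volume.restrict K) := by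
      refine IntegrableOn.of_bound hK.measure_lt_top (hgm.inner hVm.restrict) (B * M) ?_
      filter_upwards [hKint] with x hx using hbd _ hx x
    have hcomp : ∫ x in K, (Λ.surfaceTension (ω x + t • V x) - Λ.surfaceTension (ω x)) ≤
        ∫ x in K, t * (inner ℝ (gradient Λ.surfaceTension (ω x + t • V x)) (V x) : ℝ) := by
      refine integral_mono_ae ((hi2.sub hi1).mono_measure (Measure.restrict_mono hKR' le_rfl))
        (hgi.const_mul t) ?_
      have hN : ∀ᵐ x ∂volume.restrict K, ω x ∈ Λ.newtonPolytope :=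
        ae_restrict_of_ae_restrict_of_subset hKR' (hflow.ae_mem_newtonPolytope hR.measurableSet)
      filter_upwards [hKint, hN] with x hx hx2
      have h1 := Λ.surfaceTension_add_inner_le hx2
        (gradient Λ.surfaceTension (ω x + t • V x))
      rw [Λ.gradient_freeEnergy_gradient_surfaceTension (hrN hx), sub_add_cancel_left,
        inner_neg_left, inner_smul_left, conj_trivial, real_inner_comm] at h1
      linarith
    rw [integral_const_mul] at hcomp
    exact nonneg_of_mul_nonneg_right (hdiff.trans hcomp) ht
  -- pass to the limit
  obtain ⟨t, ht0, ht⟩ : ∃ t : ℕ → ℝ, (∀ n, 0 < t n) ∧ Tendsto t atTop (𝓝 0) :=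
    ⟨fun n => 1 / ((n : ℝ) + 1), fun n => by positivity,
      tendsto_one_div_add_atTop_nhds_zero_nat⟩
  have hsmall : ∀ᶠ n : ℕ in atTop, t n * M ≤ r := by
    have := ht.mul_const M
    rw [zero_mul] at this
    exact (this.eventually (gt_mem_nhds hr)).mono fun n hn => hn.le
  have hωK : ∀ᵐ x ∂volume.restrict K, ω x ∈ C := (ae_restrict_iff' hK.measurableSet).2 hKC
  have hKall : ∀ᶠ n : ℕ in atTop, ∀ᵐ x ∂volume.restrict K,
      ω x + t n • V x ∈ Metric.cthickening r C := by
    filter_upwards [hsmall] with n hn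
    exact (ae_restrict_iff' hK.measurableSet).2 (hmemK _ (ht0 n).le hn)
  have hlim : Tendsto (fun n : ℕ => ∫ x in K,
      (inner ℝ (gradient Λ.surfaceTension (ω x + t n • V x)) (V x) : ℝ)) atTop
      (𝓝 (∫ x in K, (inner ℝ (gaugeFlow Λ ω x) (V x) : ℝ))) := by
    refine tendsto_integral_filter_of_dominated_convergence (fun _ => B * M) ?_ ?_ ?_ ?_
    · filter_upwards [hKall] with n hn
      have h1 : AEStronglyMeasurable (fun x => ω x + t n • V x)
          (volume.restrict K) := (hflow.1.add (hVm.const_smul (t n))).restrict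
      have h2 := aestronglyMeasurable_gradient_surfaceTension_comp h1
        (hn.mono fun x hx => hrN hx)
      exact h2.inner hVm.restrict
    · filter_upwards [hKall] with n hn
      filter_upwards [hn] with x hx using hbd _ hx x
    · exact integrable_const_iff.2 (Or.inr ⟨by simpa using hK.measure_lt_top⟩)
    · filter_upwards [hωK] with x hx
      have h1 : Tendsto (fun n : ℕ => ω x + t n • V x) atTop (𝓝 (ω x)) := by
        have := (ht.smul_const (V x)).const_add
          (ω x)
        rwa [zero_smul, add_zero] at this
      have h2 : ContinuousAt (gradient Λ.surfaceTension) (ω x) :=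
        Λ.continuousOn_gradient_surfaceTension.continuousAt
          (isOpen_interior.mem_nhds (hCN hx))
      exact (h2.tendsto.comp h1).inner tendsto_const_nhds
  have hfinal : 0 ≤ ∫ x in K, (inner ℝ (gaugeFlow Λ ω x) (V x) : ℝ) :=
    ge_of_tendsto hlim (hsmall.mono fun n hn => hpert _ (ht0 n) hn)
  rwa [setIntegral_eq_integral_of_forall_compl_eq_zero fun x hx => by
    rw [hVK x hx, inner_zero_right]] at hfinal

/-- The first variation of the surface tension functional at a limit shape without facets. -/
theorem IsLimitShape.integral_inner_gaugeFlow_eq_zero (hR : IsCompact R)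
    {b : SignedMeasure (Vec d)} {ω : Vec d → Vec d} (hω : IsLimitShape Λ R b ω)
    (hfree : IsFacetFree Λ R ω) {V : Vec d → Vec d} (hVm : AEStronglyMeasurable V) {M : ℝ}
    (hM : ∀ x, ‖V x‖ ≤ M) {K : Set (Vec d)} (hK : IsCompact K) (hKR : K ⊆ interior R)
    (hVK : ∀ x, x ∉ K → V x = 0)
    (hdiv : ∀ φ : Vec d → ℝ, ContDiff ℝ (⊤ : ℕ∞) φ → HasCompactSupport φ →
      ∫ x, inner ℝ (V x) (gradient φ x) = 0) :
    ∫ x, (inner ℝ (gaugeFlow Λ ω x) (V x) : ℝ) = 0 := by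
  refine le_antisymm ?_ (hω.integral_inner_gaugeFlow_nonneg hR hfree hVm hM hK hKR hVK hdiv)
  have := hω.integral_inner_gaugeFlow_nonneg hR hfree (V := fun x => - V x) hVm.neg (M := M)
    (fun x => by rw [norm_neg]; exact hM x) hK hKR (fun x hx => by rw [hVK x hx, neg_zero])
    (fun φ hφ hφc => by simp only [inner_neg_left, integral_neg, hdiv φ hφ hφc, neg_zero])
  simp only [inner_neg_right, integral_neg] at this
  linarith

/-! ### Uniqueness of gauge functions with given boundary values -/

/-- Finitely many neighborhoods on which `|u| ≤ δ` cover the compact frontier; `K` is what remains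
of `R`. Truncations of `u` at level `δ` are thereby supported away from the frontier. -/
lemma exists_compact_of_tendsto_frontier (hR : IsCompact R) {u : Vec d → ℝ}
    (hu : ∀ y ∈ frontier R, Tendsto u (𝓝[interior R] y ⊓ ae volume) (𝓝 0)) {δ : ℝ} (hδ : 0 < δ) :
    ∃ K, IsCompact K ∧ K ⊆ interior R ∧
      ∀ᵐ x ∂volume.restrict (interior R), x ∉ K → |u x| ≤ δ := by
  have hfr : IsCompact (frontier R) := hR.of_isClosed_subset isClosed_frontier
    (frontier_subset_iff_isClosed.2 hR.isClosed)
  obtain ⟨U, hU, hRU, hUu⟩ : ∃ U, IsOpen U ∧ frontier R ⊆ U ∧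
      ∀ᵐ x, x ∈ U → x ∈ interior R → |u x| ≤ δ := by
    refine hfr.induction_on (p := fun S => ∃ U, IsOpen U ∧ S ⊆ U ∧
      ∀ᵐ x, x ∈ U → x ∈ interior R → |u x| ≤ δ) ⟨∅, isOpen_empty, le_rfl, by simp⟩ ?_ ?_ ?_
    · rintro s t hst ⟨U, hU, htU, h⟩
      exact ⟨U, hU, hst.trans htU, h⟩
    · rintro s t ⟨U, hU, hsU, h⟩ ⟨U', hU', htU, h'⟩
      refine ⟨U ∪ U', hU.union hU', union_subset_union hsU htU, ?_⟩
      filter_upwards [h, h'] with x hx hx' hxU hxR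
      exact hxU.elim (fun h => hx h hxR) fun h => hx' h hxR
    · intro y hy
      have h1 : ∀ᶠ x in 𝓝[interior R] y ⊓ ae volume, |u x| ≤ δ := by
        filter_upwards [(hu y hy).eventually (Metric.closedBall_mem_nhds 0 hδ)] with x hx
        simpa using hx
      obtain ⟨s, hs, t, ht, hst⟩ := mem_inf_iff_superset.1 h1
      obtain ⟨U, hU, hyU, hUs⟩ := mem_nhdsWithin.1 hs
      refine ⟨U, mem_nhdsWithin_of_mem_nhds (hU.mem_nhds hyU), U, hU, le_rfl, ?_⟩
      filter_upwards [ht] with x hx hxU hxR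
      exact hst ⟨hUs ⟨hxU, hxR⟩, hx⟩
  refine ⟨R \ U, hR.diff hU, fun x hx => ?_, ?_⟩
  · by_contra hxi
    exact hx.2 (hRU ⟨subset_closure hx.1, hxi⟩)
  · rw [ae_restrict_iff' isOpen_interior.measurableSet]
    filter_upwards [hUu] with x hx hxR hxK
    refine hx ?_ hxR
    by_contra hxU
    exact hxK ⟨interior_subset hxR, hxU⟩

lemma IsWeaklyDivFree.sub {Ω : Set (Vec d)} {V W : Vec d → Vec d} (hV : IsWeaklyDivFree Ω V)
    (hW : IsWeaklyDivFree Ω W) : IsWeaklyDivFree Ω fun x => V x - W x := by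
  refine ⟨hV.1.sub hW.1, fun φ hφ => ?_⟩
  have hi : ∀ {f : Vec d → Vec d}, LocallyIntegrableOn f Ω volume →
      IntegrableOn (fun x => (inner ℝ (f x) (gradient φ x) : ℝ)) Ω := by
    intro f hf
    simp only [inner_eq_sum_mul]
    refine integrable_finsetSum _ fun i _ => ?_
    have := (LocallyIntegrableOn.integrable_smul_of_tsupport_subset (hf.euclidean_apply i)
      (hφ.gradient_apply i).1.continuous (hφ.gradient_apply i).2.1
      (hφ.gradient_apply i).2.2).integrableOn (s := Ω)
    simpa [mul_comm, IntegrableOn] using this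
  simp only [inner_sub_left]
  rw [integral_sub (hi hV.1) (hi hW.1), hV.2 φ hφ, hW.2 φ hφ, sub_zero]

lemma HasBoundaryValues.tendsto_sub {H H' Hb : Vec d → ℝ} (h : HasBoundaryValues R H Hb)
    (h' : HasBoundaryValues R H' Hb) :
    ∀ y ∈ frontier R, Tendsto (fun x => H x - H' x) (𝓝[interior R] y ⊓ ae volume) (𝓝 0) :=
  fun y hy => by simpa using (h y hy).sub (h' y hy)

/-- The comparison principle for `u = H - H'` and `V = ∇F(A) - ∇F(A')`. Strict monotonicity of `∇F`
gives the sign of `⟪V, A - A'⟫`, and `V` is bounded because the polytope is. Then `δ = 1 / (n + 1)`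
tends to zero. -/
lemma ae_gaugeFunction_le (hR : IsCompact R) {H H' Hb : Vec d → ℝ}
    {A A' : Vec d → Vec d} (h : IsWeakGaugeSolution Λ (interior R) H A)
    (h' : IsWeakGaugeSolution Λ (interior R) H' A') (hb : HasBoundaryValues R H Hb)
    (hb' : HasBoundaryValues R H' Hb) : ∀ᵐ x ∂volume.restrict (interior R), H x ≤ H' x := by
  obtain ⟨M, hM0, hM⟩ := Λ.exists_norm_le_of_mem_newtonPolytope
  have hn : ∀ n : ℕ, ∀ᵐ x ∂volume.restrict (interior R), H x - H' x ≤ 1 / ((n : ℝ) + 1) := by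
    intro n
    obtain ⟨K, hK, hKR, hle⟩ := exists_compact_of_tendsto_frontier hR (hb.tendsto_sub hb')
      (δ := 1 / ((n : ℝ) + 1)) (by positivity)
    refine (h.1.sub h'.1).ae_le_of_isWeaklyDivFree Λ.dim_pos isOpen_interior hK hKR
      (h.2.sub h'.2) (M := M + M) (Eventually.of_forall fun x => ?_)
      (Eventually.of_forall fun x => ?_) (by positivity)
      (hle.mono fun x hx hxK => (le_abs_self _).trans (hx hxK))
    · exact (norm_sub_le _ _).trans (add_le_add (hM _ (Λ.gradient_freeEnergy_mem _))
        (hM _ (Λ.gradient_freeEnergy_mem _)))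
    · rcases eq_or_ne (A x) (A' x) with heq | hne
      · simp [heq]
      · have h1 := Λ.freeEnergy_add_inner_lt hne
        have h2 := Λ.freeEnergy_add_inner_lt hne.symm
        rw [← neg_sub, inner_neg_right] at h1
        have h3 : (0 : ℝ) < inner ℝ (gradient Λ.freeEnergy (A x) - gradient Λ.freeEnergy (A' x))
            (A x - A' x) := by
          rw [inner_sub_left]
          linarith
        exact ⟨h3.le, fun h0 => absurd h0 h3.ne'⟩
  filter_upwards [ae_all_iff.2 hn] with x hx
  have := ge_of_tendsto' (tendsto_one_div_add_atTop_nhds_zero_nat (𝕜 := ℝ)) hx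
  linarith

/-- Uniqueness for the Dirichlet problem of the gauge equation. -/
theorem IsWeakGaugeSolution.ae_eq (hR : IsCompact R) {H H' Hb : Vec d → ℝ}
    {A A' : Vec d → Vec d} (h : IsWeakGaugeSolution Λ (interior R) H A)
    (h' : IsWeakGaugeSolution Λ (interior R) H' A') (hb : HasBoundaryValues R H Hb)
    (hb' : HasBoundaryValues R H' Hb) :
    ∀ᵐ x, x ∈ interior R → A x = A' x ∧ H x = H' x := by
  have h1 : ∀ᵐ x, x ∈ interior R → H x - H' x = 0 := by
    rw [← ae_restrict_iff' isOpen_interior.measurableSet]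
    filter_upwards [ae_gaugeFunction_le hR h h' hb hb', ae_gaugeFunction_le hR h' h hb' hb]
      with x hx hx'
    linarith
  filter_upwards [h1, (h.1.sub h'.1).ae_eq_zero isOpen_interior h1] with x hx hx' hxR
  exact ⟨sub_eq_zero.1 (hx' hxR), sub_eq_zero.1 (hx hxR)⟩

/-! ### Solutions of the dual equations are gauge flows -/

lemma ae_restrict_interior_eq (hR : IsCompact R) (hR0 : volume (frontier R) = 0) :
    volume.restrict (interior R) = volume.restrict R := by
  refine Measure.restrict_congr_set ?_
  have h : (interior R : Set (Vec d)) ≤ᵐ[volume] R := interior_subset.eventuallyLE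
  refine h.antisymm ?_
  rw [ae_le_set, ← hR.isClosed.frontier_eq]
  exact hR0

lemma isAsymptoticFlow_dualFlow (hR : IsCompact R) (hR0 : volume (frontier R) = 0)
    {A : Vec d → Vec d}
    (hdiv : IsWeaklyDivFree (interior R) (fun x => gradient Λ.freeEnergy (A x))) :
    IsAsymptoticFlow Λ R (dualFlow Λ R A) := by
  have hae : ∀ᵐ x, x ∈ R → x ∈ interior R := by
    have := ae_restrict_mem (μ := volume) (isOpen_interior (s := R)).measurableSet
    rw [ae_restrict_interior_eq hR hR0] at this
    exact (ae_restrict_iff' hR.measurableSet).1 this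
  refine ⟨?_, ?_, ⟨?_, fun φ hφ => ?_⟩, ?_⟩
  · exact (aestronglyMeasurable_indicator_iff isOpen_interior.measurableSet).2
      hdiv.1.aestronglyMeasurable
  · exact Eventually.of_forall fun x hx => indicator_of_notMem (fun h => hx (interior_subset h)) _
  · intro x hx
    obtain ⟨U, hU, hi⟩ := hdiv.1 x hx
    refine ⟨U ∩ interior R, inter_mem hU self_mem_nhdsWithin, ?_⟩
    rw [dualFlow, integrableOn_indicator_iff]
    · exact hi.mono_set (inter_subset_right.trans inter_subset_left)
    · exact isOpen_interior.measurableSet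
  · rw [← hdiv.2 φ hφ]
    refine setIntegral_congr_fun isOpen_interior.measurableSet fun x hx => ?_
    simp only [dualFlow, indicator_of_mem hx]
  · filter_upwards [hae] with x hx hxR
    rw [dualFlow, indicator_of_mem (hx hxR)]
    exact Λ.gradient_freeEnergy_mem _

/-- `A` calibrates its dual flow: against any competitor, the linear term of the tangent plane
inequality integrates to zero. For another minimizer the nonnegative defect in that inequality has
zero integral, so equality holds pointwise almost everywhere. -/
theorem isLimitShape_dualFlow (hR : IsCompact R) (hR0 : volume (frontier R) = 0)
    {b : SignedMeasure (Vec d)} {A : Vec d → Vec d}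
    (hdiv : IsWeaklyDivFree (interior R) (fun x => gradient Λ.freeEnergy (A x)))
    (hA : AEStronglyMeasurable A (volume.restrict (interior R))) (hgrad : IsGradientUpToBoundary R A)
    (hflux : HasBoundaryFlux R (dualFlow Λ R A) b) :
    IsLimitShape Λ R b (dualFlow Λ R A) ∧ ∀ ω : Vec d → Vec d, IsLimitShape Λ R b ω →
      ∀ᵐ x, x ∈ interior R → gradient Λ.freeEnergy (A x) = ω x ∧ gaugeFlow Λ ω x = A x := by
  have hμ := ae_restrict_interior_eq hR hR0
  have hflow := isAsymptoticFlow_dualFlow hR hR0 hdiv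
  rw [hμ] at hA
  obtain ⟨φ, hφ, hlim⟩ := hgrad
  rw [hμ] at hlim
  have hφi : ∀ n, Integrable (gradient (φ n)) := fun n => integrable_gradient (hφ n).1 (hφ n).2
  -- One approximating gradient within `L¹` distance `1` is enough.
  have hAi : Integrable A (volume.restrict R) := by
    obtain ⟨n, hn⟩ := ((ENNReal.tendsto_nhds_zero.1 hlim) 1 one_pos).exists
    have h1 : Integrable (fun x => gradient (φ n) x - A x) (volume.restrict R) :=
      ⟨(hφi n).1.restrict.sub hA, hn.trans_lt ENNReal.one_lt_top⟩
    exact ((hφi n).restrict.sub h1).congr (Eventually.of_forall fun x => by simp)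
  have hdual : ∀ᵐ x ∂volume.restrict R, dualFlow Λ R A x = gradient Λ.freeEnergy (A x) := by
    rw [← hμ]
    filter_upwards [ae_restrict_mem isOpen_interior.measurableSet] with x hx
    exact indicator_of_mem hx _
  -- competitors pair with `A` like the dual flow
  have hpair : ∀ ω, IsAsymptoticFlow Λ R ω → HasBoundaryFlux R ω b →
      Integrable (fun x => (inner ℝ (ω x - dualFlow Λ R A x) (A x) : ℝ)) (volume.restrict R) ∧
      ∫ x in R, (inner ℝ (ω x - dualFlow Λ R A x) (A x) : ℝ) = 0 := by
    intro ω hω hωb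
    obtain ⟨M, hM⟩ := hω.exists_norm_le
    obtain ⟨M', hM'⟩ := hflow.exists_norm_le
    have hb : ∀ᵐ x ∂volume.restrict R, ‖ω x - dualFlow Λ R A x‖ ≤ M + M' := by
      filter_upwards [ae_restrict_of_ae hM, ae_restrict_of_ae hM'] with x hx hx'
      exact (norm_sub_le _ _).trans (add_le_add hx hx')
    have hm : AEStronglyMeasurable (fun x => ω x - dualFlow Λ R A x) (volume.restrict R) :=
      (hω.1.sub hflow.1).restrict
    constructor
    · refine (hAi.norm.const_mul (M + M')).mono' (hm.inner hA) ?_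
      filter_upwards [hb] with x hx
      exact (norm_inner_le_norm _ _).trans (mul_le_mul_of_nonneg_right hx (norm_nonneg _))
    · have h1 := tendsto_integral_inner_of_L1 hm hb
        (Eventually.of_forall fun n => (hφi n).restrict) hA hlim
      refine tendsto_nhds_unique h1 (tendsto_const_nhds.congr fun n => ?_)
      simp only [inner_sub_left]
      rw [integral_sub (integrable_inner_gradient (hω.integrable hR).restrict (hφ n).1 (hφ n).2)
        (integrable_inner_gradient (hflow.integrable hR).restrict (hφ n).1 (hφ n).2),
        hωb _ (hφ n).1 (hφ n).2, hflux _ (hφ n).1 (hφ n).2, sub_self]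
  have hineq : ∀ ω, IsAsymptoticFlow Λ R ω → ∀ᵐ x ∂volume.restrict R,
      (inner ℝ (ω x - dualFlow Λ R A x) (A x) : ℝ) ≤
        Λ.surfaceTension (ω x) - Λ.surfaceTension (dualFlow Λ R A x) := by
    intro ω hω
    filter_upwards [hω.ae_mem_newtonPolytope hR.measurableSet, hdual] with x hx hx'
    have := Λ.surfaceTension_add_inner_le hx (A x)
    rw [hx']
    linarith
  have hmin : ∀ ω, IsAsymptoticFlow Λ R ω → HasBoundaryFlux R ω b →
      ∫ x in R, Λ.surfaceTension (dualFlow Λ R A x) ≤ ∫ x in R, Λ.surfaceTension (ω x) := by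
    intro ω hω hωb
    obtain ⟨hi, h0⟩ := hpair ω hω hωb
    have h1 := integrableOn_surfaceTension hR hω
    have h2 := integrableOn_surfaceTension hR hflow
    have := integral_mono_ae hi (h1.sub h2) (hineq ω hω)
    rw [h0, integral_sub' h1 h2] at this
    linarith
  refine ⟨⟨hflow, hflux, hmin⟩, fun ω hω => ?_⟩
  obtain ⟨hi, h0⟩ := hpair ω hω.1 hω.2.1
  have h1 := integrableOn_surfaceTension hR hω.1
  have h2 := integrableOn_surfaceTension hR hflow
  have heq : ∫ x in R, Λ.surfaceTension (ω x) = ∫ x in R, Λ.surfaceTension (dualFlow Λ R A x) :=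
    le_antisymm (hω.2.2 _ hflow hflux) (hmin ω hω.1 hω.2.1)
  have hz : ∀ᵐ x ∂volume.restrict R, Λ.surfaceTension (ω x) -
      Λ.surfaceTension (dualFlow Λ R A x) -
      (inner ℝ (ω x - dualFlow Λ R A x) (A x) : ℝ) = 0 := by
    refine (integral_eq_zero_iff_of_nonneg_ae ?_ ((h1.sub h2).sub hi)).1 ?_
    · filter_upwards [hineq ω hω.1] with x hx
      simpa using hx
    · have e1 := integral_sub (h1.sub h2) hi
      have e2 := integral_sub h1 h2
      simp only [Pi.sub_apply] at e1 ⊢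
      rw [e1, e2, h0, heq]
      simp
  rw [← ae_restrict_iff' isOpen_interior.measurableSet, hμ]
  filter_upwards [hz, hdual, hω.1.ae_mem_newtonPolytope hR.measurableSet] with x hx hx' hxN
  rw [hx'] at hx
  have h3 : gradient Λ.freeEnergy (A x) = ω x :=
    Λ.gradient_freeEnergy_eq_of_surfaceTension_eq hxN (by linarith)
  refine ⟨h3, ?_⟩
  rw [gaugeFlow, ← h3, Λ.gradient_surfaceTension_gradient]

end LimitShapes

section GradientLimits

variable {d : ℕ}

/-! ### Fields orthogonal to divergence-free fields are limits of gradients -/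

lemma gradient_fun_add {φ ψ : Vec d → ℝ} {x : Vec d} (hφ : DifferentiableAt ℝ φ x)
    (hψ : DifferentiableAt ℝ ψ x) :
    gradient (fun y => φ y + ψ y) x = gradient φ x + gradient ψ x := by
  ext i
  simp [gradient_apply_eq_fderiv, fderiv_fun_add hφ hψ]

lemma gradient_const_mul {φ : Vec d → ℝ} {x : Vec d} (hφ : DifferentiableAt ℝ φ x) (c : ℝ) :
    gradient (fun y => c * φ y) x = c • gradient φ x := by
  ext i
  simp [gradient_apply_eq_fderiv, fderiv_const_mul hφ]

/-- The square-integrable fields on `K` that are gradients of smooth compactly supported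
functions. -/
noncomputable def gradientSubmodule (K : Set (Vec d)) : Submodule ℝ (Lp (Vec d) 2 (volume.restrict K)) where
  carrier := {f | ∃ ψ : Vec d → ℝ, ContDiff ℝ (⊤ : ℕ∞) ψ ∧ HasCompactSupport ψ ∧
    f =ᵐ[volume.restrict K] gradient ψ}
  add_mem' := by
    rintro f g ⟨ψ, hψ, hψc, hf⟩ ⟨ψ', hψ', hψc', hg⟩
    refine ⟨fun x => ψ x + ψ' x, hψ.add hψ', hψc.add hψc', ?_⟩
    filter_upwards [hf, hg, Lp.coeFn_add f g] with x h1 h2 h3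
    rw [h3, Pi.add_apply, h1, h2, gradient_fun_add (hψ.differentiable (by simp) x)
      (hψ'.differentiable (by simp) x)]
  zero_mem' := by
    refine ⟨fun _ => 0, contDiff_const, HasCompactSupport.zero, ?_⟩
    filter_upwards [Lp.coeFn_zero (Vec d) 2 (volume.restrict K)] with x hx
    rw [hx, gradient_fun_const, Pi.zero_apply]
  smul_mem' := by
    rintro c f ⟨ψ, hψ, hψc, hf⟩
    refine ⟨fun x => c * ψ x, contDiff_const.mul hψ, hψc.mul_left, ?_⟩
    filter_upwards [hf, Lp.coeFn_smul c f] with x h1 h2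
    rw [h2, Pi.smul_apply, h1, gradient_const_mul (hψ.differentiable (by simp) x)]

/-- The field `α` on `Ω` is locally bounded and orthogonal to the bounded divergence-free fields
with compact support in `Ω`. -/
structure IsOrthogonalToDivFree (Ω : Set (Vec d)) (α : Vec d → Vec d) : Prop where
  locallyIntegrableOn : LocallyIntegrableOn α Ω volume
  exists_norm_le : ∀ K, IsCompact K → K ⊆ Ω → ∃ B : ℝ, ∀ᵐ x, x ∈ K → ‖α x‖ ≤ B
  integral_inner_eq_zero : ∀ (V : Vec d → Vec d) (M : ℝ) (K : Set (Vec d)),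
    AEStronglyMeasurable V → (∀ x, ‖V x‖ ≤ M) → IsCompact K → K ⊆ Ω → (∀ x, x ∉ K → V x = 0) →
    (∀ φ : Vec d → ℝ, ContDiff ℝ (⊤ : ℕ∞) φ → HasCompactSupport φ →
      ∫ x, inner ℝ (V x) (gradient φ x) = 0) → ∫ x, (inner ℝ (α x) (V x) : ℝ) = 0

namespace IsOrthogonalToDivFree

variable {Ω : Set (Vec d)} {α : Vec d → Vec d}

lemma memLp (h : IsOrthogonalToDivFree Ω α) {K : Set (Vec d)} (hK : IsCompact K) (hKΩ : K ⊆ Ω) :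
    MemLp α 2 (volume.restrict K) := by
  have : IsFiniteMeasure (volume.restrict K) := ⟨by simpa using hK.measure_lt_top⟩
  obtain ⟨B, hB⟩ := h.exists_norm_le K hK hKΩ
  exact MemLp.of_bound (h.locallyIntegrableOn.integrableOn_compact_subset hKΩ hK).1 B
    ((ae_restrict_iff' hK.measurableSet).2 hB)

/-- Orthogonality extends to integrable fields. -/
lemma integral_inner_eq_zero_of_integrable (h : IsOrthogonalToDivFree Ω α) (hΩ : IsOpen Ω)
    {K : Set (Vec d)} (hK : IsCompact K) (hKΩ : K ⊆ Ω) {V : Vec d → Vec d} (hV : Integrable V)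
    (hVK : ∀ x, x ∉ K → V x = 0)
    (hdiv : ∀ φ : Vec d → ℝ, ContDiff ℝ (⊤ : ℕ∞) φ → HasCompactSupport φ →
      ∫ x, inner ℝ (V x) (gradient φ x) = 0) : ∫ x, (inner ℝ (α x) (V x) : ℝ) = 0 := by
  obtain ⟨r, hr, hrΩ⟩ := hK.exists_cthickening_subset_open hΩ hKΩ
  have hK' : IsCompact (Metric.cthickening r K) := hK.cthickening
  obtain ⟨B, hB⟩ := h.exists_norm_le _ hK' hrΩ
  have hrest : ∀ W : Vec d → Vec d, (∀ x, x ∉ Metric.cthickening r K → W x = 0) →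
      ∫ x in Metric.cthickening r K, (inner ℝ (α x) (W x) : ℝ) = ∫ x, (inner ℝ (α x) (W x) : ℝ) :=
    fun W hW => setIntegral_eq_integral_of_forall_compl_eq_zero fun x hx => by
      rw [hW x hx, inner_zero_right]
  -- Mollifications of `V` are bounded, divergence-free and, for large `n`, supported in a slightly
  -- larger compact set on which `α` is bounded.
  have hlim := tendsto_integral_inner_of_L1 (μ := volume.restrict (Metric.cthickening r K))
    (h.locallyIntegrableOn.integrableOn_compact_subset hrΩ hK').1
    ((ae_restrict_iff' hK'.measurableSet).2 hB) (f := fun n => mollify n V) (g := V)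
    (Eventually.of_forall fun n => (integrable_mollify n hV).restrict) hV.1.restrict
    (tendsto_of_tendsto_of_tendsto_of_le_of_le tendsto_const_nhds
      (tendsto_lintegral_mollify_sub hV) (fun _ => zero_le) fun n => setLIntegral_le_lintegral _ _)
  rw [hrest V fun x hx => hVK x fun hxK => hx (Metric.self_subset_cthickening _ hxK)] at hlim
  refine tendsto_nhds_unique hlim (tendsto_const_nhds.congr' ?_)
  have h0 : ∀ᶠ n : ℕ in atTop, 1 / ((n : ℝ) + 1) < r :=
    tendsto_one_div_add_atTop_nhds_zero_nat.eventually (gt_mem_nhds hr)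
  filter_upwards [h0] with n hn
  have hcont : Continuous (mollify n V) := (contDiff_mollify n hV.locallyIntegrable).continuous
  obtain ⟨M, hM⟩ := (hasCompactSupport_mollify (n := n) hK hVK).exists_bound_of_continuous hcont
  have hz : ∀ x, x ∉ Metric.cthickening r K → mollify n V x = 0 := fun x hx => by
    by_contra hne
    exact hx (Metric.cthickening_mono hn.le _ (support_mollify_subset hVK hne))
  rw [hrest _ hz]
  exact (h.integral_inner_eq_zero _ M _ hcont.aestronglyMeasurable hM hK' hrΩ hz
    fun φ hφ hφc => integral_inner_mollify_gradient_eq_zero hV hdiv n hφ hφc).symm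

/-- The closure of a subspace is its double orthogonal complement. The potentials are not required
to vanish near the boundary of `K`, so a field orthogonal to their gradients stays divergence-free
on all of `ℝ^d` after extension by zero, and `α` is orthogonal to it. -/
lemma toLp_mem_closure (h : IsOrthogonalToDivFree Ω α) (hΩ : IsOpen Ω)
    {K : Set (Vec d)} (hK : IsCompact K) (hKΩ : K ⊆ Ω) :
    (h.memLp hK hKΩ).toLp α ∈ (gradientSubmodule K).topologicalClosure := by
  have : IsFiniteMeasure (volume.restrict K) := ⟨by simpa using hK.measure_lt_top⟩
  rw [← Submodule.orthogonal_orthogonal_eq_closure, Submodule.mem_orthogonal]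
  intro V hV
  rw [Submodule.mem_orthogonal] at hV
  have hVi : IntegrableOn V K volume := (Lp.memLp V).integrable (by norm_num)
  have hWi : Integrable (K.indicator V) := hVi.integrable_indicator hK.measurableSet
  have hWK : ∀ x, x ∉ K → K.indicator V x = 0 := fun x hx => indicator_of_notMem hx _
  have hdiv : ∀ φ : Vec d → ℝ, ContDiff ℝ (⊤ : ℕ∞) φ → HasCompactSupport φ →
      ∫ x, inner ℝ (K.indicator V x) (gradient φ x) = 0 := by
    intro φ hφ hφc
    obtain ⟨C, hC⟩ := hφc.gradient.exists_bound_of_continuous hφ.continuous_gradient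
    have hm : MemLp (gradient φ) 2 (volume.restrict K) :=
      MemLp.of_bound hφ.continuous_gradient.aestronglyMeasurable C (Eventually.of_forall hC)
    have h1 := hV (hm.toLp _) ⟨φ, hφ, hφc, hm.coeFn_toLp⟩
    rw [L2.inner_def] at h1
    rw [← setIntegral_eq_integral_of_forall_compl_eq_zero (s := K) fun x hx => by
      rw [hWK x hx, inner_zero_left], ← h1]
    refine integral_congr_ae ?_
    filter_upwards [hm.coeFn_toLp, ae_restrict_mem hK.measurableSet] with x hx hxK
    rw [hx, indicator_of_mem hxK, real_inner_comm]
  have h2 := h.integral_inner_eq_zero_of_integrable hΩ hK hKΩ hWi hWK hdiv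
  rw [← setIntegral_eq_integral_of_forall_compl_eq_zero (s := K) fun x hx => by
      rw [hWK x hx, inner_zero_right]] at h2
  rw [L2.inner_def, ← h2]
  refine integral_congr_ae ?_
  filter_upwards [(h.memLp hK hKΩ).coeFn_toLp, ae_restrict_mem hK.measurableSet] with x hx hxK
  rw [hx, indicator_of_mem hxK, real_inner_comm]

/-- On compact sets, `α` is an `L¹` limit of gradients of smooth functions. -/
theorem exists_lintegral_gradient_sub_le (h : IsOrthogonalToDivFree Ω α) (hΩ : IsOpen Ω)
    {K : Set (Vec d)} (hK : IsCompact K) (hKΩ : K ⊆ Ω) {ε : ENNReal} (hε : 0 < ε) :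
    ∃ ψ : Vec d → ℝ, ContDiff ℝ (⊤ : ℕ∞) ψ ∧ HasCompactSupport ψ ∧
      ∫⁻ x in K, ‖gradient ψ x - α x‖ₑ ≤ ε := by
  have : IsFiniteMeasure (volume.restrict K) := ⟨by simpa using hK.measure_lt_top⟩
  have hcl : (h.memLp hK hKΩ).toLp α ∈ closure (gradientSubmodule K : Set _) :=
    h.toLp_mem_closure hΩ hK hKΩ
  obtain ⟨f, hf, hlim⟩ := mem_closure_iff_seq_limit.1 hcl
  have hlim2 := (Lp.tendsto_Lp_iff_tendsto_eLpNorm' _ _).1 hlim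
  -- The Hölder constant comparing the `L¹` and `L²` norms on the finite measure space `K`.
  set c : ENNReal := (volume.restrict K) univ ^ (1 / (1 : ENNReal).toReal - 1 / (2 : ENNReal).toReal)
    with hc
  have hcne : c ≠ ⊤ := by
    refine ENNReal.rpow_ne_top_of_nonneg ?_ (measure_ne_top _ _)
    norm_num
  have hlim3 := ENNReal.Tendsto.mul_const hlim2 (Or.inr hcne)
  rw [zero_mul] at hlim3
  obtain ⟨n, hn⟩ := ((ENNReal.tendsto_nhds_zero.1 hlim3) ε hε).exists
  obtain ⟨ψ, hψ, hψc, hψf⟩ := hf n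
  refine ⟨ψ, hψ, hψc, le_trans (le_of_eq ?_) ((eLpNorm_le_eLpNorm_mul_rpow_measure_univ
    (p := 1) (q := 2) (by norm_num) ((Lp.aestronglyMeasurable (f n)).sub
      (Lp.aestronglyMeasurable _))).trans hn)⟩
  rw [eLpNorm_one_eq_lintegral_enorm]
  refine lintegral_congr_ae ?_
  filter_upwards [hψf, (h.memLp hK hKΩ).coeFn_toLp] with x h1 h2
  rw [Pi.sub_apply, h1, h2]

end IsOrthogonalToDivFree

/-! ### A Poincaré inequality -/

lemma enorm_sub_le_lintegral_gradient {u : Vec d → ℝ} (hu : ContDiff ℝ (⊤ : ℕ∞) u) (x h : Vec d) :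
    ‖u (x + h) - u x‖ₑ ≤ ∫⁻ t in Ioc (0 : ℝ) 1, ‖h‖ₑ * ‖gradient u (x + t • h)‖ₑ := by
  have hline : ∀ t : ℝ, HasDerivAt (fun t : ℝ => x + t • h) h t := fun t => by
    simpa using ((hasDerivAt_id t).smul_const h).const_add x
  have hderiv : ∀ t : ℝ, HasDerivAt (fun t : ℝ => u (x + t • h))
      (inner ℝ (gradient u (x + t • h)) h) t := fun t => by
    rw [inner_gradient_left]
    exact ((hu.differentiable (by simp) _).hasFDerivAt).comp_hasDerivAt t (hline t)
  have hcont : Continuous fun t : ℝ => (inner ℝ (gradient u (x + t • h)) h : ℝ) := by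
    have := hu.continuous_gradient
    fun_prop
  have hftc := intervalIntegral.integral_eq_sub_of_hasDerivAt (a := 0) (b := 1)
    (fun t _ => hderiv t) (hcont.intervalIntegrable _ _)
  simp only [one_smul, zero_smul, add_zero] at hftc
  rw [← hftc, intervalIntegral.integral_of_le zero_le_one]
  refine (enorm_integral_le_lintegral_enorm _).trans (lintegral_mono fun t => ?_)
  rw [← ofReal_norm, ← ofReal_norm, ← ofReal_norm, ← ENNReal.ofReal_mul (norm_nonneg _), mul_comm]
  exact ENNReal.ofReal_le_ofReal (norm_inner_le_norm _ _)

/-- Integrate the gradient along the segment from `x` to `x + h` and exchange integrals. The points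
`x + t • h` stay in the ball of radius `r + 2r`. -/
lemma lintegral_sub_translate_le {u : Vec d → ℝ} (hu : ContDiff ℝ (⊤ : ℕ∞) u) (x₀ : Vec d) (r : ℝ)
    {h : Vec d} (hh : ‖h‖ ≤ 2 * r) :
    ∫⁻ x in Metric.closedBall x₀ r, ‖u (x + h) - u x‖ₑ ≤
      ENNReal.ofReal (2 * r) * ∫⁻ x in Metric.closedBall x₀ (3 * r), ‖gradient u x‖ₑ := by
  have hg := hu.continuous_gradient
  calc ∫⁻ x in Metric.closedBall x₀ r, ‖u (x + h) - u x‖ₑ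
      ≤ ∫⁻ x in Metric.closedBall x₀ r, ∫⁻ t in Ioc (0 : ℝ) 1, ‖h‖ₑ * ‖gradient u (x + t • h)‖ₑ :=
        lintegral_mono fun x => enorm_sub_le_lintegral_gradient hu x h
    _ = ∫⁻ t in Ioc (0 : ℝ) 1, ∫⁻ x in Metric.closedBall x₀ r, ‖h‖ₑ * ‖gradient u (x + t • h)‖ₑ := by
        refine lintegral_lintegral_swap ?_
        refine Measurable.aemeasurable ?_
        have : Continuous fun p : Vec d × ℝ => gradient u (p.1 + p.2 • h) := by fun_prop
        exact this.enorm.measurable.const_mul _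
    _ ≤ ∫⁻ t in Ioc (0 : ℝ) 1, ENNReal.ofReal (2 * r) *
          ∫⁻ x in Metric.closedBall x₀ (3 * r), ‖gradient u x‖ₑ := by
        refine setLIntegral_mono' measurableSet_Ioc fun t ht => ?_
        rw [lintegral_const_mul' _ _ enorm_ne_top]
        refine mul_le_mul' ?_ ?_
        · rw [← ofReal_norm]
          exact ENNReal.ofReal_le_ofReal hh
        · rw [← lintegral_indicator Metric.isClosed_closedBall.measurableSet,
            ← lintegral_indicator Metric.isClosed_closedBall.measurableSet,
            ← lintegral_add_right_eq_self
              (fun x => (Metric.closedBall x₀ (3 * r)).indicator _ x) (t • h)]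
          refine lintegral_mono fun x => ?_
          by_cases hx : x ∈ Metric.closedBall x₀ r
          · have hx2 : x + t • h ∈ Metric.closedBall x₀ (3 * r) := by
              rw [Metric.mem_closedBall, dist_eq_norm] at hx ⊢
              have h1 : ‖t • h‖ ≤ 2 * r := by
                rw [norm_smul, Real.norm_of_nonneg ht.1.le]
                exact (mul_le_of_le_one_left (norm_nonneg _) ht.2).trans hh
              calc ‖x + t • h - x₀‖ = ‖(x - x₀) + t • h‖ := by congr 1; abel
                _ ≤ ‖x - x₀‖ + ‖t • h‖ := norm_add_le _ _
                _ ≤ 3 * r := by linarith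
            rw [indicator_of_mem hx, indicator_of_mem hx2]
          · rw [indicator_of_notMem hx]
            exact zero_le
    _ = _ := by simp

/-- A Poincaré inequality in `L¹` on balls, with a larger ball on the right hand side. -/
theorem exists_poincare (x₀ : Vec d) {r : ℝ} (hr : 0 < r) :
    ∃ C : ENNReal, C ≠ ⊤ ∧ ∀ u : Vec d → ℝ, ContDiff ℝ (⊤ : ℕ∞) u → ∃ c : ℝ,
      ∫⁻ x in Metric.closedBall x₀ r, ‖u x - c‖ₑ ≤
        C * ∫⁻ x in Metric.closedBall x₀ (3 * r), ‖gradient u x‖ₑ := by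
  set B := Metric.closedBall x₀ r with hB
  set B₂ := Metric.closedBall (0 : Vec d) (2 * r) with hB₂
  have hBm : MeasurableSet B := Metric.isClosed_closedBall.measurableSet
  have hB₂m : MeasurableSet B₂ := Metric.isClosed_closedBall.measurableSet
  have hB0 : volume B ≠ 0 := (Metric.measure_closedBall_pos volume x₀ hr).ne'
  have hBt : volume B ≠ ⊤ := (isCompact_closedBall x₀ r).measure_lt_top.ne
  have hB₂t : volume B₂ ≠ ⊤ := (isCompact_closedBall (0 : Vec d) (2 * r)).measure_lt_top.ne
  refine ⟨(volume B)⁻¹ * (ENNReal.ofReal (2 * r) * volume B₂),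
    ENNReal.mul_ne_top (ENNReal.inv_ne_top.2 hB0)
      (ENNReal.mul_ne_top ENNReal.ofReal_ne_top hB₂t), fun u hu => ?_⟩
  have hmeas : Measurable fun p : Vec d × Vec d => ‖u p.1 - u p.2‖ₑ := by
    have := hu.continuous
    exact (Continuous.enorm (by fun_prop)).measurable
  have hmeas2 : Measurable fun p : Vec d × Vec d => ‖u (p.1 + p.2) - u p.1‖ₑ := by
    have := hu.continuous
    exact (Continuous.enorm (by fun_prop)).measurable
  -- the double integral is bounded
  have hdouble : ∫⁻ y in B, ∫⁻ x in B, ‖u x - u y‖ₑ ≤ ENNReal.ofReal (2 * r) * volume B₂ *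
      ∫⁻ x in Metric.closedBall x₀ (3 * r), ‖gradient u x‖ₑ := by
    calc ∫⁻ y in B, ∫⁻ x in B, ‖u x - u y‖ₑ
        ≤ ∫⁻ y in B, ∫⁻ h in B₂, ‖u (y + h) - u y‖ₑ := by
          refine setLIntegral_mono' hBm fun y hy => ?_
          rw [← lintegral_indicator hBm, ← lintegral_indicator hB₂m,
            ← lintegral_add_left_eq_self (fun x => B.indicator _ x) y]
          refine lintegral_mono fun h => ?_
          by_cases hx : y + h ∈ B
          · have hh : h ∈ B₂ := by
              rw [hB, Metric.mem_closedBall, dist_eq_norm] at hx hy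
              rw [hB₂, mem_closedBall_zero_iff]
              calc ‖h‖ = ‖(y + h - x₀) - (y - x₀)‖ := by congr 1; abel
                _ ≤ ‖y + h - x₀‖ + ‖y - x₀‖ := norm_sub_le _ _
                _ ≤ 2 * r := by linarith
            rw [indicator_of_mem hx, indicator_of_mem hh]
          · rw [indicator_of_notMem hx]
            exact zero_le
      _ = ∫⁻ h in B₂, ∫⁻ y in B, ‖u (y + h) - u y‖ₑ :=
          lintegral_lintegral_swap hmeas2.aemeasurable
      _ ≤ ∫⁻ h in B₂, ENNReal.ofReal (2 * r) *
            ∫⁻ x in Metric.closedBall x₀ (3 * r), ‖gradient u x‖ₑ :=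
          setLIntegral_mono' hB₂m fun h hh =>
            lintegral_sub_translate_le hu x₀ r (mem_closedBall_zero_iff.1 hh)
      _ = _ := by
          rw [lintegral_const, Measure.restrict_apply_univ]
          ring
  have hm : AEMeasurable (fun y => ∫⁻ x in B, ‖u x - u y‖ₑ) (volume.restrict B) :=
    (Measurable.lintegral_prod_left' hmeas).aemeasurable
  -- Some `y` does no worse than the average of the double integral, and `c = u y` is the constant;
  -- no mean value of `u` is needed.
  obtain ⟨y, -, hy⟩ := exists_le_setLAverage hB0 hBt hm
  refine ⟨u y, hy.trans ?_⟩
  rw [setLAverage_eq, ENNReal.div_eq_inv_mul, mul_assoc]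
  gcongr

end GradientLimits

section Potentials

variable {d : ℕ}

/-! ### Rapidly converging sequences of gradients -/

lemma IsOpen.exists_compact_exhaustion {Ω : Set (Vec d)} (hΩ : IsOpen Ω) :
    ∃ K : ℕ → Set (Vec d), (∀ n, IsCompact (K n) ∧ K n ⊆ Ω) ∧
      ∀ S, IsCompact S → S ⊆ Ω → ∀ᶠ n in atTop, S ⊆ K n := by
  refine ⟨fun n => Metric.closedBall 0 n \ Metric.thickening (1 / ((n : ℝ) + 1)) Ωᶜ,
    fun n => ⟨(isCompact_closedBall _ _).diff Metric.isOpen_thickening, fun x hx => ?_⟩,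
    fun S hS hSΩ => ?_⟩
  · by_contra hxΩ
    exact hx.2 (Metric.self_subset_thickening (by positivity) _ hxΩ)
  · obtain ⟨r, hr, hrΩ⟩ := hS.exists_cthickening_subset_open hΩ hSΩ
    obtain ⟨M, hM⟩ := hS.isBounded.exists_norm_le
    have h0 : ∀ᶠ n : ℕ in atTop, 1 / ((n : ℝ) + 1) < r :=
      tendsto_one_div_add_atTop_nhds_zero_nat.eventually (gt_mem_nhds hr)
    filter_upwards [h0, tendsto_natCast_atTop_atTop.eventually_ge_atTop M] with n hn hnM x hx
    refine ⟨mem_closedBall_zero_iff.2 ((hM x hx).trans hnM), fun hxt => ?_⟩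
    obtain ⟨z, hz, hxz⟩ := Metric.mem_thickening_iff.1 hxt
    exact hz (hrΩ (Metric.mem_cthickening_of_dist_le z x _ _ hx
      (by rw [dist_comm]; exact (hxz.trans hn).le)))

lemma ENNReal.tsum_ne_top_of_eventually_le {f g : ℕ → ENNReal} (hf : ∀ n, f n ≠ ⊤)
    (hg : ∑' n, g n ≠ ⊤) (h : ∀ᶠ n in atTop, f n ≤ g n) : ∑' n, f n ≠ ⊤ := by
  obtain ⟨N, hN⟩ := eventually_atTop.1 h
  have h1 : ∑' n, f n ≤ ∑' n, ((if n < N then f n else 0) + g n) := by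
    refine ENNReal.tsum_le_tsum fun n => ?_
    by_cases hn : n < N
    · simp [hn]
    · simpa [hn] using hN n (not_lt.1 hn)
  refine ne_top_of_le_ne_top ?_ h1
  rw [ENNReal.tsum_add]
  refine ENNReal.add_ne_top.2 ⟨?_, hg⟩
  rw [tsum_eq_sum (s := Finset.range N) fun n hn => by simp_all]
  refine ENNReal.sum_ne_top.2 fun n _ => ?_
  split_ifs
  · exact hf n
  · exact ENNReal.zero_ne_top

/-- A diagonal choice: `ψ n` approximates `α` on the `n`-th compact set of an exhaustion, with
summable errors. A given compact set is contained in all but finitely many of these, and each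
remaining term is finite. -/
theorem IsOrthogonalToDivFree.exists_tsum_gradient_sub_ne_top {Ω : Set (Vec d)}
    {α : Vec d → Vec d} (h : IsOrthogonalToDivFree Ω α) (hΩ : IsOpen Ω) :
    ∃ ψ : ℕ → Vec d → ℝ, (∀ n, ContDiff ℝ (⊤ : ℕ∞) (ψ n)) ∧
      ∀ K, IsCompact K → K ⊆ Ω → ∑' n, ∫⁻ x in K, ‖gradient (ψ n) x - α x‖ₑ ≠ ⊤ := by
  obtain ⟨K, hK, hKS⟩ := hΩ.exists_compact_exhaustion
  obtain ⟨ε, hε, hεsum⟩ := ENNReal.exists_pos_sum_of_countable' one_ne_zero ℕ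
  choose ψ hψ hψc hψK using fun n =>
    h.exists_lintegral_gradient_sub_le hΩ (hK n).1 (hK n).2 (hε n)
  refine ⟨ψ, hψ, fun S hS hSΩ => ENNReal.tsum_ne_top_of_eventually_le (g := ε) (fun n => ?_)
    (hεsum.trans ENNReal.one_lt_top).ne ?_⟩
  · have h1 : Integrable (fun x => gradient (ψ n) x - α x) (volume.restrict S) :=
      (integrable_gradient (hψ n) (hψc n)).restrict.sub
        (h.locallyIntegrableOn.integrableOn_compact_subset hSΩ hS)
    exact h1.2.ne
  · filter_upwards [hKS S hS hSΩ] with n hn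
    exact (lintegral_mono_set hn).trans (hψK n)

/-! ### Potentials -/

/-- Two normalizing sequences for `u` on overlapping balls have an absolutely summable
difference. -/
lemma tsum_enorm_sub_ne_top {u : ℕ → Vec d → ℝ} (hu : ∀ n, Continuous (u n)) {c c' : ℕ → ℝ}
    {S : Set (Vec d)} (hS : volume S ≠ 0) (h : ∑' n, ∫⁻ x in S, ‖u n x - c n‖ₑ ≠ ⊤)
    (h' : ∑' n, ∫⁻ x in S, ‖u n x - c' n‖ₑ ≠ ⊤) : ∑' n, ‖c n - c' n‖ₑ ≠ ⊤ := by
  have h1 : ∑' n, ‖c n - c' n‖ₑ * volume S ≤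
      ∑' n, ((∫⁻ x in S, ‖u n x - c n‖ₑ) + ∫⁻ x in S, ‖u n x - c' n‖ₑ) := by
    refine ENNReal.tsum_le_tsum fun n => ?_
    have hm : Measurable fun x => ‖u n x - c n‖ₑ :=
      ((hu n).sub continuous_const).enorm.measurable
    rw [← lintegral_add_left hm, ← setLIntegral_const]
    refine lintegral_mono fun x => ?_
    have : c n - c' n = (u n x - c' n) - (u n x - c n) := by ring
    rw [this, add_comm]
    exact enorm_sub_le
  rw [ENNReal.tsum_mul_right, ENNReal.tsum_add] at h1
  intro htop
  rw [htop, ENNReal.top_mul hS, top_le_iff] at h1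
  exact (ENNReal.add_ne_top.2 ⟨h, h'⟩) h1

lemma tsum_lintegral_sub_ne_top_of_sub {u : ℕ → Vec d → ℝ} (hu : ∀ n, Continuous (u n))
    {c c' : ℕ → ℝ} {S : Set (Vec d)} (hS : volume S ≠ ⊤)
    (h : ∑' n, ∫⁻ x in S, ‖u n x - c n‖ₑ ≠ ⊤) (hc : ∑' n, ‖c n - c' n‖ₑ ≠ ⊤) :
    ∑' n, ∫⁻ x in S, ‖u n x - c' n‖ₑ ≠ ⊤ := by
  have h1 : ∑' n, ∫⁻ x in S, ‖u n x - c' n‖ₑ ≤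
      ∑' n, ((∫⁻ x in S, ‖u n x - c n‖ₑ) + ‖c n - c' n‖ₑ * volume S) := by
    refine ENNReal.tsum_le_tsum fun n => ?_
    have hm : Measurable fun x => ‖u n x - c n‖ₑ :=
      ((hu n).sub continuous_const).enorm.measurable
    rw [← setLIntegral_const, ← lintegral_add_left hm]
    refine lintegral_mono fun x => ?_
    have : u n x - c' n = (u n x - c n) + (c n - c' n) := by ring
    rw [this]
    exact enorm_add_le _ _
  refine ne_top_of_le_ne_top ?_ h1
  rw [ENNReal.tsum_add, ENNReal.tsum_mul_right]
  exact ENNReal.add_ne_top.2 ⟨h, ENNReal.mul_ne_top hc hS⟩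

/-- If the gradients of `u n` are locally summable on `Ω`, then so are the `u n`, after
subtraction of locally constant functions. -/
theorem exists_locallyConstant_tsum_ne_top {Ω : Set (Vec d)} (hΩ : IsOpen Ω)
    {u : ℕ → Vec d → ℝ} (hu : ∀ n, ContDiff ℝ (⊤ : ℕ∞) (u n))
    (hsum : ∀ K, IsCompact K → K ⊆ Ω → ∑' n, ∫⁻ x in K, ‖gradient (u n) x‖ₑ ≠ ⊤) :
    ∃ δ : ℕ → Vec d → ℝ, (∀ x ∈ Ω, ∀ᶠ y in 𝓝 x, ∀ n, δ n y = δ n x) ∧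
      ∀ K, IsCompact K → K ⊆ Ω → ∑' n, ∫⁻ x in K, ‖u n x - δ n x‖ₑ ≠ ⊤ := by
  have hcont : ∀ n, Continuous (u n) := fun n => (hu n).continuous
  have hloc : ∀ x, ∃ c : ℕ → ℝ, x ∈ Ω → ∃ r > 0,
      ∑' n, ∫⁻ y in Metric.ball x r, ‖u n y - c n‖ₑ ≠ ⊤ := by
    intro x
    by_cases hx : x ∈ Ω
    · obtain ⟨r, hr, hrΩ⟩ := Metric.nhds_basis_closedBall.mem_iff.1 (hΩ.mem_nhds hx)
      have hr3 : 0 < r / 3 := by positivity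
      obtain ⟨C, hC, hP⟩ := exists_poincare x hr3
      choose c hc using fun n => hP (u n) (hu n)
      refine ⟨c, fun _ => ⟨r / 3, hr3, ?_⟩⟩
      have h1 : ∑' n, ∫⁻ y in Metric.ball x (r / 3), ‖u n y - c n‖ₑ ≤
          ∑' n, C * ∫⁻ y in Metric.closedBall x (3 * (r / 3)), ‖gradient (u n) y‖ₑ :=
        ENNReal.tsum_le_tsum fun n =>
          (lintegral_mono_set Metric.ball_subset_closedBall).trans (hc n)
      refine ne_top_of_le_ne_top ?_ h1
      rw [ENNReal.tsum_mul_left]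
      refine ENNReal.mul_ne_top hC (hsum _ (isCompact_closedBall _ _) ?_)
      rwa [mul_div_cancel₀ _ (by norm_num : (3 : ℝ) ≠ 0)]
    · exact ⟨0, fun h => absurd h hx⟩
  choose c hc using hloc
  -- the set on which `c x` is a good normalization contains the component of `x`
  have hcomp : ∀ x ∈ Ω, ∀ y ∈ connectedComponentIn Ω x, ∃ r > 0,
      ∑' n, ∫⁻ z in Metric.ball y r, ‖u n z - c x n‖ₑ ≠ ⊤ := by
    intro x hx
    set G : Set (Vec d) := {y | ∃ r > 0,
      ∑' n, ∫⁻ z in Metric.ball y r, ‖u n z - c x n‖ₑ ≠ ⊤} with hG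
    have hmono : ∀ {y : Vec d} {S : Set (Vec d)} {e : ℕ → ℝ},
        (∑' n, ∫⁻ z in S, ‖u n z - e n‖ₑ) ≠ ⊤ → ∀ {T : Set (Vec d)}, T ⊆ S →
        (∑' n, ∫⁻ z in T, ‖u n z - e n‖ₑ) ≠ ⊤ := fun h _ hTS =>
      ne_top_of_le_ne_top h (ENNReal.tsum_le_tsum fun n => lintegral_mono_set hTS)
    have hGo : IsOpen G := by
      rw [Metric.isOpen_iff]
      rintro y ⟨r, hr, hy⟩
      refine ⟨r, hr, fun z hz => ⟨r - dist z y, sub_pos.2 hz, hmono (y := y) hy ?_⟩⟩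
      exact Metric.ball_subset_ball' (by linarith)
    -- `G` is open, so it suffices that it is closed relative to the component. At a limit point
    -- `y`, the normalizations `c x` and `c y` are both good on a common nonempty open set, hence
    -- differ by a summable sequence.
    refine isPreconnected_connectedComponentIn.subset_of_closure_inter_subset hGo
      ⟨x, mem_connectedComponentIn hx, hc x hx⟩ ?_
    rintro y ⟨hyG, hyx⟩
    have hyΩ : y ∈ Ω := connectedComponentIn_subset _ _ hyx
    obtain ⟨r, hr, hy⟩ := hc y hyΩ
    obtain ⟨z, ⟨s, hs, hz⟩, hzy⟩ := Metric.mem_closure_iff.1 hyG r hr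
    set S := Metric.ball z s ∩ Metric.ball y r with hS
    have hS0 : volume S ≠ 0 :=
      ((Metric.isOpen_ball.inter Metric.isOpen_ball).measure_pos volume
        ⟨z, Metric.mem_ball_self hs, by rwa [Metric.mem_ball, dist_comm]⟩).ne'
    have hcc := tsum_enorm_sub_ne_top hcont hS0 (hmono (y := y) hy inter_subset_right)
      (hmono (y := y) hz inter_subset_left)
    exact ⟨r, hr, tsum_lintegral_sub_ne_top_of_sub hcont measure_ball_lt_top.ne hy hcc⟩
  -- choose one normalization for each component
  classical
  set rep : Vec d → Vec d := fun x =>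
    (fun S : Set (Vec d) => if hS : S.Nonempty then hS.some else 0) (connectedComponentIn Ω x)
    with hrep
  have hrepmem : ∀ x ∈ Ω, rep x ∈ connectedComponentIn Ω x := by
    intro x hx
    have hne : (connectedComponentIn Ω x).Nonempty := ⟨x, mem_connectedComponentIn hx⟩
    simp only [hrep, dif_pos hne]
    exact hne.some_mem
  -- The representative is chosen from the component as a set, so it is the same for all points of
  -- that component.
  have hrepeq : ∀ x ∈ Ω, ∀ᶠ y in 𝓝 x, rep y = rep x := by
    intro x hx
    filter_upwards [hΩ.connectedComponentIn.mem_nhds (mem_connectedComponentIn hx)] with y hy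
    simp only [hrep, ← connectedComponentIn_eq hy]
  refine ⟨fun n x => c (rep x) n, fun x hx => ?_, fun K hK hKΩ => ?_⟩
  · filter_upwards [hrepeq x hx] with y hy n
    rw [hy]
  · refine hK.induction_on (p := fun K => ∑' n, ∫⁻ x in K, ‖u n x - c (rep x) n‖ₑ ≠ ⊤)
      (by simp) (fun s t hst ht => ?_) (fun s t hs ht => ?_) fun x hx => ?_
    · exact ne_top_of_le_ne_top ht (ENNReal.tsum_le_tsum fun n => lintegral_mono_set hst)
    · refine ne_top_of_le_ne_top (ENNReal.add_ne_top.2 ⟨hs, ht⟩) ?_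
      rw [← ENNReal.tsum_add]
      exact ENNReal.tsum_le_tsum fun n => lintegral_union_le _ _ _
    · have hxΩ := hKΩ hx
      have hr := hrepmem x hxΩ
      have hrΩ : rep x ∈ Ω := connectedComponentIn_subset _ _ hr
      have hxr : x ∈ connectedComponentIn Ω (rep x) := by
        rw [← connectedComponentIn_eq hr]
        exact mem_connectedComponentIn hxΩ
      obtain ⟨r, hr0, hball⟩ := hcomp _ hrΩ x hxr
      obtain ⟨s, hs, hseq⟩ := Metric.eventually_nhds_iff_ball.1 (hrepeq x hxΩ)
      refine ⟨Metric.ball x (min r s), mem_nhdsWithin_of_mem_nhds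
        (Metric.ball_mem_nhds _ (lt_min hr0 hs)), ne_top_of_le_ne_top hball
          (ENNReal.tsum_le_tsum fun n => ?_)⟩
      refine le_trans (le_of_eq ?_) (lintegral_mono_set
        (Metric.ball_subset_ball (min_le_left r s)))
      refine setLIntegral_congr_fun Metric.isOpen_ball.measurableSet fun y hy => ?_
      simp only [hseq y (Metric.ball_subset_ball (min_le_right r s) hy)]

/-- A field that is a locally rapid limit of gradients on `Ω` is a weak gradient on `Ω`. -/
theorem exists_hasWeakGradient_of_tsum {Ω : Set (Vec d)} (hΩ : IsOpen Ω) {α : Vec d → Vec d}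
    (hα : LocallyIntegrableOn α Ω volume) {ψ : ℕ → Vec d → ℝ}
    (hψ : ∀ n, ContDiff ℝ (⊤ : ℕ∞) (ψ n))
    (hsum : ∀ K, IsCompact K → K ⊆ Ω → ∑' n, ∫⁻ x in K, ‖gradient (ψ n) x - α x‖ₑ ≠ ⊤) :
    ∃ H, HasWeakGradient Ω H α := by
  have hαm : ∀ K, IsCompact K → K ⊆ Ω → ∀ n, AEMeasurable (fun x => ‖gradient (ψ n) x - α x‖ₑ)
      (volume.restrict K) := fun K hK hKΩ n =>
    ((hψ n).continuous_gradient.aestronglyMeasurable.sub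
      (hα.integrableOn_compact_subset hKΩ hK).1).enorm
  -- The `ψ n` themselves need not converge. Their increments have summable gradients, hence become
  -- summable after subtracting locally constant `δ n`, and the potential is the resulting series.
  set u : ℕ → Vec d → ℝ := fun n x => ψ (n + 1) x - ψ n x with hu
  have hus : ∀ n, ContDiff ℝ (⊤ : ℕ∞) (u n) := fun n => (hψ _).sub (hψ n)
  have husum : ∀ K, IsCompact K → K ⊆ Ω → ∑' n, ∫⁻ x in K, ‖gradient (u n) x‖ₑ ≠ ⊤ := by
    intro K hK hKΩ
    have h1 : ∑' n, ∫⁻ x in K, ‖gradient (u n) x‖ₑ ≤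
        ∑' n, ((∫⁻ x in K, ‖gradient (ψ (n + 1)) x - α x‖ₑ) +
          ∫⁻ x in K, ‖gradient (ψ n) x - α x‖ₑ) := by
      refine ENNReal.tsum_le_tsum fun n => ?_
      rw [← lintegral_add_left' (hαm K hK hKΩ _)]
      refine lintegral_mono fun x => ?_
      have : gradient (u n) x = (gradient (ψ (n + 1)) x - α x) - (gradient (ψ n) x - α x) := by
        rw [sub_sub_sub_cancel_right]
        exact gradient_sub ((hψ _).differentiable (by simp) x) ((hψ _).differentiable (by simp) x)
      rw [this]
      exact enorm_sub_le
    refine ne_top_of_le_ne_top ?_ h1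
    rw [ENNReal.tsum_add]
    refine ENNReal.add_ne_top.2 ⟨ne_top_of_le_ne_top (hsum K hK hKΩ) ?_, hsum K hK hKΩ⟩
    exact ENNReal.tsum_comp_le_tsum_of_injective (add_left_injective 1)
      fun n => ∫⁻ x in K, ‖gradient (ψ n) x - α x‖ₑ
  obtain ⟨δ, hδ, hδsum⟩ := exists_locallyConstant_tsum_ne_top hΩ hus husum
  -- the normalized approximations
  set h : ℕ → Vec d → ℝ := fun N x => ψ 0 x + ∑ n ∈ Finset.range N, (u n x - δ n x) with hh
  set H : Vec d → ℝ := fun x => ψ 0 x + ∑' n, (u n x - δ n x) with hH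
  -- The sum telescopes and the `δ n` are constant near `x`, so the normalization does not affect
  -- gradients.
  have hlocal : ∀ N, ∀ x ∈ Ω, ∃ C, h N =ᶠ[𝓝 x] fun y => ψ N y - C := by
    intro N x hx
    refine ⟨∑ n ∈ Finset.range N, δ n x, ?_⟩
    filter_upwards [hδ x hx] with y hy
    have htel := Finset.sum_range_sub (fun n => ψ n y) N
    simp only [Finset.sum_sub_distrib] at htel
    simp only [hh, hu, Finset.sum_sub_distrib, hy]
    linarith
  have hhd : ∀ N, ∀ x ∈ Ω, DifferentiableAt ℝ (h N) x := fun N x hx => by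
    obtain ⟨C, hC⟩ := hlocal N x hx
    exact (((hψ N).differentiable (by simp) x).sub_const C).congr_of_eventuallyEq hC
  have hhgrad : ∀ N, ∀ x ∈ Ω, gradient (h N) x = gradient (ψ N) x := fun N x hx => by
    obtain ⟨C, hC⟩ := hlocal N x hx
    rw [hC.gradient_eq, gradient_sub ((hψ N).differentiable (by simp) x)
      (differentiableAt_const _), gradient_fun_const, sub_zero]
  have hhcont : ∀ N, ContinuousOn (h N) Ω := fun N x hx =>
    (hhd N x hx).continuousAt.continuousWithinAt
  have hδm : ∀ K, IsCompact K → K ⊆ Ω → ∀ n, AEMeasurable (fun x => ‖u n x - δ n x‖ₑ)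
      (volume.restrict K) := by
    intro K hK hKΩ n
    have hc : ContinuousOn (fun x => u n x - δ n x) K := by
      refine (hus n).continuous.continuousOn.sub fun x hx => ?_
      have : δ n =ᶠ[𝓝 x] fun _ => δ n x := (hδ x (hKΩ hx)).mono fun y hy => hy n
      exact (continuousAt_const.congr this.symm).continuousWithinAt
    exact (hc.aestronglyMeasurable hK.measurableSet).enorm
  have hae : ∀ K, IsCompact K → K ⊆ Ω → ∀ᵐ x ∂volume.restrict K,
      ∑' n, ‖u n x - δ n x‖ₑ ≠ ⊤ := by
    intro K hK hKΩ
    have h1 := hδsum K hK hKΩ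
    rw [← lintegral_tsum (hδm K hK hKΩ)] at h1
    exact (ae_lt_top' (AEMeasurable.tsum (hδm K hK hKΩ)) h1).mono fun x hx => hx.ne
  have hsummable : ∀ x, ∑' n, ‖u n x - δ n x‖ₑ ≠ ⊤ → Summable fun n => u n x - δ n x := by
    intro x hx
    refine Summable.of_norm ?_
    have := ENNReal.summable_toReal hx
    simpa using this
  have hhlim : ∀ K, IsCompact K → K ⊆ Ω → ∀ᵐ x ∂volume.restrict K,
      Tendsto (fun N => h N x) atTop (𝓝 (H x)) := by
    intro K hK hKΩ
    filter_upwards [hae K hK hKΩ] with x hx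
    exact (hsummable x hx).hasSum.tendsto_sum_nat.const_add _
  have hhL1 : ∀ K, IsCompact K → K ⊆ Ω →
      Tendsto (fun N => ∫⁻ x in K, ‖h N x - H x‖ₑ) atTop (𝓝 0) := by
    intro K hK hKΩ
    refine tendsto_of_tendsto_of_tendsto_of_le_of_le tendsto_const_nhds
      (ENNReal.tendsto_sum_nat_add _ (hδsum K hK hKΩ)) (fun _ => zero_le) fun N => ?_
    simp only
    rw [← lintegral_tsum fun n => hδm K hK hKΩ (n + N)]
    refine lintegral_mono_ae ?_
    filter_upwards [hae K hK hKΩ] with x hx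
    have hs := hsummable x hx
    have e1 : h N x - H x = - ∑' n, (u (n + N) x - δ (n + N) x) := by
      simp only [hh, hH]
      rw [← hs.sum_add_tsum_nat_add N]
      ring
    rw [e1, enorm_neg]
    have hs' : Summable fun n => ‖u (n + N) x - δ (n + N) x‖ :=
      (summable_nat_add_iff N).2 hs.norm
    rw [← ofReal_norm]
    refine (ENNReal.ofReal_le_ofReal (norm_tsum_le_tsum_norm hs')).trans ?_
    rw [ENNReal.ofReal_tsum_of_nonneg (fun _ => norm_nonneg _) hs']
    simp only [ofReal_norm]
    exact le_rfl
  have hhint : ∀ N K, IsCompact K → K ⊆ Ω → IntegrableOn (h N) K volume := fun N K hK hKΩ =>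
    ((hhcont N).mono hKΩ).integrableOn_compact hK
  have hHm : ∀ K, IsCompact K → K ⊆ Ω → AEStronglyMeasurable H (volume.restrict K) :=
    fun K hK hKΩ => aestronglyMeasurable_of_tendsto_ae atTop
      (fun N => (hhint N K hK hKΩ).1) (hhlim K hK hKΩ)
  have hHint : LocallyIntegrableOn H Ω volume := by
    rw [locallyIntegrableOn_iff hΩ.isLocallyClosed]
    intro K hKΩ hK
    obtain ⟨N, hN⟩ := ((ENNReal.tendsto_nhds_zero.1 (hhL1 K hK hKΩ)) 1 one_pos).exists
    have h1 : Integrable (fun x => h N x - H x) (volume.restrict K) :=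
      ⟨(hhint N K hK hKΩ).1.sub (hHm K hK hKΩ), hN.trans_lt ENNReal.one_lt_top⟩
    exact ((hhint N K hK hKΩ).sub h1).congr (Eventually.of_forall fun x => by simp)
  refine ⟨H, hHint, hα, fun φ hφ i => ?_⟩
  set K := tsupport φ with hK
  have hKc : IsCompact K := hφ.2.1.isCompact
  have hφi := hφ.gradient_apply i
  have hzφ : ∀ x, x ∉ K → φ x = 0 := fun x hx => image_eq_zero_of_notMem_tsupport hx
  have hzg : ∀ x, x ∉ K → gradient φ x i = 0 := fun x hx => by
    rw [gradient_eq_zero_of_notMem_tsupport hx, PiLp.zero_apply]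
  obtain ⟨C, hC⟩ := hφ.2.1.exists_bound_of_continuous hφ.1.continuous
  obtain ⟨C', hC'⟩ := hφi.2.1.exists_bound_of_continuous hφi.1.continuous
  -- integration by parts for the approximations
  have hparts : ∀ N, ∫ x in K, (inner ℝ (gradient φ x i) (h N x) : ℝ) =
      - ∫ x in K, (inner ℝ (φ x • EuclideanSpace.single i (1 : ℝ)) (gradient (ψ N) x) : ℝ) := by
    intro N
    have hloc : LocallyIntegrableOn (h N) Ω volume := (hhcont N).locallyIntegrableOn hΩ.measurableSet
    have hgloc : LocallyIntegrableOn (fun x => fderiv ℝ (h N) x (EuclideanSpace.single i 1)) Ω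
        volume := by
      refine ContinuousOn.locallyIntegrableOn ?_ hΩ.measurableSet
      refine (((hψ N).gradient_apply i).continuous.continuousOn).congr fun x hx => ?_
      rw [← gradient_apply_eq_fderiv, hhgrad N x hx]
    have key := integral_mul_fderiv_eq_neg_fderiv_mul_of_integrable (μ := volume)
      (f := h N) (g := φ) (v := EuclideanSpace.single i 1)
      (by
        have := LocallyIntegrableOn.integrable_smul_of_tsupport_subset hgloc hφ.1.continuous
          hφ.2.1 hφ.2.2
        simpa [mul_comm] using this)
      (by
        have := LocallyIntegrableOn.integrable_smul_of_tsupport_subset hloc hφi.1.continuous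
          hφi.2.1 hφi.2.2
        simpa [mul_comm, gradient_apply_eq_fderiv] using this)
      (by
        have := LocallyIntegrableOn.integrable_smul_of_tsupport_subset hloc hφ.1.continuous
          hφ.2.1 hφ.2.2
        simpa [mul_comm] using this)
      (fun x hx => hhd N x (hφ.2.2 hx)) (fun x _ => hφ.1.differentiable (by simp) x)
    have e1 : ∫ x in K, (inner ℝ (gradient φ x i) (h N x) : ℝ) =
        ∫ x, h N x * fderiv ℝ φ x (EuclideanSpace.single i 1) := by
      rw [setIntegral_eq_integral_of_forall_compl_eq_zero fun x hx => by
        rw [hzg x hx, inner_zero_left]]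
      simp [gradient_apply_eq_fderiv]
    have e2 : ∫ x in K, (inner ℝ (φ x • EuclideanSpace.single i (1 : ℝ)) (gradient (ψ N) x) : ℝ) =
        ∫ x, fderiv ℝ (h N) x (EuclideanSpace.single i 1) * φ x := by
      rw [setIntegral_eq_integral_of_forall_compl_eq_zero fun x hx => by
        rw [hzφ x hx, zero_smul, inner_zero_left]]
      refine integral_congr_ae (Eventually.of_forall fun x => ?_)
      by_cases hx : x ∈ K
      · simp only
        rw [← gradient_apply_eq_fderiv, hhgrad N x (hφ.2.2 hx), inner_smul_left,
          EuclideanSpace.inner_single_left]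
        simp [mul_comm]
      · simp [hzφ x hx]
    rw [e1, e2, key]
  -- Both sides of the identity pair a fixed bounded function with an `L¹`-convergent sequence: `h N
  -- → H` on the left, `∇ψ N → α` on the right.
  have lim1 := tendsto_integral_inner_of_L1 (μ := volume.restrict K) (M := C')
    hφi.1.continuous.aestronglyMeasurable (Eventually.of_forall hC')
    (Eventually.of_forall fun N => hhint N K hKc hφ.2.2) (hHm K hKc hφ.2.2) (hhL1 K hKc hφ.2.2)
  have hgi : ∀ N, IntegrableOn (gradient (ψ N)) K volume := fun N =>
    (hψ N).continuous_gradient.continuousOn.integrableOn_compact hKc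
  have lim2 := tendsto_integral_inner_of_L1 (μ := volume.restrict K) (M := C)
    (V := fun x => φ x • EuclideanSpace.single i (1 : ℝ))
    (hφ.1.continuous.smul continuous_const).aestronglyMeasurable
    (Eventually.of_forall fun x => by simpa [norm_smul] using hC x)
    (Eventually.of_forall hgi) (hα.integrableOn_compact_subset hφ.2.2 hKc).1
    (ENNReal.tendsto_atTop_zero_of_tsum_ne_top (hsum K hKc hφ.2.2))
  have heq := tendsto_nhds_unique (lim1.congr hparts) lim2.neg
  have f1 : ∫ x in Ω, H x * gradient φ x i = ∫ x in K, (inner ℝ (gradient φ x i) (H x) : ℝ) := by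
    rw [setIntegral_eq_of_subset_of_forall_sdiff_eq_zero hΩ.measurableSet hφ.2.2
      fun x hx => by rw [hzg x hx.2, mul_zero]]
    exact integral_congr_ae (Eventually.of_forall fun x => by simp)
  have f2 : ∫ x in Ω, α x i * φ x =
      ∫ x in K, (inner ℝ (φ x • EuclideanSpace.single i (1 : ℝ)) (α x) : ℝ) := by
    rw [setIntegral_eq_of_subset_of_forall_sdiff_eq_zero hΩ.measurableSet hφ.2.2
      fun x hx => by rw [hzφ x hx.2, mul_zero]]
    refine integral_congr_ae (Eventually.of_forall fun x => ?_)
    simp [inner_smul_left, EuclideanSpace.inner_single_left, mul_comm]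
  rw [f1, f2, heq]

/-- A locally bounded field orthogonal to all divergence-free fields is a weak gradient. -/
theorem IsOrthogonalToDivFree.exists_hasWeakGradient {Ω : Set (Vec d)} (hΩ : IsOpen Ω)
    {α : Vec d → Vec d} (h : IsOrthogonalToDivFree Ω α) : ∃ H, HasWeakGradient Ω H α := by
  obtain ⟨ψ, hψ, hsum⟩ := h.exists_tsum_gradient_sub_ne_top hΩ
  exact exists_hasWeakGradient_of_tsum hΩ h.locallyIntegrableOn hψ hsum

/-- Weak gradients are curl-free. -/
theorem HasWeakGradient.isWeaklyCurlFree {Ω : Set (Vec d)} {H : Vec d → ℝ} {A : Vec d → Vec d}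
    (h : HasWeakGradient Ω H A) : IsWeaklyCurlFree Ω A := by
  refine ⟨h.2.1, fun φ hφ i j => ?_⟩
  have hi : ∀ k l, IntegrableOn (fun x => A x k * gradient φ x l) Ω := fun k l => by
    have := (LocallyIntegrableOn.integrable_smul_of_tsupport_subset (h.2.1.euclidean_apply k)
      (hφ.gradient_apply l).1.continuous (hφ.gradient_apply l).2.1
      (hφ.gradient_apply l).2.2).integrableOn (s := Ω)
    simpa [mul_comm] using this
  -- Testing the weak gradient with `∂ᵢφ` in direction `j` and with `∂ⱼφ` in direction `i` gives the
  -- same left-hand side, by symmetry of the Hessian.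
  have hsymm : ∀ x, gradient (fun y => gradient φ y i) x j = gradient (fun y => gradient φ y j) x i :=
    fun x => by
      have hd : DifferentiableAt ℝ (fderiv ℝ φ) x :=
        (hφ.1.fderiv_right (m := (⊤ : ℕ∞)) (by simp)).differentiable (by simp) x
      have hs : IsSymmSndFDerivAt ℝ φ x :=
        (hφ.1.contDiffAt (x := x)).isSymmSndFDerivAt
          (by simpa using (WithTop.coe_le_coe.2 le_top : (2 : WithTop ℕ∞) ≤ ((⊤ : ℕ∞) : WithTop ℕ∞)))
      simp only [gradient_apply_eq_fderiv]
      rw [fderiv_clm_apply hd (differentiableAt_const _),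
        fderiv_clm_apply hd (differentiableAt_const _)]
      simpa using hs _ _
  have h1 := h.2.2 _ (hφ.gradient_apply i) j
  have h2 := h.2.2 _ (hφ.gradient_apply j) i
  simp only [hsymm] at h1
  rw [integral_sub (hi j i) (hi i j)]
  linarith

end Potentials

/-! ### Proof of the theorem -/

/-- The gauge flow of a limit shape without facets is orthogonal to divergence-free fields. -/
lemma IsLimitShape.isOrthogonalToDivFree {d : ℕ} {Λ : DimerLattice d} {R : Set (Vec d)}
    (hR : IsCompact R) {b : SignedMeasure (Vec d)} {ω : Vec d → Vec d}
    (hω : IsLimitShape Λ R b ω) (hfree : IsFacetFree Λ R ω) :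
    IsOrthogonalToDivFree (interior R) (gaugeFlow Λ ω) where
  locallyIntegrableOn := hfree.locallyIntegrableOn_gaugeFlow hω.1.1
  exists_norm_le _ hK hKR := hfree.exists_norm_gaugeFlow_le hK hKR
  integral_inner_eq_zero _ _ _ hVm hM hK hKR hVK hdiv :=
    hω.integral_inner_gaugeFlow_eq_zero hR hfree hVm hM hK hKR hVK hdiv

lemma IsWeaklyDivFree.congr_ae {d : ℕ} {Ω : Set (Vec d)} (hΩ : MeasurableSet Ω)
    {V W : Vec d → Vec d} (hV : IsWeaklyDivFree Ω V) (h : ∀ᵐ x, x ∈ Ω → W x = V x) :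
    IsWeaklyDivFree Ω W := by
  have h' : W =ᵐ[volume.restrict Ω] V := (ae_restrict_iff' hΩ).2 h
  refine ⟨hV.1.congr h'.symm, fun φ hφ => ?_⟩
  rw [← hV.2 φ hφ]
  exact integral_congr_ae (h'.mono fun x hx => by simp only [hx])

theorem mainTheorem9 {d : ℕ} (Λ : DimerLattice d) (R : Set (Vec d))
    (hR_compact : IsCompact R) (hR_connected : IsConnected R)
    (hR_domain : closure (interior R) = R) (hR_boundary : volume (frontier R) = 0)
    (b : SignedMeasure (Vec d)) :
    -- the gauge flow of a limit shape solves the dual Euler-Lagrange equations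
    (∀ ω : Vec d → Vec d, IsLimitShape Λ R b ω → IsFacetFree Λ R ω →
      (∀ᵐ x, x ∈ interior R → gradient Λ.freeEnergy (gaugeFlow Λ ω x) = ω x) ∧
      IsWeaklyDivFree (interior R) (fun x => gradient Λ.freeEnergy (gaugeFlow Λ ω x)) ∧
      IsWeaklyCurlFree (interior R) (gaugeFlow Λ ω) ∧
      -- it is the gradient of a weak solution of the gauge equation
      (∃ H₀ : Vec d → ℝ, IsWeakGaugeSolution Λ (interior R) H₀ (gaugeFlow Λ ω)) ∧
      -- which is determined by its boundary values
      (∀ H₀ Hb : Vec d → ℝ, HasWeakGradient (interior R) H₀ (gaugeFlow Λ ω) →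
        HasBoundaryValues R H₀ Hb →
        ∀ (H : Vec d → ℝ) (A : Vec d → Vec d), IsWeakGaugeSolution Λ (interior R) H A →
          HasBoundaryValues R H Hb →
          ∀ᵐ x, x ∈ interior R → gaugeFlow Λ ω x = A x ∧ H₀ x = H x)) ∧
    -- conversely, a solution `A` of the dual Euler-Lagrange equations (in particular `A = ∇H` for a
    -- weak solution `H` of the gauge equation) whose dual flow has boundary value `b` is the gauge
    -- flow of the limit shape, and is the only such solution
    (∀ A : Vec d → Vec d, IsWeaklyDivFree (interior R) (fun x => gradient Λ.freeEnergy (A x)) →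
      IsWeaklyCurlFree (interior R) A → IsGradientUpToBoundary R A →
      HasBoundaryFlux R (dualFlow Λ R A) b →
      IsLimitShape Λ R b (dualFlow Λ R A) ∧
      ∀ ω : Vec d → Vec d, IsLimitShape Λ R b ω →
        ∀ᵐ x, x ∈ interior R →
          gradient Λ.freeEnergy (A x) = ω x ∧ gaugeFlow Λ ω x = A x) := by
  refine ⟨fun ω hω hfree => ?_, fun A hdiv hcurl hgrad hflux => ?_⟩
  · have hgrad := hfree.ae_gradient_gaugeFlow
    have hdiv : IsWeaklyDivFree (interior R)
        (fun x => gradient Λ.freeEnergy (gaugeFlow Λ ω x)) :=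
      hω.1.2.2.1.congr_ae isOpen_interior.measurableSet hgrad
    -- Orthogonality to all compactly supported bounded divergence-free fields yields a
    -- single-valued potential whatever the topology of the interior; vanishing of the curl is then
    -- read off from the potential.
    obtain ⟨H₀, hH₀⟩ :=
      (hω.isOrthogonalToDivFree hR_compact hfree).exists_hasWeakGradient isOpen_interior
    exact ⟨hgrad, hdiv, hH₀.isWeaklyCurlFree, ⟨H₀, hH₀, hdiv⟩,
      fun H₁ Hb hH₁ hb H A hHA hb' =>
        IsWeakGaugeSolution.ae_eq hR_compact ⟨hH₁, hdiv⟩ hHA hb hb'⟩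
  · exact isLimitShape_dualFlow hR_compact hR_boundary hdiv hcurl.1.aestronglyMeasurable hgrad hflux
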